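/- Let $d_1,d_2,d'\ge 1$ be integers, $A=\mathbb R^{d'}$, $T>0$, $\epsilon>0$. Let $b:\mathbb R^{d_1}\times A\to\mathbb R^{d_1}$, $\ell:A\to\mathbb R$, $L:\mathbb R^{d_1}\times\mathbb R^{d_2}\to\mathbb R$ satisfy the following. (i) All derivatives $\nabla_x^k\nabla_a^l b$ with $0\le k+l\le 4$ exist and are jointly continuous, there is $C\ge 0$ with $|\nabla_x^k\nabla_a^l b(x,a)|\le C(1+|a|^{k+1})(1+|x|^l)$ for all $x,a$ and all $k+l\le 4$, and $b(x,0)=0$ for all $x$. (ii) $\ell$ is convex and $C^2$, and there is $c>0$ with $\nabla^2\ell(a)\ge c(1+|a|^2)I_{d'}$ for all $a$. Set $\nu^\infty(da)=\frac{1}{z^\infty}e^{-\ell(a)}da$ with $z^\infty=\int_A e^{-\ell(a)}da$. (iii) $L$ is bounded from below and three times differentiable, with $|L(x,y)|\le C(1+|x|^2+|y|^2)$ and $|\nabla^kL(x,y)|\le C(1+|x|+|y|)$ for $k=1,2,3$. For $p\ge 1$, let $\mathcal P_p$ be the set of Borel probability measures on $\mathbb R^{d_1}\times\mathbb R^{d_2}$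 with finite moment of order $p$, with the Wasserstein distance of order $p$. Let $(t_0,\gamma_0)\in[0,T]\times\mathcal P_3$. Let $\mathcal A(t_0)$ be the set of measurable maps $\boldsymbol\nu:t\in[t_0,T]\mapsto\nu_t\in\mathcal P(A)$ such that $\int_{t_0}^T\mathcal E(\nu_t|\nu^\infty)\,dt<\infty$, where $\mathcal E$ is the relative entropy. Write $b(x,\nu)=\int_A b(x,a)\,d\nu(a)$. Given $\boldsymbol\nu\in\mathcal A(t_0)$: - a solution of the continuity equation $\partial_t\gamma_t+\operatorname{div}_x(b(x,\nu_t)\gamma_t)=0$, $\gamma_{t_0}=\gamma_0$, is a curve $\boldsymbol\gamma\in\mathcal C([t_0,T],\mathcal P_2)$ such that, for every $C^1$ function $\varphi$ on $[t_0,T]\times\mathbb R^{d_1}\times\mathbb R^{d_2}$ that is bounded with bounded first derivatives, and every $t_1\in[t_0,T]$, $$\int\varphi_{t_1}\,d\gamma_{t_1}=\int\varphi_{t_0}\,d\gamma_0+\int_{t_0}^{t_1}\!\int\{\partial_t\varphi_t+b(x,\nu_t)\cdot\nabla_x\varphi_t\}\,d\gamma_t\,dt;$$ - a solution of the backward transport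 equation $-\partial_tu_t-b(x,\nu_t)\cdot\nabla_xu_t=0$, $u_T=L$, is a function $\boldsymbol u\in\mathcal C^{1/2}([t_0,T],\mathcal C^1_{2,1})$ with $u_t(x,y)=L(x,y)+\int_t^Tb(x,\nu_s)\cdot\nabla_xu_s(x,y)\,ds$ for all $t\in[t_0,T]$ and all $(x,y)$. Here $\mathcal C^1_{2,1}$ is the space of $C^1$ functions $\varphi$ on $\mathbb R^{d_1}\times\mathbb R^{d_2}$ such that $$\sup_{x,y}\frac{|\varphi(x,y)|}{1+|x|^2+|y|^2}+\sup_{x,y}\frac{|\nabla\varphi(x,y)|}{1+|x|+|y|}<\infty,$$ with this quantity as norm. Put $J((t_0,\gamma_0),\boldsymbol\nu)=\int L\,d\gamma_T+\epsilon\int_{t_0}^T\mathcal E(\nu_t|\nu^\infty)\,dt$, where $\boldsymbol\gamma$ is the solution of the continuity equation started at $\gamma_0$ and driven by $\boldsymbol\nu$. **Theorem (first-order optimality conditions).** Let $\boldsymbol\nu^*$ be a minimizer of $J((t_0,\gamma_0),\cdot)$ over $\mathcal A(t_0)$. The continuity equation started at $\gamma_0$ and driven by $\boldsymbol\nu^*$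 has a unique solution $\boldsymbol\gamma^*$, and the backward transport equation driven by $\boldsymbol\nu^*$ has a unique solution $\boldsymbol u^*$. The pair $(\boldsymbol u^*,\boldsymbol\gamma^*)$ thus solves the forward-backward system $$-\partial_tu^*_t-b(x,\nu^*_t)\cdot\nabla_xu^*_t=0,\quad u^*_T=L;\qquad \partial_t\gamma^*_t+\operatorname{div}_x(b(x,\nu^*_t)\gamma^*_t)=0,\quad \gamma^*_{t_0}=\gamma_0.$$ Moreover $\boldsymbol\nu^*$ admits a jointly continuous density $(t,a)\in[t_0,T]\times A\mapsto\nu^*_t(a)$, given for all $(t,a)\in[t_0,T]\times A$ by $$\nu^*_t(a)=\frac1{z^*_t}\exp\Bigl(-\ell(a)-\frac1\epsilon\int b(x,a)\cdot\nabla_xu^*_t(x,y)\,d\gamma^*_t(x,y)\Bigr),$$ where the integral converges absolutely and $z^*_t\in(0,\infty)$ is the normalizing constant. That this is a density of $\boldsymbol\nu^*$ means that, for Lebesgue-almost every $t\in[t_0,T]$, the measure $\nu^*_t$ equals $\nu^*_t(a)\,da$. -/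

import Mathlib

open MeasureTheory Set Filter Topology
open scoped ENNReal

noncomputable section

namespace MeanFieldResNet

/-- The Euclidean space `ℝ^d`. -/
abbrev Vec (d : ℕ) : Type := EuclideanSpace ℝ (Fin d)

/-- The state space `ℝ^{d₁} × ℝ^{d₂}` of pairs (feature, label). -/
abbrev State (d₁ d₂ : ℕ) : Type := Vec d₁ × Vec d₂

/-- The regularity assumption on the velocity field `b`, the potential `ℓ` and the final cost `L`.
The parameter space is `A = ℝ^m`. -/
structure Regularity {d₁ d₂ m : ℕ} (b : Vec d₁ → Vec m → Vec d₁) (ℓ : Vec m → ℝ)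
    (L : State d₁ d₂ → ℝ) : Prop where
  /-- All the derivatives `∇_x^k ∇_a^l b`, `k + l ≤ 4`, exist and are jointly continuous. -/
  b_smooth : ContDiff ℝ 4 (fun p : Vec d₁ × Vec m => b p.1 p.2)
  /-- `|∇_x^k ∇_a^l b(x,a)| ≤ C (1 + |a|^{k+1}) (1 + |x|^l)` for `k + l ≤ 4`. -/
  b_growth : ∃ C : ℝ, ∀ k l : ℕ, k + l ≤ 4 → ∀ (x : Vec d₁) (a : Vec m),
    ‖iteratedFDeriv ℝ k (fun x' => iteratedFDeriv ℝ l (fun a' => b x' a') a) x‖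
      ≤ C * (1 + ‖a‖ ^ (k + 1)) * (1 + ‖x‖ ^ l)
  b_zero : ∀ x, b x 0 = 0
  ell_smooth : ContDiff ℝ 2 ℓ
  ell_convex : ConvexOn ℝ univ ℓ
  /-- `∇² ℓ(a) ≥ c (1 + |a|²) I` as quadratic forms. -/
  ell_hessian : ∃ c : ℝ, 0 < c ∧ ∀ a v : Vec m,
    c * (1 + ‖a‖ ^ 2) * ‖v‖ ^ 2 ≤ iteratedFDeriv ℝ 2 ℓ a ![v, v]
  L_bddBelow : ∃ C : ℝ, ∀ z, C ≤ L z
  /-- `L` is three times differentiable (the third derivative need not be continuous). -/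
  L_two : ContDiff ℝ 2 L
  L_three : Differentiable ℝ (iteratedFDeriv ℝ 2 L)
  /-- Growth: `L` is at most quadratic, its derivatives of order 1, 2, 3 are at most linear. -/
  L_growth : ∃ C : ℝ, ∀ z : State d₁ d₂,
    |L z| ≤ C * (1 + ‖z.1‖ ^ 2 + ‖z.2‖ ^ 2) ∧
    ∀ k : ℕ, 1 ≤ k → k ≤ 3 → ‖iteratedFDeriv ℝ k L z‖ ≤ C * (1 + ‖z.1‖ + ‖z.2‖)

/-- The prior `ν^∞(da) = (1 / z^∞) exp(-ℓ(a)) da`, with `z^∞ = ∫ exp(-ℓ(a)) da`. -/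
def prior {m : ℕ} (ℓ : Vec m → ℝ) : Measure (Vec m) :=
  volume.withDensity fun a => ENNReal.ofReal ((∫ a', Real.exp (-ℓ a'))⁻¹ * Real.exp (-ℓ a))

/-- The set `𝒜(t₀)` of admissible controls: measurable maps `ν : [t₀,T] → 𝒫(A)` with
`∫_{t₀}^T ℰ(ν_t | ν^∞) dt < ∞`. Only the values of `ν` on `[t₀,T]` matter; for probability measures
`klDiv` is the relative entropy `ℰ`. -/
def AdmissibleControls {m : ℕ} (ℓ : Vec m → ℝ) (t₀ T : ℝ) : Set (ℝ → Measure (Vec m)) :=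
  {ν | (∀ t ∈ Icc t₀ T, IsProbabilityMeasure (ν t)) ∧
    Measurable (fun t : Icc t₀ T => ν t) ∧
    ∫⁻ t in Icc t₀ T, InformationTheory.klDiv (ν t) (prior ℓ) < ⊤}

/-- The averaged velocity field `b(x,ν) = ∫_A b(x,a) dν(a)`. -/
def avgField {d₁ m : ℕ} (b : Vec d₁ → Vec m → Vec d₁) (x : Vec d₁) (ν : Measure (Vec m)) :
    Vec d₁ :=
  ∫ a, b x a ∂ν

/-- The partial gradient `∇_x f(x,y)`. -/
def gradX {d₁ d₂ : ℕ} (f : State d₁ d₂ → ℝ) (z : State d₁ d₂) : Vec d₁ :=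
  gradient (fun x => f (x, z.2)) z.1

/-- `γ ∈ 𝒫_p(ℝ^{d₁} × ℝ^{d₂})`: a probability measure with `∫ (|x|² + |y|²)^{p/2} dγ < ∞`. -/
def InP {d₁ d₂ : ℕ} (p : ℝ) (γ : Measure (State d₁ d₂)) : Prop :=
  IsProbabilityMeasure γ ∧
    ∫⁻ z, ENNReal.ofReal ((‖z.1‖ ^ 2 + ‖z.2‖ ^ 2) ^ (p / 2)) ∂γ < ⊤

/-- The Monge-Kantorovich-Rubinstein (Wasserstein) distance of order 2 on `ℝ^{d₁} × ℝ^{d₂}` with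
its Euclidean distance: the infimum runs over the couplings of `μ` and `μ'`. -/
def dist2 {d₁ d₂ : ℕ} (μ μ' : Measure (State d₁ d₂)) : ℝ≥0∞ :=
  (⨅ (π : Measure (State d₁ d₂ × State d₁ d₂)) (_ : π.map Prod.fst = μ)
    (_ : π.map Prod.snd = μ'),
      ∫⁻ q, ENNReal.ofReal (‖q.1.1 - q.2.1‖ ^ 2 + ‖q.1.2 - q.2.2‖ ^ 2) ∂π) ^ (1 / 2 : ℝ)

/-- `γ ∈ 𝒞([t₀,T], 𝒫₂)` is a solution of `∂_t γ_t + div_x(b(x,ν_t) γ_t) = 0`, `γ_{t₀} = γ₀`: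
the weak formulation holds for all test functions that are `C¹` and bounded with bounded
first derivatives on `[t₀,T] × ℝ^{d₁} × ℝ^{d₂}`. (A `C¹_b` function on this closed strip is the
restriction of a `C¹` function on the whole space, so test functions are taken of this form.) -/
structure IsContinuitySolution {d₁ d₂ m : ℕ} (b : Vec d₁ → Vec m → Vec d₁) (t₀ T : ℝ)
    (γ₀ : Measure (State d₁ d₂)) (ν : ℝ → Measure (Vec m)) (γ : ℝ → Measure (State d₁ d₂)) :
    Prop where
  mem_P2 : ∀ t ∈ Icc t₀ T, InP 2 (γ t)
  continuous : ∀ t ∈ Icc t₀ T, Tendsto (fun s => dist2 (γ s) (γ t)) (𝓝[Icc t₀ T] t) (𝓝 0)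
  initial : γ t₀ = γ₀
  weak : ∀ φ : ℝ × State d₁ d₂ → ℝ, ContDiff ℝ 1 φ →
    (∃ C : ℝ, ∀ t ∈ Icc t₀ T, ∀ z, |φ (t, z)| ≤ C ∧ ‖fderiv ℝ φ (t, z)‖ ≤ C) →
    ∀ t₁ ∈ Icc t₀ T,
      ∫ z, φ (t₁, z) ∂(γ t₁) = ∫ z, φ (t₀, z) ∂γ₀ +
        ∫ t in t₀..t₁, ∫ z, (deriv (fun s => φ (s, z)) t +
          inner ℝ (avgField b z.1 (ν t)) (gradX (fun z' => φ (t, z')) z)) ∂(γ t)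

/-- `‖f‖_{𝒞¹_{2,1}} ≤ K` up to a numerical factor: quadratic growth of `f` and linear growth of its
gradient. -/
def C121Bound {d₁ d₂ : ℕ} (f : State d₁ d₂ → ℝ) (K : ℝ) : Prop :=
  ∀ z, |f z| ≤ K * (1 + ‖z.1‖ ^ 2 + ‖z.2‖ ^ 2) ∧ ‖fderiv ℝ f z‖ ≤ K * (1 + ‖z.1‖ + ‖z.2‖)

/-- `u ∈ 𝒞^{1/2}([t₀,T], 𝒞¹_{2,1})` is a solution of the backward transport equation
`-∂_t u_t - b(x,ν_t) · ∇_x u_t = 0`, `u_T = L`, in its integrated form. -/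
structure IsTransportSolution {d₁ d₂ m : ℕ} (b : Vec d₁ → Vec m → Vec d₁)
    (L : State d₁ d₂ → ℝ) (t₀ T : ℝ) (ν : ℝ → Measure (Vec m)) (u : ℝ → State d₁ d₂ → ℝ) :
    Prop where
  contDiff : ∀ t ∈ Icc t₀ T, ContDiff ℝ 1 (u t)
  growth : ∀ t ∈ Icc t₀ T, ∃ K : ℝ, C121Bound (u t) K
  holder : ∃ K : ℝ, ∀ s ∈ Icc t₀ T, ∀ t ∈ Icc t₀ T,
    C121Bound (fun z => u t z - u s z) (K * Real.sqrt |t - s|)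
  equation : ∀ t ∈ Icc t₀ T, ∀ z : State d₁ d₂,
    u t z = L z + ∫ s in t..T, inner ℝ (avgField b z.1 (ν s)) (gradX (u s) z)

/-- The state trajectory driven by the control `ν`: the solution of the continuity equation started
from `γ₀` at time `t₀` (it is unique on `[t₀,T]` for `γ₀ ∈ 𝒫₂` and `ν` admissible). -/
def stateCurve {d₁ d₂ m : ℕ} (b : Vec d₁ → Vec m → Vec d₁) (t₀ T : ℝ)
    (γ₀ : Measure (State d₁ d₂)) (ν : ℝ → Measure (Vec m)) : ℝ → Measure (State d₁ d₂) :=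
  Classical.epsilon fun γ => IsContinuitySolution b t₀ T γ₀ ν γ

/-- The total cost `J((t₀,γ₀),ν) = ∫ L dγ_T + ε ∫_{t₀}^T ℰ(ν_t | ν^∞) dt`, for admissible `ν`. -/
def cost {d₁ d₂ m : ℕ} (b : Vec d₁ → Vec m → Vec d₁) (ℓ : Vec m → ℝ) (L : State d₁ d₂ → ℝ)
    (ε t₀ T : ℝ) (γ₀ : Measure (State d₁ d₂)) (ν : ℝ → Measure (Vec m)) : ℝ :=
  ∫ z, L z ∂(stateCurve b t₀ T γ₀ ν T) +
    ε * (∫⁻ t in Icc t₀ T, InformationTheory.klDiv (ν t) (prior ℓ)).toReal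

/-- `ν ∈ 𝒜(t₀)` is a minimizer of `J((t₀,γ₀),·)` over `𝒜(t₀)`. -/
def IsMinimizer {d₁ d₂ m : ℕ} (b : Vec d₁ → Vec m → Vec d₁) (ℓ : Vec m → ℝ)
    (L : State d₁ d₂ → ℝ) (ε t₀ T : ℝ) (γ₀ : Measure (State d₁ d₂))
    (ν : ℝ → Measure (Vec m)) : Prop :=
  ν ∈ AdmissibleControls ℓ t₀ T ∧
    ∀ ν' ∈ AdmissibleControls ℓ t₀ T, cost b ℓ L ε t₀ T γ₀ ν ≤ cost b ℓ L ε t₀ T γ₀ ν'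

/-- The Gibbs weight `exp(-ℓ(a) - ε⁻¹ ∫ b(x,a) · ∇_x u(x,y) dγ(x,y))`. -/
def gibbsWeight {d₁ d₂ m : ℕ} (b : Vec d₁ → Vec m → Vec d₁) (ℓ : Vec m → ℝ) (ε : ℝ)
    (u : State d₁ d₂ → ℝ) (γ : Measure (State d₁ d₂)) (a : Vec m) : ℝ :=
  Real.exp (-ℓ a - 1 / ε * ∫ z, inner ℝ (b z.1 a) (gradX u z) ∂γ)

end MeanFieldResNet

end

/-!
The proof compares a minimizer with the Gibbs control determined by its own adjoint state, and
rests on an exact formula for the change of the value along a perturbed trajectory.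

**Regularity of the velocity field.** The Hessian bound forces `ℓ` to grow like `‖a‖ ^ 4`
(`exists_quartic_lower_bound`), so by the Donsker–Varadhan inequality a control of finite entropy
has a fourth moment that is integrable in time (`exists_moment_le_klDiv`, `exists_goodControl`). The
averaged field `b(x, ν_t)` is then bounded and has a Lipschitz derivative in `x`, with constants
integrable in time (`IsGoodControl.isSmoothField`), although it is merely measurable in time.

**The two equations.** Such a field has a flow `X_{s,t}` that is differentiable in space
(`flow`, `IsSmoothField.hasFDerivAt_flow_of_curve`). The push-forward of `γ₀` by the flow solves the
continuity equation and `u_t = L ∘ X_{t,T}` solves the transport equation. Uniqueness for the first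
follows by duality with the second: `∫ u_t dγ_t` is constant
(`IsSmoothField.integral_eq_integral_pull`). Uniqueness for the second holds because a solution is
constant along the flow (`IsSmoothField.transport_along_curve`). As nothing is differentiable in
time at every point, derivatives in time are replaced by `sub_eq_integral_of_local`: a function
whose increments over short intervals are integrals of kernels with a limit is the integral of that
limit.

**First variation.** Let `κ` be the minimizer, `u`, `γ` the associated solutions and
`P_t(a) = ∫ b(x,a) · ∇_x u_t dγ_t`. Evaluating `u` along the trajectories of the control
`(1 - δ) κ + δ g` gives the change of the terminal cost exactly, as `δ` times an integral over these
trajectories. Letting `δ → 0` (`IsSmoothField.tendsto_variation`), and using that the relative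
entropy is convex, minimality yields (`IsMinimizer.variation_nonneg`)
`0 ≤ ∫ (∫ P_t dg_t - ∫ P_t dκ_t) dt + ε ∫ (KL(g_t | ν^∞) - KL(κ_t | ν^∞)) dt`.

**Identification.** Take for `g_t` the probability measure with density proportional to
`exp (-ℓ - P_t / ε)`. The potential `P_t(a)` is jointly continuous and grows at most linearly in `a`,
so `g` is an admissible control (`exists_gibbs_control`). By the Gibbs variational principle
(`toReal_klDiv_gibbs`) the right-hand side above equals `-ε ∫ KL(κ_t | g_t) dt`. Hence
`KL(κ_t | g_t) = 0`, that is `κ_t = g_t`, for almost every `t` (`IsMinimizer.ae_eq_gibbs`).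
-/


namespace MeanFieldResNet

/-! ### A fundamental theorem of calculus for locally represented increments -/

/-- If the increments of `f` over small intervals are integrals of kernels `k s t`, dominated by an
integrable function and converging to `k₀` as the interval shrinks to a point, then `k₀` is the
derivative of `f` in the sense of absolutely continuous functions. -/
theorem sub_eq_integral_of_local {f : ℝ → ℝ} {k : ℝ → ℝ → ℝ → ℝ} {k₀ Λ : ℝ → ℝ} {a b : ℝ}
    (hab : a ≤ b) (hΛ : IntegrableOn Λ (Ioc a b))
    (hmeas : ∀ s t, a ≤ s → s ≤ t → t ≤ b →
      AEStronglyMeasurable (k s t) (volume.restrict (Ioc s t)))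
    (heq : ∀ s t, a ≤ s → s ≤ t → t ≤ b → f t - f s = ∫ r in Ioc s t, k s t r)
    (hbd : ∀ s t r, a ≤ s → t ≤ b → r ∈ Ioc s t → |k s t r| ≤ Λ r)
    (hlim : ∀ r ∈ Ioc a b,
      Tendsto (fun p : ℝ × ℝ => k p.1 p.2 r) (𝓝[Icc a r] r ×ˢ 𝓝[Icc r b] r) (𝓝 (k₀ r))) :
    f b - f a = ∫ r in Ioc a b, k₀ r := by
  -- the uniform partition of `[a, b]` into `N + 1` intervals
  set s : ℕ → ℕ → ℝ := fun N i => a + i * ((b - a) / (N + 1)) with hs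
  have hstep : ∀ N : ℕ, 0 ≤ (b - a) / ((N : ℝ) + 1) := fun N =>
    div_nonneg (by linarith) (by positivity)
  have hs0 : ∀ N, s N 0 = a := fun N => by simp [hs]
  have hsN : ∀ N, s N (N + 1) = b := fun N => by
    simp only [hs]; push_cast; field_simp; ring
  have hsucc : ∀ N i, s N (i + 1) = s N i + (b - a) / (N + 1) := fun N i => by
    simp only [hs]; push_cast; ring
  have hmono : ∀ N, Monotone (s N) := fun N =>
    monotone_nat_of_le_succ fun i => by rw [hsucc]; linarith [hstep N]
  have hsa : ∀ N i, a ≤ s N i := fun N i => by rw [← hs0 N]; exact hmono N (Nat.zero_le i)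
  have hsb : ∀ N i, i ≤ N + 1 → s N i ≤ b := fun N i hi => by
    have h := hmono N hi
    rwa [hsN N] at h
  -- `K N r` is the kernel of the interval of the `N`-th partition that contains `r`
  set K : ℕ → ℝ → ℝ := fun N r => ∑ i ∈ Finset.range (N + 1),
    (Ioc (s N i) (s N (i + 1))).indicator (k (s N i) (s N (i + 1))) r with hK
  have hex : ∀ N, ∀ r ∈ Ioc a b, ∃ i, i < N + 1 ∧ r ∈ Ioc (s N i) (s N (i + 1)) := by
    intro N r hr
    have hP : ∃ j, r ≤ s N j := ⟨N + 1, by rw [hsN]; exact hr.2⟩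
    classical
    have h1 := Nat.find_spec hP
    have h2 : Nat.find hP ≤ N + 1 := Nat.find_min' hP (by rw [hsN]; exact hr.2)
    have h3 : Nat.find hP ≠ 0 := by
      intro h0
      rw [h0, hs0] at h1
      exact absurd hr.1 (not_lt.mpr h1)
    obtain ⟨j, hj⟩ := Nat.exists_eq_succ_of_ne_zero h3
    refine ⟨j, by omega, ?_, by rw [← Nat.succ_eq_add_one, ← hj]; exact h1⟩
    exact not_le.mp (Nat.find_min hP (by omega))
  have hKval : ∀ N, ∀ r ∈ Ioc a b, ∀ i, i < N + 1 → r ∈ Ioc (s N i) (s N (i + 1)) →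
      K N r = k (s N i) (s N (i + 1)) r := by
    intro N r hr i hi hri
    simp only [hK]
    rw [Finset.sum_eq_single_of_mem i (Finset.mem_range.mpr hi)]
    · rw [indicator_of_mem hri]
    · intro j _ hj
      refine indicator_of_notMem (fun hrj => ?_) _
      exact disjoint_left.mp ((hmono N).pairwise_disjoint_on_Ioc_succ hj) hrj hri
  have hint : ∀ N i, i < N + 1 →
      IntegrableOn (k (s N i) (s N (i + 1))) (Ioc (s N i) (s N (i + 1))) := by
    intro N i hi
    refine Integrable.mono' (hΛ.mono_set (Ioc_subset_Ioc (hsa N i) (hsb N (i + 1) (by omega))))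
      (hmeas _ _ (hsa N i) (hmono N (Nat.le_succ i)) (hsb N (i + 1) (by omega))) ?_
    exact (ae_restrict_iff' measurableSet_Ioc).mpr
      (ae_of_all _ fun r hr => hbd _ _ r (hsa N i) (hsb N (i + 1) (by omega)) hr)
  have hKint : ∀ N, ∫ r in Ioc a b, K N r = f b - f a := by
    intro N
    simp only [hK]
    rw [integral_finsetSum]
    · rw [← hsN N, ← hs0 N, ← Finset.sum_range_sub (fun i => f (s N i))]
      refine Finset.sum_congr rfl fun i hi => ?_
      have hi' := Finset.mem_range.mp hi
      rw [hsN N, hs0 N, setIntegral_indicator measurableSet_Ioc,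
        inter_eq_right.mpr (Ioc_subset_Ioc (hsa N i) (hsb N (i + 1) (by omega))),
        heq _ _ (hsa N i) (hmono N (Nat.le_succ i)) (hsb N (i + 1) (by omega))]
    · intro i hi
      exact ((hint N i (Finset.mem_range.mp hi)).integrable_indicator
        measurableSet_Ioc).integrableOn
  -- dominated convergence as the mesh goes to zero
  have htend : Tendsto (fun N => ∫ r in Ioc a b, K N r) atTop (𝓝 (∫ r in Ioc a b, k₀ r)) := by
    refine tendsto_integral_of_dominated_convergence Λ ?_ hΛ ?_ ?_
    · intro N
      exact (integrable_finsetSum _ fun i hi => ((hint N i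
        (Finset.mem_range.mp hi)).integrable_indicator
          measurableSet_Ioc).integrableOn).aestronglyMeasurable
    · intro N
      refine (ae_restrict_iff' measurableSet_Ioc).mpr (ae_of_all _ fun r hr => ?_)
      obtain ⟨i, hi, hri⟩ := hex N r hr
      rw [hKval N r hr i hi hri]
      exact hbd _ _ r (hsa N i) (hsb N (i + 1) (by omega)) hri
    · refine (ae_restrict_iff' measurableSet_Ioc).mpr (ae_of_all _ fun r hr => ?_)
      choose i hi hri using fun N => hex N r hr
      have h0 : Tendsto (fun N : ℕ => (b - a) / ((N : ℝ) + 1)) atTop (𝓝 0) :=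
        tendsto_const_div_atTop_nhds_zero_nat (b - a) |>.comp (tendsto_add_atTop_nat 1) |>.congr
          fun N => by simp
      have hl : Tendsto (fun N => s N (i N)) atTop (𝓝 r) := by
        have : Tendsto (fun N : ℕ => r - (b - a) / ((N : ℝ) + 1)) atTop (𝓝 r) := by
          simpa using h0.const_sub r
        refine tendsto_of_tendsto_of_tendsto_of_le_of_le this tendsto_const_nhds ?_ ?_
        · intro N
          have := (hri N).2
          rw [hsucc] at this
          simp only
          linarith
        · intro N
          exact (hri N).1.le
      have hr' : Tendsto (fun N => s N (i N + 1)) atTop (𝓝 r) := by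
        have := hl.add h0
        rw [add_zero] at this
        exact this.congr fun N => (hsucc N (i N)).symm
      have hp : Tendsto (fun N => (s N (i N), s N (i N + 1))) atTop
          (𝓝[Icc a r] r ×ˢ 𝓝[Icc r b] r) := by
        refine Tendsto.prodMk ?_ ?_
        · exact tendsto_nhdsWithin_iff.mpr ⟨hl, Eventually.of_forall fun N =>
            ⟨hsa N _, (hri N).1.le⟩⟩
        · exact tendsto_nhdsWithin_iff.mpr ⟨hr', Eventually.of_forall fun N =>
            ⟨(hri N).2, hsb N _ (by have := hi N; omega)⟩⟩
      refine ((hlim r hr).comp hp).congr fun N => ?_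
      exact (hKval N r hr _ (hi N) (hri N)).symm
  exact tendsto_nhds_unique (tendsto_const_nhds.congr fun N => (hKint N).symm) htend

variable {E : Type*} [NormedAddCommGroup E] [NormedSpace ℝ E]

theorem continuous_setIntegral_Ioc {v : ℝ → E} (hv : Integrable v) (s : ℝ) :
    Continuous fun t => ∫ r in Ioc s t, v r := by
  have h : (fun t => ∫ r in Ioc s t, v r) = fun t => ∫ r in s..(max s t), v r := by
    ext t
    rw [intervalIntegral.integral_of_le (le_max_left s t)]
    rcases le_total s t with h | h
    · rw [max_eq_right h]
    · rw [max_eq_left h, Ioc_self, Ioc_eq_empty (not_lt.mpr h)]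
  rw [h]
  exact (intervalIntegral.continuous_primitive (fun a b => hv.intervalIntegrable) s).comp
    (continuous_const.max continuous_id)

theorem setIntegral_Ioc_add {v : ℝ → E} (hv : Integrable v) {a b c : ℝ} (hab : a ≤ b)
    (hbc : b ≤ c) : ∫ r in Ioc a c, v r = (∫ r in Ioc a b, v r) + ∫ r in Ioc b c, v r := by
  rw [← intervalIntegral.integral_of_le hab, ← intervalIntegral.integral_of_le hbc,
    ← intervalIntegral.integral_of_le (hab.trans hbc),
    intervalIntegral.integral_add_adjacent_intervals hv.intervalIntegrable hv.intervalIntegrable]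

/-- Chain rule along an absolutely continuous curve. -/
theorem chain_rule_curve [CompleteSpace E] {φ : E → ℝ} (hφ : ContDiff ℝ 1 φ) {X v : ℝ → E}
    {a b : ℝ} (hab : a ≤ b) (hv : IntegrableOn v (Ioc a b))
    (hX : ∀ t ∈ Icc a b, X t = X a + ∫ r in Ioc a t, v r) :
    φ (X b) - φ (X a) = ∫ r in Ioc a b, fderiv ℝ φ (X r) (v r) := by
  have hvint : Integrable ((Ioc a b).indicator v) := hv.integrable_indicator measurableSet_Ioc
  have hXeq : ∀ t ∈ Icc a b, X t = X a + ∫ r in Ioc a t, (Ioc a b).indicator v r := by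
    intro t ht
    rw [hX t ht, setIntegral_indicator measurableSet_Ioc,
      inter_eq_left.mpr (Ioc_subset_Ioc_right ht.2)]
  have hXc : ContinuousOn X (Icc a b) :=
    ((continuous_const.add (continuous_setIntegral_Ioc hvint a)).continuousOn).congr hXeq
  have hinc : ∀ s t, a ≤ s → s ≤ t → t ≤ b → X t - X s = ∫ r in Ioc s t, v r := by
    intro s t has hst htb
    rw [hXeq t ⟨has.trans hst, htb⟩, hXeq s ⟨has, hst.trans htb⟩,
      setIntegral_Ioc_add hvint has hst, setIntegral_indicator measurableSet_Ioc,
      setIntegral_indicator measurableSet_Ioc, inter_eq_left.mpr (Ioc_subset_Ioc has htb)]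
    abel
  -- over `[s, t]` the kernel is the derivative of `φ` at an intermediate point `ξ s t`, which need
  -- not depend measurably on `s` and `t`
  have hmvt : ∀ s t, ∃ z ∈ segment ℝ (X s) (X t),
      φ (X t) - φ (X s) = fderiv ℝ φ z (X t - X s) := fun s t =>
    domain_mvt (s := univ) (f' := fderiv ℝ φ) (fun x _ =>
      ((hφ.differentiable one_ne_zero) x).hasFDerivAt.hasFDerivWithinAt) convex_univ
      (mem_univ _) (mem_univ _)
  choose ξ hξ hξeq using hmvt
  -- the intermediate points stay in the image of a compact set
  set S : Set E := (fun p : ℝ × E × E => p.2.1 + p.1 • (p.2.2 - p.2.1)) ''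
    (Icc (0 : ℝ) 1 ×ˢ ((X '' Icc a b) ×ˢ (X '' Icc a b))) with hS
  have hScomp : IsCompact S := by
    refine (isCompact_Icc.prod ((isCompact_Icc.image_of_continuousOn hXc).prod
      (isCompact_Icc.image_of_continuousOn hXc))).image (by fun_prop)
  obtain ⟨M, hM⟩ := hScomp.exists_bound_of_continuousOn
    (hφ.continuous_fderiv one_ne_zero).continuousOn
  have hmem : ∀ s t, s ∈ Icc a b → t ∈ Icc a b → ξ s t ∈ S := by
    intro s t hs ht
    have := hξ s t
    rw [segment_eq_image'] at this
    obtain ⟨θ, hθ, he⟩ := this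
    exact ⟨(θ, X s, X t), ⟨hθ, mem_image_of_mem _ hs, mem_image_of_mem _ ht⟩, he⟩
  refine sub_eq_integral_of_local (f := fun t => φ (X t))
    (k := fun s t r => fderiv ℝ φ (ξ s t) (v r)) (Λ := fun r => M * ‖v r‖) hab
    (hv.norm.const_mul M) ?_ ?_ ?_ ?_
  · intro s t has hst htb
    exact ((fderiv ℝ φ (ξ s t)).continuous.comp_aestronglyMeasurable
      (hv.mono_set (Ioc_subset_Ioc has htb)).aestronglyMeasurable)
  · intro s t has hst htb
    rw [ContinuousLinearMap.integral_comp_comm _ (hv.mono_set (Ioc_subset_Ioc has htb)),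
      ← hinc s t has hst htb]
    exact hξeq s t
  · intro s t r has htb hr
    have hst : s ≤ t := (hr.1.trans_le hr.2).le
    rw [← Real.norm_eq_abs]
    refine (ContinuousLinearMap.le_opNorm _ _).trans ?_
    exact mul_le_mul_of_nonneg_right (hM _ (hmem s t ⟨has, hst.trans htb⟩ ⟨has.trans hst, htb⟩))
      (norm_nonneg _)
  · intro r hr
    have hr' : r ∈ Icc a b := ⟨hr.1.le, hr.2⟩
    have h1 : Tendsto (fun p : ℝ × ℝ => X p.1) (𝓝[Icc a r] r ×ˢ 𝓝[Icc r b] r) (𝓝 (X r)) :=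
      ((hXc r hr').mono_left (nhdsWithin_mono r (Icc_subset_Icc_right hr.2))).comp tendsto_fst
    have h2 : Tendsto (fun p : ℝ × ℝ => X p.2) (𝓝[Icc a r] r ×ˢ 𝓝[Icc r b] r) (𝓝 (X r)) :=
      ((hXc r hr').mono_left (nhdsWithin_mono r (Icc_subset_Icc_left hr.1.le))).comp tendsto_snd
    have h3 : Tendsto (fun p : ℝ × ℝ => ξ p.1 p.2) (𝓝[Icc a r] r ×ˢ 𝓝[Icc r b] r) (𝓝 (X r)) := by
      have h4 : Tendsto (fun p : ℝ × ℝ => ‖X p.1 - X r‖ + ‖X p.2 - X p.1‖)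
          (𝓝[Icc a r] r ×ˢ 𝓝[Icc r b] r) (𝓝 0) := by
        have := ((h1.sub_const (X r)).norm).add (h2.sub h1).norm
        simpa using this
      refine tendsto_iff_norm_sub_tendsto_zero.mpr (squeeze_zero (fun _ => norm_nonneg _) ?_ h4)
      intro p
      have := hξ p.1 p.2
      rw [segment_eq_image'] at this
      obtain ⟨θ, hθ, he⟩ := this
      simp only at he
      rw [← he]
      calc ‖X p.1 + θ • (X p.2 - X p.1) - X r‖ = ‖(X p.1 - X r) + θ • (X p.2 - X p.1)‖ := by
            congr 1; abel
        _ ≤ ‖X p.1 - X r‖ + ‖θ • (X p.2 - X p.1)‖ := norm_add_le _ _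
        _ ≤ ‖X p.1 - X r‖ + ‖X p.2 - X p.1‖ := by
            gcongr
            rw [norm_smul, Real.norm_of_nonneg hθ.1]
            exact mul_le_of_le_one_left (norm_nonneg _) hθ.2
    have h5 := ((hφ.continuous_fderiv one_ne_zero).tendsto (X r)).comp h3
    exact ((ContinuousLinearMap.apply ℝ ℝ (v r)).continuous.tendsto _).comp h5

/-! ### Grönwall's inequality with integrable coefficients -/

/-- The weight `exp (2 ∫_{-∞}^t Λ)`, which turns Volterra operators with kernel `Λ` into
contractions. -/
noncomputable def weight (Λ : ℝ → ℝ) (t : ℝ) : ℝ := Real.exp (2 * ∫ r in Iic t, Λ r)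

/-- The constant `2 exp (2 ∫ Λ)` of Grönwall's inequality. -/
noncomputable def gron (Λ : ℝ → ℝ) : ℝ := 2 * Real.exp (2 * ∫ r, Λ r)

variable {Λ : ℝ → ℝ}

theorem one_le_weight (hΛ0 : ∀ t, 0 ≤ Λ t) (t : ℝ) : 1 ≤ weight Λ t :=
  Real.one_le_exp (mul_nonneg zero_le_two (integral_nonneg hΛ0))

theorem weight_le (hΛ : Integrable Λ) (hΛ0 : ∀ t, 0 ≤ Λ t) (t : ℝ) : 2 * weight Λ t ≤ gron Λ := by
  unfold weight gron
  gcongr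
  · exact ae_of_all _ hΛ0
  · exact Measure.restrict_le_self

theorem one_le_gron (hΛ : Integrable Λ) (hΛ0 : ∀ t, 0 ≤ Λ t) : 1 ≤ gron Λ := by
  have := one_le_weight hΛ0 0
  linarith [weight_le hΛ hΛ0 0]

theorem integral_Iic_sub (hΛ : Integrable Λ) {s t : ℝ} (hst : s ≤ t) :
    ∫ r in Iic t, Λ r = (∫ r in Iic s, Λ r) + ∫ r in Ioc s t, Λ r := by
  rw [← intervalIntegral.integral_of_le hst,
    ← intervalIntegral.integral_Iic_sub_Iic hΛ.integrableOn hΛ.integrableOn]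
  ring

theorem continuous_weight (hΛ : Integrable Λ) : Continuous (weight Λ) := by
  have : Continuous fun t => ∫ r in Iic t, Λ r := by
    have h : (fun t => ∫ r in Iic t, Λ r) =
        fun t => (∫ r in Iic 0, Λ r) + ∫ r in (0 : ℝ)..t, Λ r := by
      ext t
      rw [← intervalIntegral.integral_Iic_sub_Iic hΛ.integrableOn hΛ.integrableOn]
      ring
    rw [h]
    exact continuous_const.add
      (intervalIntegral.continuous_primitive (fun a b => hΛ.intervalIntegrable) 0)
  unfold weight
  fun_prop

theorem integrable_mul_weight (hΛ : Integrable Λ) (hΛ0 : ∀ t, 0 ≤ Λ t) :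
    Integrable fun r => Λ r * weight Λ r := by
  refine (hΛ.mul_const (gron Λ)).mono'
    (hΛ.aestronglyMeasurable.mul (continuous_weight hΛ).aestronglyMeasurable)
    (ae_of_all _ fun r => ?_)
  have h1 := one_le_weight hΛ0 r
  have h2 := weight_le hΛ hΛ0 r
  rw [Real.norm_of_nonneg (mul_nonneg (hΛ0 r) (by linarith))]
  exact mul_le_mul_of_nonneg_left (by linarith) (hΛ0 r)

/-- The contraction property of the weight: it is the derivative of `weight Λ / 2` that is
integrated, and the lower end point contributes a nonpositive term. -/
theorem setIntegral_mul_weight_le (hΛ : Integrable Λ) (hΛ0 : ∀ t, 0 ≤ Λ t) (s t : ℝ) :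
    ∫ r in Ioc s t, Λ r * weight Λ r ≤ weight Λ t / 2 := by
  rcases le_total s t with hst | hst
  · have h := chain_rule_curve (φ := fun x : ℝ => Real.exp (2 * x) / 2) (by fun_prop)
      (X := fun t => ∫ r in Iic t, Λ r) (v := Λ) hst hΛ.integrableOn
      (fun t ht => integral_Iic_sub hΛ ht.1)
    have h2 : ∀ x v : ℝ, fderiv ℝ (fun x : ℝ => Real.exp (2 * x) / 2) x v
        = v * Real.exp (2 * x) := by
      intro x v
      have : HasDerivAt (fun x : ℝ => Real.exp (2 * x) / 2) (Real.exp (2 * x)) x := by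
        have h := ((((hasDerivAt_id x).const_mul 2).exp).div_const 2)
        simpa using h
      rw [this.hasFDerivAt.fderiv]
      simp
    simp only [h2] at h
    have hpos := Real.exp_pos (2 * ∫ r in Iic s, Λ r)
    unfold weight
    linarith
  · rw [Ioc_eq_empty (not_lt.mpr hst)]
    have := one_le_weight hΛ0 t
    simp only [Measure.restrict_empty, integral_zero_measure]
    linarith

/-- Grönwall's inequality in integral form, for a function that is bounded a priori. -/
theorem gronwall_integral (hΛ : Integrable Λ) (hΛ0 : ∀ t, 0 ≤ Λ t) {y : ℝ → ℝ}
    {a B s T : ℝ} (ha : 0 ≤ a)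
    (hy : ∀ t ∈ Icc s T, 0 ≤ y t) (hB : ∀ t ∈ Icc s T, y t ≤ B)
    (h : ∀ t ∈ Icc s T, y t ≤ a + ∫ r in Ioc s t, Λ r * y r) :
    ∀ t ∈ Icc s T, y t ≤ gron Λ * a := by
  intro t ht
  have hB0 : 0 ≤ B := (hy t ht).trans (hB t ht)
  -- each use of the hypothesis halves the contribution of the a priori bound `B`, by
  -- `setIntegral_mul_weight_le`
  have key : ∀ n : ℕ, ∀ t ∈ Icc s T, y t ≤ (2 * a + B / 2 ^ n) * weight Λ t := by
    intro n
    induction n with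
    | zero =>
      intro t ht
      have h1 := one_le_weight hΛ0 t
      calc y t ≤ B := hB t ht
        _ ≤ (2 * a + B / 2 ^ 0) * 1 := by simp; linarith
        _ ≤ _ := by gcongr
    | succ n ih =>
      intro t ht
      have h1 := one_le_weight hΛ0 t
      have hc : 0 ≤ 2 * a + B / 2 ^ n := by positivity
      have h2 : ∫ r in Ioc s t, Λ r * y r ≤
          ∫ r in Ioc s t, (2 * a + B / 2 ^ n) * (Λ r * weight Λ r) := by
        refine integral_mono_of_nonneg ?_
          ((integrable_mul_weight hΛ hΛ0).integrableOn.const_mul _) ?_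
        · exact (ae_restrict_iff' measurableSet_Ioc).mpr (ae_of_all _ fun r hr =>
            mul_nonneg (hΛ0 r) (hy r ⟨hr.1.le, hr.2.trans ht.2⟩))
        · refine (ae_restrict_iff' measurableSet_Ioc).mpr (ae_of_all _ fun r hr => ?_)
          have := mul_le_mul_of_nonneg_left (ih r ⟨hr.1.le, hr.2.trans ht.2⟩) (hΛ0 r)
          simp only
          linarith
      rw [integral_const_mul] at h2
      have h3 := mul_le_mul_of_nonneg_left (setIntegral_mul_weight_le hΛ hΛ0 s t) hc
      have h4 : a ≤ a * weight Λ t := le_mul_of_one_le_right ha h1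
      have h5 : (2 * a + B / 2 ^ (n + 1)) * weight Λ t
          = a * weight Λ t + (2 * a + B / 2 ^ n) * (weight Λ t / 2) := by
        rw [pow_succ]; ring
      rw [h5]
      linarith [h t ht]
  have hlim : Tendsto (fun n : ℕ => (2 * a + B / 2 ^ n) * weight Λ t) atTop
      (𝓝 ((2 * a + 0) * weight Λ t)) := by
    refine Tendsto.mul_const _ (Tendsto.const_add _ ?_)
    exact tendsto_const_nhds.div_atTop (tendsto_pow_atTop_atTop_of_one_lt one_lt_two)
  have h6 := ge_of_tendsto' hlim fun n => key n t ht
  have h7 := mul_le_mul_of_nonneg_right (weight_le hΛ hΛ0 t) ha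
  linarith

/-- Stability estimate for integral equations: a curve whose velocity is bounded by
`Λ ‖Z‖ + e` is controlled by its initial value and the integral of `e`. -/
theorem norm_le_of_integral_eq (hΛ : Integrable Λ) (hΛ0 : ∀ t, 0 ≤ Λ t)
    {Z q : ℝ → E} {e : ℝ → ℝ} {v : E} {s T : ℝ}
    (hZ : ContinuousOn Z (Icc s T)) (he : IntegrableOn e (Ioc s T)) (he0 : ∀ t ∈ Ioc s T, 0 ≤ e t)
    (heq : ∀ t ∈ Icc s T, Z t = v + ∫ r in Ioc s t, q r)
    (hq : ∀ r ∈ Ioc s T, ‖q r‖ ≤ Λ r * ‖Z r‖ + e r) :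
    ∀ t ∈ Icc s T, ‖Z t‖ ≤ gron Λ * (‖v‖ + ∫ r in Ioc s T, e r) := by
  obtain ⟨B, hB⟩ := isCompact_Icc.exists_bound_of_continuousOn hZ
  refine gronwall_integral hΛ hΛ0 (y := fun t => ‖Z t‖) ?_ (fun _ _ => norm_nonneg _)
    (fun t ht => hB t ht) ?_
  · exact add_nonneg (norm_nonneg _) (setIntegral_nonneg measurableSet_Ioc he0)
  · intro t ht
    have hint : IntegrableOn (fun r => Λ r * ‖Z r‖) (Ioc s t) := by
      refine (hΛ.mul_const B).integrableOn.mono' (hΛ.aestronglyMeasurable.restrict.mul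
        ((hZ.mono (Ioc_subset_Icc_self.trans (Icc_subset_Icc_right ht.2))).norm.aestronglyMeasurable
          measurableSet_Ioc)) ?_
      refine (ae_restrict_iff' measurableSet_Ioc).mpr (ae_of_all _ fun r hr => ?_)
      rw [norm_mul, norm_norm, Real.norm_of_nonneg (hΛ0 r)]
      exact mul_le_mul_of_nonneg_left (hB r ⟨hr.1.le, hr.2.trans ht.2⟩) (hΛ0 r)
    have h1 : ‖∫ r in Ioc s t, q r‖ ≤ ∫ r in Ioc s t, (Λ r * ‖Z r‖ + e r) := by
      refine norm_integral_le_of_norm_le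
        (hint.add (he.mono_set (Ioc_subset_Ioc_right ht.2))) ?_
      exact (ae_restrict_iff' measurableSet_Ioc).mpr (ae_of_all _ fun r hr =>
        hq r ⟨hr.1, hr.2.trans ht.2⟩)
    rw [integral_add hint (he.mono_set (Ioc_subset_Ioc_right ht.2))] at h1
    have h2 : ∫ r in Ioc s t, e r ≤ ∫ r in Ioc s T, e r :=
      setIntegral_mono_set he ((ae_restrict_iff' measurableSet_Ioc).mpr (ae_of_all _ he0))
        (Eventually.of_forall (Ioc_subset_Ioc_right ht.2))
    calc ‖Z t‖ = ‖v + ∫ r in Ioc s t, q r‖ := by rw [heq t ht]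
      _ ≤ ‖v‖ + ‖∫ r in Ioc s t, q r‖ := norm_add_le _ _
      _ ≤ _ := by linarith

/-! ### Flows of vector fields that are merely measurable in time -/

variable {E : Type*} [NormedAddCommGroup E]

/-- Time-dependent vector fields that are measurable in time and Lipschitz in space, with an
integrable Lipschitz constant `Λ`. -/
structure IsCaratheodoryField (F : ℝ → E → E) (Λ : ℝ → ℝ) : Prop where
  meas : ∀ z, StronglyMeasurable fun t => F t z
  integrable : Integrable Λ
  lip : ∀ t z z', ‖F t z - F t z'‖ ≤ Λ t * ‖z - z'‖
  zero : ∀ t, ‖F t 0‖ ≤ Λ t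

section Existence

variable {F : ℝ → E → E} {Λ : ℝ → ℝ}

theorem IsCaratheodoryField.nonneg (hF : IsCaratheodoryField F Λ) (t : ℝ) : 0 ≤ Λ t :=
  (norm_nonneg _).trans (hF.zero t)

theorem IsCaratheodoryField.continuous (hF : IsCaratheodoryField F Λ) (t : ℝ) :
    Continuous (F t) :=
  (LipschitzWith.of_dist_le' fun z z' => by
    rw [dist_eq_norm, dist_eq_norm]; exact hF.lip t z z').continuous

variable [NormedSpace ℝ E] [MeasurableSpace E] [BorelSpace E] [SecondCountableTopology E]

theorem IsCaratheodoryField.stronglyMeasurable_uncurry (hF : IsCaratheodoryField F Λ) :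
    StronglyMeasurable fun p : E × ℝ => F p.2 p.1 :=
  stronglyMeasurable_uncurry_of_continuous_of_stronglyMeasurable (u := fun z t => F t z)
    (fun t => hF.continuous t) hF.meas

theorem IsCaratheodoryField.stronglyMeasurable_comp (hF : IsCaratheodoryField F Λ) {X : ℝ → E}
    (hX : Continuous X) : StronglyMeasurable fun r => F r (X r) :=
  hF.stronglyMeasurable_uncurry.comp_measurable (hX.measurable.prodMk measurable_id)

theorem IsCaratheodoryField.integrable_comp (hF : IsCaratheodoryField F Λ) {X : ℝ → E}
    (hX : Continuous X) {B : ℝ} (hB : ∀ t, ‖X t‖ ≤ B) : Integrable fun r => F r (X r) := by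
  refine (hF.integrable.mul_const (B + 1)).mono'
    (hF.stronglyMeasurable_comp hX).aestronglyMeasurable (ae_of_all _ fun r => ?_)
  have h1 := hF.lip r (X r) 0
  have h2 : ‖F r (X r)‖ ≤ ‖F r (X r) - F r 0‖ + ‖F r 0‖ := by
    simpa using norm_add_le (F r (X r) - F r 0) (F r 0)
  have h3 := mul_le_mul_of_nonneg_left (hB r) (hF.nonneg r)
  rw [sub_zero] at h1
  linarith [hF.zero r]

/-- Existence of integral curves. The integral equation is solved by Banach's fixed point theorem
for the unknown divided by `weight Λ`. The integral over `Ioc s t` is zero for `t ≤ s`, so that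
the curve is extended by its initial value. -/
theorem IsCaratheodoryField.exists_curve [CompleteSpace E] (hF : IsCaratheodoryField F Λ)
    (s : ℝ) (x : E) :
    ∃ X : ℝ → E, Continuous X ∧ (∃ B, ∀ t, ‖X t‖ ≤ B) ∧
      ∀ t, X t = x + ∫ r in Ioc s t, F r (X r) := by
  have hΛ := hF.integrable
  have hΛ0 := hF.nonneg
  have hw := continuous_weight hΛ
  have hw1 := one_le_weight hΛ0
  have hw0 : ∀ t, 0 < weight Λ t := fun t => zero_lt_one.trans_le (hw1 t)
  have hcont : ∀ Z : BoundedContinuousFunction ℝ E, Continuous fun t => weight Λ t • Z t :=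
    fun Z => hw.smul Z.continuous
  have hbdd : ∀ (Z : BoundedContinuousFunction ℝ E) (t : ℝ),
      ‖weight Λ t • Z t‖ ≤ gron Λ * ‖Z‖ := by
    intro Z t
    rw [norm_smul, Real.norm_of_nonneg (hw0 t).le]
    refine mul_le_mul ?_ (Z.norm_coe_le_norm t) (norm_nonneg _) ?_
    · linarith [weight_le hΛ hΛ0 t, hw0 t]
    · linarith [one_le_gron hΛ hΛ0]
  have hint : ∀ Z : BoundedContinuousFunction ℝ E,
      Integrable fun r => F r (weight Λ r • Z r) :=
    fun Z => hF.integrable_comp (hcont Z) (hbdd Z)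
  -- the integral operator in the unknown `Z = X / weight Λ`
  let Ψ : BoundedContinuousFunction ℝ E → BoundedContinuousFunction ℝ E := fun Z =>
    BoundedContinuousFunction.ofNormedAddCommGroup
      (fun t => (weight Λ t)⁻¹ • (x + ∫ r in Ioc s t, F r (weight Λ r • Z r)))
      ((hw.inv₀ fun t => (hw0 t).ne').smul
        (continuous_const.add (continuous_setIntegral_Ioc (hint Z) s)))
      (‖x‖ + ∫ r, ‖F r (weight Λ r • Z r)‖) (fun t => by
        rw [norm_smul, norm_inv, Real.norm_of_nonneg (hw0 t).le]
        refine (mul_le_of_le_one_left (norm_nonneg _) (inv_le_one_of_one_le₀ (hw1 t))).trans ?_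
        refine (norm_add_le _ _).trans (add_le_add le_rfl ?_)
        refine (norm_integral_le_integral_norm _).trans ?_
        exact integral_mono_measure Measure.restrict_le_self
          (ae_of_all _ fun _ => norm_nonneg _) (hint Z).norm)
  have hΨ : ∀ Z t, Ψ Z t = (weight Λ t)⁻¹ • (x + ∫ r in Ioc s t, F r (weight Λ r • Z r)) :=
    fun Z t => rfl
  -- the factor `1 / 2` is that of `setIntegral_mul_weight_le`
  have hcontr : ContractingWith (1 / 2) Ψ := by
    refine ⟨by norm_num, LipschitzWith.of_dist_le_mul fun Z Z' => ?_⟩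
    refine (BoundedContinuousFunction.dist_le (by positivity)).mpr fun t => ?_
    rw [dist_eq_norm, hΨ, hΨ, ← smul_sub, norm_smul, norm_inv, Real.norm_of_nonneg (hw0 t).le,
      add_sub_add_left_eq_sub, ← integral_sub (hint Z).integrableOn (hint Z').integrableOn]
    have h1 : ‖∫ r in Ioc s t, (F r (weight Λ r • Z r) - F r (weight Λ r • Z' r))‖ ≤
        ∫ r in Ioc s t, (Λ r * weight Λ r) * dist Z Z' := by
      refine norm_integral_le_of_norm_le
        ((integrable_mul_weight hΛ hΛ0).mul_const _).integrableOn (ae_of_all _ fun r => ?_)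
      refine (hF.lip r _ _).trans ?_
      rw [← smul_sub, norm_smul, Real.norm_of_nonneg (hw0 r).le, ← mul_assoc, ← dist_eq_norm]
      exact mul_le_mul_of_nonneg_left (Z.dist_coe_le_dist r) (mul_nonneg (hΛ0 r) (hw0 r).le)
    rw [integral_mul_const] at h1
    have h2 := mul_le_mul_of_nonneg_right (setIntegral_mul_weight_le hΛ hΛ0 s t)
      (dist_nonneg (x := Z) (y := Z'))
    calc _ ≤ (weight Λ t)⁻¹ * (weight Λ t / 2 * dist Z Z') :=
          mul_le_mul_of_nonneg_left (h1.trans h2) (inv_nonneg.mpr (hw0 t).le)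
      _ = _ := by
          have := (hw0 t).ne'
          push_cast
          field_simp
  refine ⟨fun t => weight Λ t • hcontr.fixedPoint Ψ t, hcont _, ⟨_, hbdd _⟩, fun t => ?_⟩
  have h := congrArg (fun Z => Z t) (hcontr.fixedPoint_isFixedPt (f := Ψ))
  simp only [hΨ] at h
  change weight Λ t • hcontr.fixedPoint Ψ t =
    x + ∫ r in Ioc s t, F r (weight Λ r • hcontr.fixedPoint Ψ r)
  rw [← h, smul_inv_smul₀ (hw0 t).ne']

end Existence

variable [NormedSpace ℝ E]

/-- Time-dependent vector fields that are measurable in time, bounded and `C^{1,1}` in space, with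
constants that are integrable in time. -/
structure IsSmoothField (F : ℝ → E → E) (Λ Λ₂ : ℝ → ℝ) : Prop where
  meas : ∀ z, StronglyMeasurable fun t => F t z
  meas_fderiv : ∀ z, StronglyMeasurable fun t => fderiv ℝ (F t) z
  diff : ∀ t, Differentiable ℝ (F t)
  integrable : Integrable Λ
  integrable₂ : Integrable Λ₂
  nonneg₂ : ∀ t, 0 ≤ Λ₂ t
  bound : ∀ t z, ‖F t z‖ ≤ Λ t
  fderiv_bound : ∀ t z, ‖fderiv ℝ (F t) z‖ ≤ Λ t
  fderiv_lip : ∀ t z z', ‖fderiv ℝ (F t) z - fderiv ℝ (F t) z'‖ ≤ Λ₂ t * ‖z - z'‖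

/-- The flow of the vector field `F`: `flow F s t z` is the position at time `t` of the integral
curve that is at `z` at time `s`. For `t ≤ s` it is `z`, by the convention for `Ioc s t`. The curve
is picked by `Classical.epsilon`; it exists by `IsCaratheodoryField.exists_curve`, and for smooth
fields it is unique. -/
noncomputable def flow (F : ℝ → E → E) (s t : ℝ) (z : E) : E :=
  Classical.epsilon
    (fun X : ℝ → E => Continuous X ∧ ∀ t, X t = z + ∫ r in Ioc s t, F r (X r)) t

/-- The first-order Taylor remainder is quadratic when the derivative is Lipschitz. -/
theorem norm_sub_sub_fderiv_le {f : E → E} {C : ℝ} (hf : Differentiable ℝ f)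
    (hlip : ∀ z z', ‖fderiv ℝ f z - fderiv ℝ f z'‖ ≤ C * ‖z - z'‖) (hC : 0 ≤ C) (z z' : E) :
    ‖f z' - f z - fderiv ℝ f z (z' - z)‖ ≤ C * ‖z' - z‖ ^ 2 := by
  have h := (convex_segment z z').norm_image_sub_le_of_norm_hasFDerivWithin_le'
    (f := f) (f' := fderiv ℝ f) (φ := fderiv ℝ f z) (C := C * ‖z' - z‖)
    (fun x _ => (hf x).hasFDerivAt.hasFDerivWithinAt) (fun x hx => ?_)
    (left_mem_segment ℝ z z') (right_mem_segment ℝ z z')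
  · rwa [mul_assoc, ← sq] at h
  · refine (hlip x z).trans (mul_le_mul_of_nonneg_left ?_ hC)
    rw [segment_eq_image'] at hx
    obtain ⟨θ, hθ, rfl⟩ := hx
    rw [add_sub_cancel_left, norm_smul, Real.norm_of_nonneg hθ.1]
    exact mul_le_of_le_one_left (norm_nonneg _) hθ.2

namespace IsSmoothField

variable {F : ℝ → E → E} {Λ Λ₂ : ℝ → ℝ}

theorem nonneg (hF : IsSmoothField F Λ Λ₂) (t : ℝ) : 0 ≤ Λ t :=
  (norm_nonneg _).trans (hF.bound t 0)

theorem caratheodory (hF : IsSmoothField F Λ Λ₂) : IsCaratheodoryField F Λ where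
  meas := hF.meas
  integrable := hF.integrable
  lip t z z' := convex_univ.norm_image_sub_le_of_norm_fderiv_le (𝕜 := ℝ)
    (fun x _ => hF.diff t x) (fun x _ => hF.fderiv_bound t x) (mem_univ z') (mem_univ z)
  zero t := hF.bound t 0

theorem setIntegral_le (hF : IsSmoothField F Λ Λ₂) (s t : ℝ) :
    ∫ r in Ioc s t, Λ r ≤ ∫ r, Λ r :=
  setIntegral_le_integral hF.integrable (ae_of_all _ hF.nonneg)

theorem setIntegral_nonneg (hF : IsSmoothField F Λ Λ₂) (s t : ℝ) :
    0 ≤ ∫ r in Ioc s t, Λ r :=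
  integral_nonneg hF.nonneg

theorem one_le_gron (hF : IsSmoothField F Λ Λ₂) : 1 ≤ gron Λ :=
  MeanFieldResNet.one_le_gron hF.integrable hF.nonneg

theorem gron_nonneg (hF : IsSmoothField F Λ Λ₂) : 0 ≤ gron Λ := zero_le_one.trans hF.one_le_gron

theorem continuous_fderiv (hF : IsSmoothField F Λ Λ₂) (t : ℝ) : Continuous (fderiv ℝ (F t)) :=
  (LipschitzWith.of_dist_le' fun z z' => by
    rw [dist_eq_norm, dist_eq_norm]; exact hF.fderiv_lip t z z').continuous

variable [FiniteDimensional ℝ E] [MeasurableSpace E] [BorelSpace E]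

theorem integrable_comp (hF : IsSmoothField F Λ Λ₂) {X : ℝ → E} (hX : Continuous X) :
    Integrable fun r => F r (X r) := by
  have : ProperSpace E := FiniteDimensional.proper_real E
  exact hF.integrable.mono' (hF.caratheodory.stronglyMeasurable_comp hX).aestronglyMeasurable
    (ae_of_all _ fun r => hF.bound r _)

theorem flow_spec (hF : IsSmoothField F Λ Λ₂) (s : ℝ) (z : E) :
    Continuous (fun t => flow F s t z) ∧
      ∀ t, flow F s t z = z + ∫ r in Ioc s t, F r (flow F s r z) := by
  have : ProperSpace E := FiniteDimensional.proper_real E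
  have : CompleteSpace E := FiniteDimensional.complete ℝ E
  obtain ⟨X, hX, -, hX2⟩ := hF.caratheodory.exists_curve s z
  exact Classical.epsilon_spec
    (p := fun X : ℝ → E => Continuous X ∧ ∀ t, X t = z + ∫ r in Ioc s t, F r (X r))
    ⟨X, hX, hX2⟩

theorem continuous_flow_time (hF : IsSmoothField F Λ Λ₂) (s : ℝ) (z : E) :
    Continuous fun t => flow F s t z := (hF.flow_spec s z).1

theorem flow_eq (hF : IsSmoothField F Λ Λ₂) (s t : ℝ) (z : E) :
    flow F s t z = z + ∫ r in Ioc s t, F r (flow F s r z) := (hF.flow_spec s z).2 t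

theorem integrable_flow (hF : IsSmoothField F Λ Λ₂) (s : ℝ) (z : E) :
    Integrable fun r => F r (flow F s r z) := hF.integrable_comp (hF.continuous_flow_time s z)

theorem flow_of_le (hF : IsSmoothField F Λ Λ₂) {s t : ℝ} (h : t ≤ s) (z : E) :
    flow F s t z = z := by
  rw [hF.flow_eq, Ioc_eq_empty (not_lt.mpr h)]
  simp

theorem flow_sub_flow (hF : IsSmoothField F Λ Λ₂) {s r t : ℝ} (hsr : s ≤ r) (hrt : r ≤ t) (z : E) :
    flow F s t z = flow F s r z + ∫ q in Ioc r t, F q (flow F s q z) := by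
  rw [hF.flow_eq s t, hF.flow_eq s r, setIntegral_Ioc_add (hF.integrable_flow s z) hsr hrt,
    add_assoc]

/-- Comparison of the flow with an integral curve of another field. -/
theorem norm_sub_flow_le (hF : IsSmoothField F Λ Λ₂) {s T : ℝ} {z z' : E} {Y G : ℝ → E}
    {e : ℝ → ℝ} (hY : ContinuousOn Y (Icc s T)) (hG : IntegrableOn G (Ioc s T))
    (he : IntegrableOn e (Ioc s T)) (he0 : ∀ t ∈ Ioc s T, 0 ≤ e t)
    (hYG : ∀ t ∈ Icc s T, Y t = z' + ∫ r in Ioc s t, G r)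
    (hGF : ∀ r ∈ Ioc s T, ‖G r - F r (Y r)‖ ≤ e r) :
    ∀ t ∈ Icc s T, ‖Y t - flow F s t z‖ ≤ gron Λ * (‖z' - z‖ + ∫ r in Ioc s T, e r) := by
  refine norm_le_of_integral_eq hF.integrable hF.nonneg (Z := fun t => Y t - flow F s t z)
    (q := fun r => G r - F r (flow F s r z))
    (hY.sub (hF.continuous_flow_time s z).continuousOn) he he0 ?_ ?_
  · intro t ht
    rw [integral_sub (hG.mono_set (Ioc_subset_Ioc_right ht.2))
      (hF.integrable_flow s z).integrableOn, hYG t ht, hF.flow_eq s t z]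
    abel
  · intro r hr
    have h1 := hGF r hr
    have h2 := hF.caratheodory.lip r (Y r) (flow F s r z)
    have h3 := norm_add_le (G r - F r (Y r)) (F r (Y r) - F r (flow F s r z))
    rw [sub_add_sub_cancel] at h3
    linarith

/-- Integral curves are unique. -/
theorem eq_flow (hF : IsSmoothField F Λ Λ₂) {s T : ℝ} {z : E} {Y : ℝ → E}
    (hY : ContinuousOn Y (Icc s T)) (hint : IntegrableOn (fun r => F r (Y r)) (Ioc s T))
    (hYF : ∀ t ∈ Icc s T, Y t = z + ∫ r in Ioc s t, F r (Y r)) :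
    ∀ t ∈ Icc s T, Y t = flow F s t z := by
  intro t ht
  have h := hF.norm_sub_flow_le (z := z) (e := fun _ => 0) hY hint integrableOn_zero
    (fun _ _ => le_rfl) hYF (fun r _ => by simp) t ht
  simp only [sub_self, norm_zero, integral_zero, add_zero, mul_zero] at h
  exact sub_eq_zero.mp (norm_le_zero_iff.mp h)

theorem norm_flow_sub_flow_time (hF : IsSmoothField F Λ Λ₂) (s : ℝ) {r t : ℝ} (hrt : r ≤ t)
    (z : E) : ‖flow F s t z - flow F s r z‖ ≤ ∫ q in Ioc r t, Λ q := by
  have key : ∀ r, s ≤ r → r ≤ t → ‖flow F s t z - flow F s r z‖ ≤ ∫ q in Ioc r t, Λ q := by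
    intro r hsr hrt
    rw [hF.flow_sub_flow hsr hrt, add_sub_cancel_left]
    exact norm_integral_le_of_norm_le hF.integrable.integrableOn
      (ae_of_all _ fun q => hF.bound q _)
  rcases le_total s r with h | h
  · exact key r h hrt
  · rw [hF.flow_of_le h]
    rcases le_total s t with h' | h'
    · have h1 := key s le_rfl h'
      rw [hF.flow_of_le le_rfl] at h1
      refine h1.trans (setIntegral_mono_set hF.integrable.integrableOn
        (ae_of_all _ hF.nonneg) (Eventually.of_forall (Ioc_subset_Ioc_left h)))
    · rw [hF.flow_of_le h', sub_self, norm_zero]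
      exact hF.setIntegral_nonneg r t

theorem norm_flow_sub_self (hF : IsSmoothField F Λ Λ₂) (s t : ℝ) (z : E) :
    ‖flow F s t z - z‖ ≤ ∫ q in Ioc s t, Λ q := by
  rcases le_total s t with h | h
  · have := hF.norm_flow_sub_flow_time s h z
    rwa [hF.flow_of_le le_rfl] at this
  · rw [hF.flow_of_le h, sub_self, norm_zero]
    exact hF.setIntegral_nonneg s t

theorem norm_flow_le (hF : IsSmoothField F Λ Λ₂) (s t : ℝ) (z : E) :
    ‖flow F s t z‖ ≤ ‖z‖ + ∫ q, Λ q := by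
  have h := norm_add_le (flow F s t z - z) z
  rw [sub_add_cancel] at h
  linarith [hF.norm_flow_sub_self s t z, hF.setIntegral_le s t]

theorem norm_flow_sub_flow_le (hF : IsSmoothField F Λ Λ₂) (s t : ℝ) (z z' : E) :
    ‖flow F s t z - flow F s t z'‖ ≤ gron Λ * ‖z - z'‖ := by
  rcases le_total s t with h | h
  · have := hF.norm_sub_flow_le (T := t) (z := z') (e := fun _ => 0)
      (hF.continuous_flow_time s z).continuousOn (hF.integrable_flow s z).integrableOn
      integrableOn_zero (fun _ _ => le_rfl) (fun t _ => hF.flow_eq s t z) (fun r _ => by simp)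
      t (right_mem_Icc.mpr h)
    simpa using this
  · rw [hF.flow_of_le h, hF.flow_of_le h]
    exact le_mul_of_one_le_left (norm_nonneg _) hF.one_le_gron

theorem flow_flow (hF : IsSmoothField F Λ Λ₂) {s r t : ℝ} (hsr : s ≤ r) (hrt : r ≤ t) (z : E) :
    flow F r t (flow F s r z) = flow F s t z := by
  refine (hF.eq_flow (T := t) (hF.continuous_flow_time s z).continuousOn
    (hF.integrable_flow s z).integrableOn (fun q hq => ?_) t (right_mem_Icc.mpr hrt)).symm
  exact hF.flow_sub_flow hsr hq.1 z

theorem continuous_flow (hF : IsSmoothField F Λ Λ₂) (s : ℝ) :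
    Continuous fun p : ℝ × E => flow F s p.1 p.2 := by
  refine continuous_iff_continuousAt.mpr fun ⟨t, z⟩ => ?_
  have h1 : Tendsto (fun p : ℝ × E => gron Λ * ‖p.2 - z‖ + ‖flow F s p.1 z - flow F s t z‖)
      (𝓝 (t, z)) (𝓝 (gron Λ * ‖z - z‖ + ‖flow F s t z - flow F s t z‖)) := by
    have hc : Continuous fun p : ℝ × E =>
        gron Λ * ‖p.2 - z‖ + ‖flow F s p.1 z - flow F s t z‖ := by
      have := (hF.continuous_flow_time s z).comp (continuous_fst (X := ℝ) (Y := E))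
      simp only [Function.comp_def] at this
      fun_prop
    exact hc.tendsto (t, z)
  simp only [sub_self, norm_zero, mul_zero, add_zero] at h1
  refine tendsto_iff_norm_sub_tendsto_zero.mpr (squeeze_zero (fun _ => norm_nonneg _) ?_ h1)
  intro p
  have h2 := norm_add_le (flow F s p.1 p.2 - flow F s p.1 z) (flow F s p.1 z - flow F s t z)
  rw [sub_add_sub_cancel] at h2
  linarith [hF.norm_flow_sub_flow_le s p.1 p.2 z]

/-- The linearized field along an integral curve, acting on endomorphisms. -/
theorem caratheodory_linearized (hF : IsSmoothField F Λ Λ₂) {X : ℝ → E} (hX : Continuous X) :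
    IsCaratheodoryField (fun r (A : E →L[ℝ] E) => (fderiv ℝ (F r) (X r)).comp A) Λ where
  meas A := by
    have : ProperSpace E := FiniteDimensional.proper_real E
    have h : StronglyMeasurable fun p : E × ℝ => fderiv ℝ (F p.2) p.1 :=
      stronglyMeasurable_uncurry_of_continuous_of_stronglyMeasurable
        (u := fun z t => fderiv ℝ (F t) z) (fun t => hF.continuous_fderiv t) hF.meas_fderiv
    have h2 : StronglyMeasurable fun r => fderiv ℝ (F r) (X r) :=
      h.comp_measurable (hX.measurable.prodMk measurable_id)
    exact (continuous_id.clm_comp continuous_const).comp_stronglyMeasurable h2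
  integrable := hF.integrable
  lip r A B := by
    rw [← ContinuousLinearMap.comp_sub]
    exact (ContinuousLinearMap.opNorm_comp_le _ _).trans
      (mul_le_mul_of_nonneg_right (hF.fderiv_bound r _) (norm_nonneg _))
  zero r := by simpa using hF.nonneg r

/-- Solvability of the linearized equation along the integral curve that starts from `z`. -/
theorem exists_fderiv_curve (hF : IsSmoothField F Λ Λ₂) (s : ℝ) (z : E) :
    ∃ D : ℝ → E →L[ℝ] E, Continuous D ∧
      Integrable (fun r => (fderiv ℝ (F r) (flow F s r z)).comp (D r)) ∧
      ∀ t, D t = ContinuousLinearMap.id ℝ E +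
        ∫ r in Ioc s t, (fderiv ℝ (F r) (flow F s r z)).comp (D r) := by
  have : ProperSpace E := FiniteDimensional.proper_real E
  have : CompleteSpace E := FiniteDimensional.complete ℝ E
  have hc := hF.caratheodory_linearized (hF.continuous_flow_time s z)
  obtain ⟨D, hD, ⟨B, hB⟩, hD2⟩ := hc.exists_curve s (ContinuousLinearMap.id ℝ E)
  exact ⟨D, hD, hc.integrable_comp hD hB, hD2⟩

/-- The solution `D` of the linearized equation is the spatial derivative of the flow: the remainder
`X(z') - X(z) - D (z' - z)` solves the linearized equation up to an error that is quadratic in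
`z' - z`, hence is quadratic itself. -/
theorem hasFDerivAt_flow_of_curve (hF : IsSmoothField F Λ Λ₂) {s : ℝ} {z : E}
    {D : ℝ → E →L[ℝ] E} (hD : Continuous D)
    (hint : Integrable (fun r => (fderiv ℝ (F r) (flow F s r z)).comp (D r)))
    (hD2 : ∀ t, D t = ContinuousLinearMap.id ℝ E +
        ∫ r in Ioc s t, (fderiv ℝ (F r) (flow F s r z)).comp (D r)) {t : ℝ} (hst : s ≤ t) :
    HasFDerivAt (flow F s t) (D t) z := by
  have : CompleteSpace E := FiniteDimensional.complete ℝ E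
  set κ := gron Λ with hκ
  have hκ0 := hF.gron_nonneg
  have key : ∀ z', ‖flow F s t z' - flow F s t z - D t (z' - z)‖ ≤
      κ * (κ ^ 2 * ∫ r in Ioc s t, Λ₂ r) * ‖z' - z‖ ^ 2 := by
    intro z'
    have hint2 : Integrable fun r => fderiv ℝ (F r) (flow F s r z) (D r (z' - z)) :=
      ((ContinuousLinearMap.apply ℝ E (z' - z)).integrable_comp hint)
    have h := norm_le_of_integral_eq hF.integrable hF.nonneg (s := s) (T := t)
      (Z := fun t => flow F s t z' - flow F s t z - D t (z' - z))
      (q := fun r => F r (flow F s r z') - F r (flow F s r z)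
        - fderiv ℝ (F r) (flow F s r z) (D r (z' - z)))
      (e := fun r => Λ₂ r * (κ * ‖z' - z‖) ^ 2) (v := 0) ?_ ?_ ?_ ?_ ?_ t
      (right_mem_Icc.mpr hst)
    · rw [integral_mul_const] at h
      refine h.trans (le_of_eq ?_)
      rw [norm_zero]
      ring
    · exact (((hF.continuous_flow_time s z').sub (hF.continuous_flow_time s z)).sub
        (hD.clm_apply continuous_const)).continuousOn
    · exact (hF.integrable₂.mul_const _).integrableOn
    · intro r _
      exact mul_nonneg (hF.nonneg₂ r) (sq_nonneg _)
    · intro q _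
      have h1 : D q (z' - z) = (z' - z) +
          ∫ r in Ioc s q, fderiv ℝ (F r) (flow F s r z) (D r (z' - z)) := by
        conv_lhs => rw [hD2 q]
        rw [add_apply, ContinuousLinearMap.integral_apply hint.integrableOn]
        rfl
      rw [integral_sub (f := fun r => F r (flow F s r z') - F r (flow F s r z))
        ((hF.integrable_flow s z').sub (hF.integrable_flow s z)).integrableOn
        hint2.integrableOn, integral_sub (hF.integrable_flow s z').integrableOn
        (hF.integrable_flow s z).integrableOn, h1, hF.flow_eq s q z', hF.flow_eq s q z]
      abel
    · intro r _
      have h1 := norm_sub_sub_fderiv_le (hF.diff r) (hF.fderiv_lip r) (hF.nonneg₂ r)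
        (flow F s r z) (flow F s r z')
      have h2 : Λ₂ r * ‖flow F s r z' - flow F s r z‖ ^ 2 ≤ Λ₂ r * (κ * ‖z' - z‖) ^ 2 := by
        have := hF.norm_flow_sub_flow_le s r z' z
        have := hF.nonneg₂ r
        gcongr
      have h3 : ‖fderiv ℝ (F r) (flow F s r z) (flow F s r z' - flow F s r z - D r (z' - z))‖ ≤
          Λ r * ‖flow F s r z' - flow F s r z - D r (z' - z)‖ :=
        (ContinuousLinearMap.le_opNorm _ _).trans
          (mul_le_mul_of_nonneg_right (hF.fderiv_bound r _) (norm_nonneg _))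
      -- the linearized field applied to the remainder, plus the Taylor remainder of the field
      have h4 : F r (flow F s r z') - F r (flow F s r z)
          - fderiv ℝ (F r) (flow F s r z) (D r (z' - z)) =
          fderiv ℝ (F r) (flow F s r z) (flow F s r z' - flow F s r z - D r (z' - z)) +
          (F r (flow F s r z') - F r (flow F s r z)
            - fderiv ℝ (F r) (flow F s r z) (flow F s r z' - flow F s r z)) := by
        rw [map_sub _ (flow F s r z' - flow F s r z) (D r (z' - z))]
        abel
      rw [h4]
      exact (norm_add_le _ _).trans (add_le_add h3 (h1.trans h2))
  rw [hasFDerivAt_iff_isLittleO]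
  have hO : (fun z' => flow F s t z' - flow F s t z - D t (z' - z)) =O[𝓝 z]
      fun z' => ‖z' - z‖ ^ 2 :=
    Asymptotics.IsBigO.of_bound (κ * (κ ^ 2 * ∫ r in Ioc s t, Λ₂ r))
      (Eventually.of_forall fun z' => by
        rw [norm_pow, norm_norm]
        exact key z')
  refine hO.trans_isLittleO ?_
  have := (Asymptotics.isLittleO_norm_pow_id (E' := E) one_lt_two).comp_tendsto
    (show Tendsto (fun z' => z' - z) (𝓝 z) (𝓝 0) by
      have : Continuous fun z' : E => z' - z := by fun_prop
      simpa using this.tendsto z)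
  exact this

/-- The spatial derivative of the flow solves the linearized equation. -/
theorem exists_fderiv_flow (hF : IsSmoothField F Λ Λ₂) (s : ℝ) (z : E) (T : ℝ) :
    ContinuousOn (fun t => fderiv ℝ (flow F s t) z) (Icc s T) ∧
    IntegrableOn (fun r => (fderiv ℝ (F r) (flow F s r z)).comp (fderiv ℝ (flow F s r) z))
      (Ioc s T) ∧
    ∀ t ∈ Icc s T, fderiv ℝ (flow F s t) z = ContinuousLinearMap.id ℝ E +
      ∫ r in Ioc s t, (fderiv ℝ (F r) (flow F s r z)).comp (fderiv ℝ (flow F s r) z) := by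
  obtain ⟨D, hD, hint, hD2⟩ := hF.exists_fderiv_curve s z
  have h : ∀ t, s ≤ t → fderiv ℝ (flow F s t) z = D t := fun t hst =>
    (hF.hasFDerivAt_flow_of_curve hD hint hD2 hst).fderiv
  refine ⟨hD.continuousOn.congr fun t ht => h t ht.1, ?_, fun t ht => ?_⟩
  · refine hint.integrableOn.congr_fun (fun r hr => ?_) measurableSet_Ioc
    simp only
    rw [h r hr.1.le]
  · rw [h t ht.1]
    conv_lhs => rw [hD2 t]
    congr 1
    refine setIntegral_congr_fun measurableSet_Ioc fun r hr => ?_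
    rw [h r hr.1.le]

theorem differentiable_flow (hF : IsSmoothField F Λ Λ₂) (s t : ℝ) :
    Differentiable ℝ (flow F s t) := by
  intro z
  rcases le_total s t with h | h
  · obtain ⟨D, hD, hint, hD2⟩ := hF.exists_fderiv_curve s z
    exact (hF.hasFDerivAt_flow_of_curve hD hint hD2 h).differentiableAt
  · have : flow F s t = id := funext fun z => hF.flow_of_le h z
    rw [this]
    exact differentiableAt_id

theorem norm_fderiv_flow_le (hF : IsSmoothField F Λ Λ₂) (s t : ℝ) (z : E) :
    ‖fderiv ℝ (flow F s t) z‖ ≤ gron Λ :=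
  norm_fderiv_le_of_lip' ℝ hF.gron_nonneg (Eventually.of_forall fun z' =>
    hF.norm_flow_sub_flow_le s t z' z)

theorem norm_fderiv_flow_sub_id_le (hF : IsSmoothField F Λ Λ₂) {s t : ℝ} (hst : s ≤ t) (z : E) :
    ‖fderiv ℝ (flow F s t) z - ContinuousLinearMap.id ℝ E‖ ≤ gron Λ * ∫ r in Ioc s t, Λ r := by
  obtain ⟨-, -, h⟩ := hF.exists_fderiv_flow s z t
  rw [h t (right_mem_Icc.mpr hst), add_sub_cancel_left, ← integral_const_mul]
  refine norm_integral_le_of_norm_le (hF.integrable.const_mul _).integrableOn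
    (ae_of_all _ fun r => ?_)
  refine (ContinuousLinearMap.opNorm_comp_le _ _).trans ?_
  rw [mul_comm]
  exact mul_le_mul (hF.norm_fderiv_flow_le s r z) (hF.fderiv_bound r _) (norm_nonneg _)
    hF.gron_nonneg

/-- The spatial derivative of the flow is Lipschitz in the initial point: the difference of two
solutions of the linearized equation solves it up to an error controlled by `Λ₂`. -/
theorem norm_fderiv_flow_sub_le (hF : IsSmoothField F Λ Λ₂) (s t : ℝ) (z z' : E) :
    ‖fderiv ℝ (flow F s t) z - fderiv ℝ (flow F s t) z'‖ ≤
      gron Λ ^ 3 * (∫ r, Λ₂ r) * ‖z - z'‖ := by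
  have hκ := hF.gron_nonneg
  rcases le_total s t with hst | hst
  · obtain ⟨c1, i1, h1⟩ := hF.exists_fderiv_flow s z t
    obtain ⟨c2, i2, h2⟩ := hF.exists_fderiv_flow s z' t
    have h := norm_le_of_integral_eq hF.integrable hF.nonneg (s := s) (T := t)
      (Z := fun t => fderiv ℝ (flow F s t) z - fderiv ℝ (flow F s t) z')
      (q := fun r => (fderiv ℝ (F r) (flow F s r z)).comp (fderiv ℝ (flow F s r) z)
        - (fderiv ℝ (F r) (flow F s r z')).comp (fderiv ℝ (flow F s r) z'))
      (e := fun r => Λ₂ r * (gron Λ * ‖z - z'‖ * gron Λ)) (v := 0) (c1.sub c2)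
      (hF.integrable₂.mul_const _).integrableOn ?_ ?_ ?_ t (right_mem_Icc.mpr hst)
    · rw [integral_mul_const, norm_zero, zero_add] at h
      refine h.trans ?_
      have h3 : ∫ r in Ioc s t, Λ₂ r ≤ ∫ r, Λ₂ r :=
        setIntegral_le_integral hF.integrable₂ (ae_of_all _ hF.nonneg₂)
      calc _ ≤ gron Λ * ((∫ r, Λ₂ r) * (gron Λ * ‖z - z'‖ * gron Λ)) := by gcongr
        _ = _ := by ring
    · intro r _
      exact mul_nonneg (hF.nonneg₂ r) (by positivity)
    · intro q hq
      rw [h1 q hq, h2 q hq, integral_sub (i1.mono_set (Ioc_subset_Ioc_right hq.2))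
        (i2.mono_set (Ioc_subset_Ioc_right hq.2))]
      abel
    · intro r _
      have h4 : (fderiv ℝ (F r) (flow F s r z)).comp (fderiv ℝ (flow F s r) z)
          - (fderiv ℝ (F r) (flow F s r z')).comp (fderiv ℝ (flow F s r) z') =
          (fderiv ℝ (F r) (flow F s r z)).comp
            (fderiv ℝ (flow F s r) z - fderiv ℝ (flow F s r) z') +
          (fderiv ℝ (F r) (flow F s r z) - fderiv ℝ (F r) (flow F s r z')).comp
            (fderiv ℝ (flow F s r) z') := by
        rw [ContinuousLinearMap.comp_sub, ContinuousLinearMap.sub_comp]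
        abel
      rw [h4]
      refine (norm_add_le _ _).trans (add_le_add ?_ ?_)
      · exact (ContinuousLinearMap.opNorm_comp_le _ _).trans
          (mul_le_mul_of_nonneg_right (hF.fderiv_bound r _) (norm_nonneg _))
      · refine (ContinuousLinearMap.opNorm_comp_le _ _).trans ?_
        rw [← mul_assoc]
        refine mul_le_mul ?_ (hF.norm_fderiv_flow_le s r z') (norm_nonneg _)
          (mul_nonneg (hF.nonneg₂ r) (by positivity))
        exact (hF.fderiv_lip r _ _).trans (mul_le_mul_of_nonneg_left
          (hF.norm_flow_sub_flow_le s r z z') (hF.nonneg₂ r))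
  · have : flow F s t = id := funext fun z => hF.flow_of_le hst z
    rw [this, fderiv_id, fderiv_id, sub_self, norm_zero]
    have : 0 ≤ ∫ r, Λ₂ r := integral_nonneg hF.nonneg₂
    positivity

end IsSmoothField

/-! ### The backward transport equation -/

/-- The primitive `∫_{-∞}^t Λ`. -/
noncomputable def cumul (Λ : ℝ → ℝ) (t : ℝ) : ℝ := ∫ r in Iic t, Λ r

theorem setIntegral_Ioc_eq_cumul {Λ : ℝ → ℝ} (hΛ : Integrable Λ) {s t : ℝ} (hst : s ≤ t) :
    ∫ r in Ioc s t, Λ r = cumul Λ t - cumul Λ s := by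
  unfold cumul
  rw [integral_Iic_sub hΛ hst]
  ring

theorem continuous_cumul {Λ : ℝ → ℝ} (hΛ : Integrable Λ) : Continuous (cumul Λ) := by
  have h : cumul Λ = fun t => (∫ r in Iic 0, Λ r) + ∫ r in (0 : ℝ)..t, Λ r := by
    ext t
    unfold cumul
    rw [← intervalIntegral.integral_Iic_sub_Iic hΛ.integrableOn hΛ.integrableOn]
    ring
  rw [h]
  exact continuous_const.add
    (intervalIntegral.continuous_primitive (fun a b => hΛ.intervalIntegrable) 0)

variable {E : Type*} [NormedAddCommGroup E] [NormedSpace ℝ E]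

theorem aestronglyMeasurable_apply {α : Type*} {_ : MeasurableSpace α} {μ : Measure α}
    {L : α → E →L[ℝ] ℝ} {v : α → E} (hL : AEStronglyMeasurable L μ)
    (hv : AEStronglyMeasurable v μ) : AEStronglyMeasurable (fun x => L x (v x)) μ :=
  (isBoundedBilinearMap_apply (𝕜 := ℝ) (E := E) (F := ℝ)).continuous.comp_aestronglyMeasurable
    (hL.prodMk hv)

theorem tendsto_apply {α : Type*} {l : Filter α} {L : α → E →L[ℝ] ℝ} {v : α → E} {L₀ : E →L[ℝ] ℝ}
    {v₀ : E} (hL : Tendsto L l (𝓝 L₀)) (hv : Tendsto v l (𝓝 v₀)) :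
    Tendsto (fun x => L x (v x)) l (𝓝 (L₀ v₀)) :=
  ((isBoundedBilinearMap_apply (𝕜 := ℝ) (E := E) (F := ℝ)).continuous.tendsto (L₀, v₀)).comp
    (hL.prodMk_nhds hv)

/-- Functions with a gradient of linear growth whose local Lipschitz constant also has linear
growth. For `K₁ = 0` these are the functions with a bounded Lipschitz gradient. -/
structure HasTameGradient (φ : E → ℝ) (K K₁ : ℝ) : Prop where
  diff : Differentiable ℝ φ
  bound : ∀ z, ‖fderiv ℝ φ z‖ ≤ K + K₁ * ‖z‖
  lip : ∀ z z', ‖fderiv ℝ φ z - fderiv ℝ φ z'‖ ≤ (K + K₁ * (‖z‖ + ‖z'‖)) * ‖z - z'‖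
  nonneg : 0 ≤ K
  nonneg₁ : 0 ≤ K₁

theorem HasTameGradient.continuous_fderiv {φ : E → ℝ} {K K₁ : ℝ} (h : HasTameGradient φ K K₁) :
    Continuous (fderiv ℝ φ) := by
  refine continuous_iff_continuousAt.mpr fun z => ?_
  have h1 : Tendsto (fun z' => (K + K₁ * (‖z'‖ + ‖z‖)) * ‖z' - z‖) (𝓝 z) (𝓝 0) := by
    have hc : Continuous fun z' => (K + K₁ * (‖z'‖ + ‖z‖)) * ‖z' - z‖ := by fun_prop
    simpa using hc.tendsto z
  exact tendsto_iff_norm_sub_tendsto_zero.mpr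
    (squeeze_zero (fun _ => norm_nonneg _) (fun z' => h.lip z' z) h1)

theorem HasTameGradient.contDiff {φ : E → ℝ} {K K₁ : ℝ} (h : HasTameGradient φ K K₁) :
    ContDiff ℝ 1 φ :=
  contDiff_one_iff_fderiv.mpr ⟨h.diff, h.continuous_fderiv⟩

theorem HasTameGradient.abs_sub_le {φ : E → ℝ} {K K₁ : ℝ} (h : HasTameGradient φ K K₁)
    (z z' : E) : |φ z' - φ z| ≤ (K + K₁ * (‖z‖ + ‖z' - z‖)) * ‖z' - z‖ := by
  rw [← Real.norm_eq_abs]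
  refine (convex_segment z z').norm_image_sub_le_of_norm_fderiv_le (𝕜 := ℝ)
    (fun x _ => h.diff x) (fun x hx => ?_) (left_mem_segment ℝ z z') (right_mem_segment ℝ z z')
  refine (h.bound x).trans ?_
  rw [segment_eq_image'] at hx
  obtain ⟨θ, hθ, rfl⟩ := hx
  have h1 : ‖z + θ • (z' - z)‖ ≤ ‖z‖ + ‖z' - z‖ := by
    refine (norm_add_le _ _).trans (add_le_add le_rfl ?_)
    rw [norm_smul, Real.norm_of_nonneg hθ.1]
    exact mul_le_of_le_one_left (norm_nonneg _) hθ.2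
  have := mul_le_mul_of_nonneg_left h1 h.nonneg₁
  linarith

/-- The solution `u_t = φ ∘ X_{t,T}` of the backward transport equation with terminal value `φ`. -/
noncomputable def pull (F : ℝ → E → E) (φ : E → ℝ) (T t : ℝ) (z : E) : ℝ := φ (flow F t T z)

namespace IsSmoothField

variable {F : ℝ → E → E} {Λ Λ₂ : ℝ → ℝ} [FiniteDimensional ℝ E] [MeasurableSpace E]
  [BorelSpace E] {φ : E → ℝ} {K K₁ : ℝ}

theorem pull_of_le (hF : IsSmoothField F Λ Λ₂) (φ : E → ℝ) {T t : ℝ} (h : T ≤ t) :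
    pull F φ T t = φ :=
  funext fun z => by rw [pull, hF.flow_of_le h]

/-- The solution of the transport equation is constant along the flow. -/
theorem pull_flow (hF : IsSmoothField F Λ Λ₂) (φ : E → ℝ) {T s t : ℝ} (hst : s ≤ t)
    (htT : t ≤ T) (z : E) : pull F φ T t (flow F s t z) = pull F φ T s z := by
  rw [pull, pull, hF.flow_flow hst htT]

/-- Composition with the flow preserves tame gradients, uniformly in time. -/
theorem exists_tame_pull (hF : IsSmoothField F Λ Λ₂) (hφ : HasTameGradient φ K K₁) (T : ℝ) :
    ∃ C, 0 ≤ C ∧ ∀ t, HasTameGradient (pull F φ T t) (C * (K + K₁)) (C * K₁) := by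
  set κ := gron Λ with hκ
  set κ₃ := gron Λ ^ 3 * (∫ r, Λ₂ r) with hκ₃
  set A := ∫ r, Λ r with hA
  have hκ1 : 1 ≤ κ := hF.one_le_gron
  have hκ0 : 0 ≤ κ := hF.gron_nonneg
  have hκ₃0 : 0 ≤ κ₃ := mul_nonneg (by positivity) (integral_nonneg hF.nonneg₂)
  have hA0 : 0 ≤ A := integral_nonneg hF.nonneg
  have hK := hφ.nonneg
  have hK₁ := hφ.nonneg₁
  have hder : ∀ t z, fderiv ℝ (pull F φ T t) z =
      (fderiv ℝ φ (flow F t T z)).comp (fderiv ℝ (flow F t T) z) := fun t z =>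
    fderiv_comp z (hφ.diff _) (hF.differentiable_flow t T z)
  have hb : ∀ t z, ‖fderiv ℝ φ (flow F t T z)‖ ≤ K + K₁ * (‖z‖ + A) := fun t z =>
    (hφ.bound _).trans (add_le_add le_rfl
      (mul_le_mul_of_nonneg_left (hF.norm_flow_le t T z) hK₁))
  refine ⟨(κ + κ ^ 2 + κ₃) * (1 + 2 * A), by positivity, fun t => ⟨?_, ?_, ?_, by positivity,
    by positivity⟩⟩
  · intro z
    exact (hφ.diff _).comp z (hF.differentiable_flow t T z)
  · intro z
    rw [hder]
    calc _ ≤ ‖fderiv ℝ φ (flow F t T z)‖ * ‖fderiv ℝ (flow F t T) z‖ :=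
          ContinuousLinearMap.opNorm_comp_le _ _
      _ ≤ (K + K₁ * (‖z‖ + A)) * κ := mul_le_mul (hb t z) (hF.norm_fderiv_flow_le t T z)
          (norm_nonneg _) (by positivity)
      _ ≤ ((1 + 2 * A) * ((K + K₁) + K₁ * ‖z‖)) * (κ + κ ^ 2 + κ₃) := by
          refine mul_le_mul ?_ ?_ hκ0 (by positivity)
          · have h1 := norm_nonneg z
            have h2 : 0 ≤ A * K := by positivity
            have h3 : 0 ≤ A * K₁ := by positivity
            have h4 : 0 ≤ A * (K₁ * ‖z‖) := by positivity
            nlinarith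
          · have : 0 ≤ κ ^ 2 := by positivity
            linarith
      _ = _ := by ring
  · intro z z'
    rw [hder, hder]
    set D := fderiv ℝ (flow F t T) z
    set D' := fderiv ℝ (flow F t T) z'
    have h1 : (fderiv ℝ φ (flow F t T z)).comp D - (fderiv ℝ φ (flow F t T z')).comp D' =
        (fderiv ℝ φ (flow F t T z) - fderiv ℝ φ (flow F t T z')).comp D +
          (fderiv ℝ φ (flow F t T z')).comp (D - D') := by
      rw [ContinuousLinearMap.comp_sub, ContinuousLinearMap.sub_comp]
      abel
    have h2 : ‖fderiv ℝ φ (flow F t T z) - fderiv ℝ φ (flow F t T z')‖ ≤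
        (K + K₁ * ((‖z‖ + A) + (‖z'‖ + A))) * (κ * ‖z - z'‖) := by
      refine (hφ.lip _ _).trans (mul_le_mul ?_ (hF.norm_flow_sub_flow_le t T z z')
        (norm_nonneg _) (by positivity))
      exact add_le_add le_rfl (mul_le_mul_of_nonneg_left
        (add_le_add (hF.norm_flow_le t T z) (hF.norm_flow_le t T z')) hK₁)
    have hS : K + K₁ * ((‖z‖ + A) + (‖z'‖ + A)) ≤
        (1 + 2 * A) * ((K + K₁) + K₁ * (‖z‖ + ‖z'‖)) := by
      have h2 : 0 ≤ A * K := by positivity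
      have h4 : 0 ≤ A * (K₁ * (‖z‖ + ‖z'‖)) := by positivity
      nlinarith
    have hS' : K + K₁ * (‖z'‖ + A) ≤ (1 + 2 * A) * ((K + K₁) + K₁ * (‖z‖ + ‖z'‖)) := by
      refine le_trans ?_ hS
      have : 0 ≤ K₁ * (‖z‖ + A) := by positivity
      nlinarith
    set S := (1 + 2 * A) * ((K + K₁) + K₁ * (‖z‖ + ‖z'‖))
    have hS0 : 0 ≤ S := by positivity
    rw [h1]
    calc _ ≤ S * (κ * ‖z - z'‖) * κ + S * (κ₃ * ‖z - z'‖) := by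
          refine (norm_add_le _ _).trans (add_le_add ?_ ?_)
          · refine (ContinuousLinearMap.opNorm_comp_le _ _).trans (mul_le_mul
              (h2.trans (mul_le_mul_of_nonneg_right hS (by positivity)))
              (hF.norm_fderiv_flow_le t T z) (norm_nonneg _) (by positivity))
          · exact (ContinuousLinearMap.opNorm_comp_le _ _).trans (mul_le_mul
              ((hb t z').trans hS') (hF.norm_fderiv_flow_sub_le t T z z') (norm_nonneg _) hS0)
      _ = S * (κ ^ 2 + κ₃) * ‖z - z'‖ := by ring
      _ ≤ S * (κ + κ ^ 2 + κ₃) * ‖z - z'‖ := by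
          gcongr
          linarith
      _ = _ := by ring

/-- Time regularity of the solution of the transport equation and of its gradient. -/
theorem exists_pull_time_bound (hF : IsSmoothField F Λ Λ₂) (hφ : HasTameGradient φ K K₁) (T : ℝ) :
    ∃ C, 0 ≤ C ∧ ∀ s t z,
      |pull F φ T t z - pull F φ T s z| ≤ C * (1 + ‖z‖) * |cumul Λ t - cumul Λ s| ∧
      ‖fderiv ℝ (pull F φ T t) z - fderiv ℝ (pull F φ T s) z‖ ≤
        C * (1 + ‖z‖) * |cumul Λ t - cumul Λ s| := by
  obtain ⟨C₀, hC₀, htame⟩ := hF.exists_tame_pull hφ T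
  set K' := C₀ * (K + K₁)
  set K₁' := C₀ * K₁
  have hK : 0 ≤ K' := (htame 0).nonneg
  have hK₁ : 0 ≤ K₁' := (htame 0).nonneg₁
  set κ := gron Λ with hκ
  set A := ∫ r, Λ r with hA
  have hκ1 : 1 ≤ κ := hF.one_le_gron
  have hκ0 : 0 ≤ κ := hF.gron_nonneg
  have hA0 : 0 ≤ A := integral_nonneg hF.nonneg
  refine ⟨2 * κ * (K' + K₁' * (2 + A)), by positivity, ?_⟩
  have hmain : ∀ s t z, s ≤ t → t ≤ T →
      |pull F φ T t z - pull F φ T s z| ≤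
        2 * κ * (K' + K₁' * (2 + A)) * (1 + ‖z‖) * ∫ r in Ioc s t, Λ r ∧
      ‖fderiv ℝ (pull F φ T t) z - fderiv ℝ (pull F φ T s) z‖ ≤
        2 * κ * (K' + K₁' * (2 + A)) * (1 + ‖z‖) * ∫ r in Ioc s t, Λ r := by
    intro s t z hst htT
    -- `u_s = u_t ∘ X_{s,t}` turns the time increment of `u` into a displacement of at most `∫ Λ`
    have hcomp : pull F φ T s = pull F φ T t ∘ flow F s t :=
      funext fun z => (hF.pull_flow φ hst htT z).symm
    have hd : ‖flow F s t z - z‖ ≤ ∫ r in Ioc s t, Λ r := hF.norm_flow_sub_self s t z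
    have hdA : ‖flow F s t z - z‖ ≤ A := hd.trans (hF.setIntegral_le s t)
    set I := ∫ r in Ioc s t, Λ r
    have hI0 : 0 ≤ I := hF.setIntegral_nonneg s t
    have hz := norm_nonneg z
    have hlin : K' + K₁' * (‖z‖ + (‖z‖ + A)) ≤ (K' + K₁' * (2 + A)) * (1 + ‖z‖) := by
      have : 0 ≤ K' * ‖z‖ := by positivity
      have : 0 ≤ K₁' * (A * ‖z‖) := by positivity
      nlinarith
    have hlin2 : K' + K₁' * ‖z‖ ≤ (K' + K₁' * (2 + A)) * (1 + ‖z‖) := by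
      refine le_trans ?_ hlin
      have : 0 ≤ K₁' * (‖z‖ + A) := by positivity
      nlinarith
    have hlin3 : K' + K₁' * (‖z‖ + A) ≤ (K' + K₁' * (2 + A)) * (1 + ‖z‖) := by
      refine le_trans ?_ hlin
      have : 0 ≤ K₁' * ‖z‖ := by positivity
      nlinarith
    set S := (K' + K₁' * (2 + A)) * (1 + ‖z‖)
    have hS0 : 0 ≤ S := by positivity
    have hSI : S * I ≤ 2 * κ * S * I := by
      have := mul_nonneg hS0 hI0
      nlinarith
    constructor
    · rw [hcomp, abs_sub_comm]
      calc _ ≤ (K' + K₁' * (‖z‖ + ‖flow F s t z - z‖)) * ‖flow F s t z - z‖ :=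
            (htame t).abs_sub_le z (flow F s t z)
        _ ≤ S * I := by
            refine mul_le_mul (le_trans ?_ hlin3) hd (norm_nonneg _) hS0
            gcongr
        _ ≤ 2 * κ * S * I := hSI
        _ = _ := by simp only [S]; ring
    · have hder : fderiv ℝ (pull F φ T s) z =
          (fderiv ℝ (pull F φ T t) (flow F s t z)).comp (fderiv ℝ (flow F s t) z) := by
        rw [hcomp]
        exact fderiv_comp z ((htame t).diff _) (hF.differentiable_flow s t z)
      set D := fderiv ℝ (flow F s t) z
      have h1 : fderiv ℝ (pull F φ T s) z - fderiv ℝ (pull F φ T t) z =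
          (fderiv ℝ (pull F φ T t) (flow F s t z) - fderiv ℝ (pull F φ T t) z).comp D +
          (fderiv ℝ (pull F φ T t) z).comp (D - ContinuousLinearMap.id ℝ E) := by
        rw [hder, ContinuousLinearMap.comp_sub, ContinuousLinearMap.sub_comp,
          ContinuousLinearMap.comp_id]
        abel
      rw [norm_sub_rev, h1]
      calc _ ≤ S * I * κ + S * (κ * I) := by
            refine (norm_add_le _ _).trans (add_le_add ?_ ?_)
            · refine (ContinuousLinearMap.opNorm_comp_le _ _).trans (mul_le_mul ?_
                (hF.norm_fderiv_flow_le s t z) (norm_nonneg _) (by positivity))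
              refine ((htame t).lip _ _).trans (mul_le_mul (le_trans ?_ hlin) hd
                (norm_nonneg _) hS0)
              have h2 : ‖flow F s t z‖ ≤ ‖z‖ + A := hF.norm_flow_le s t z
              have := mul_le_mul_of_nonneg_left h2 hK₁
              nlinarith
            · exact (ContinuousLinearMap.opNorm_comp_le _ _).trans (mul_le_mul
                (((htame t).bound z).trans hlin2) (hF.norm_fderiv_flow_sub_id_le hst z)
                (norm_nonneg _) hS0)
        _ = _ := by simp only [S]; ring
  -- reduction to ordered times before `T`
  have hall : ∀ s t z, s ≤ t →
      |pull F φ T t z - pull F φ T s z| ≤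
        2 * κ * (K' + K₁' * (2 + A)) * (1 + ‖z‖) * ∫ r in Ioc s t, Λ r ∧
      ‖fderiv ℝ (pull F φ T t) z - fderiv ℝ (pull F φ T s) z‖ ≤
        2 * κ * (K' + K₁' * (2 + A)) * (1 + ‖z‖) * ∫ r in Ioc s t, Λ r := by
    intro s t z hst
    rcases le_total t T with htT | htT
    · exact hmain s t z hst htT
    rcases le_total s T with hsT | hsT
    · have h := hmain s T z hsT le_rfl
      rw [hF.pull_of_le φ htT]
      rw [hF.pull_of_le φ le_rfl] at h
      have h2 : ∫ r in Ioc s T, Λ r ≤ ∫ r in Ioc s t, Λ r :=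
        setIntegral_mono_set hF.integrable.integrableOn (ae_of_all _ hF.nonneg)
          (Eventually.of_forall (Ioc_subset_Ioc_right htT))
      have h3 := mul_le_mul_of_nonneg_left h2
        (show 0 ≤ 2 * κ * (K' + K₁' * (2 + A)) * (1 + ‖z‖) by positivity)
      exact ⟨h.1.trans h3, h.2.trans h3⟩
    · rw [hF.pull_of_le φ htT, hF.pull_of_le φ hsT]
      have h4 := hF.setIntegral_nonneg s t
      simp only [sub_self, abs_zero, norm_zero]
      exact ⟨by positivity, by positivity⟩
  intro s t z
  rcases le_total s t with hst | hst
  · have h := hall s t z hst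
    have h5 : |cumul Λ t - cumul Λ s| = ∫ r in Ioc s t, Λ r := by
      rw [← setIntegral_Ioc_eq_cumul hF.integrable hst, abs_of_nonneg (hF.setIntegral_nonneg s t)]
    rwa [h5]
  · have h := hall t s z hst
    have h5 : |cumul Λ t - cumul Λ s| = ∫ r in Ioc t s, Λ r := by
      rw [abs_sub_comm, ← setIntegral_Ioc_eq_cumul hF.integrable hst,
        abs_of_nonneg (hF.setIntegral_nonneg t s)]
    rw [h5, abs_sub_comm, norm_sub_rev]
    exact h

theorem continuous_fderiv_pull (hF : IsSmoothField F Λ Λ₂) (hφ : HasTameGradient φ K K₁) (T : ℝ) :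
    Continuous fun p : ℝ × E => fderiv ℝ (pull F φ T p.1) p.2 := by
  obtain ⟨C₀, hC₀, htame⟩ := hF.exists_tame_pull hφ T
  obtain ⟨C, hC, hbd⟩ := hF.exists_pull_time_bound hφ T
  refine continuous_iff_continuousAt.mpr fun ⟨t, z⟩ => ?_
  have hA := continuous_cumul hF.integrable
  have h1 : Tendsto (fun p : ℝ × E =>
      (C₀ * (K + K₁) + C₀ * K₁ * (‖p.2‖ + ‖z‖)) * ‖p.2 - z‖ +
        C * (1 + ‖z‖) * |cumul Λ p.1 - cumul Λ t|) (𝓝 (t, z)) (𝓝 0) := by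
    have hc : Continuous (fun p : ℝ × E =>
      (C₀ * (K + K₁) + C₀ * K₁ * (‖p.2‖ + ‖z‖)) * ‖p.2 - z‖ +
        C * (1 + ‖z‖) * |cumul Λ p.1 - cumul Λ t|) := by fun_prop
    simpa using hc.tendsto (t, z)
  refine tendsto_iff_norm_sub_tendsto_zero.mpr (squeeze_zero (fun _ => norm_nonneg _) ?_ h1)
  intro p
  have h2 := norm_add_le (fderiv ℝ (pull F φ T p.1) p.2 - fderiv ℝ (pull F φ T p.1) z)
    (fderiv ℝ (pull F φ T p.1) z - fderiv ℝ (pull F φ T t) z)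
  rw [sub_add_sub_cancel] at h2
  exact h2.trans (add_le_add ((htame p.1).lip p.2 z) (hbd t p.1 z).2)

/-- `pull F φ T` solves the transport equation in integrated form. Over a short interval `[s, t]` the
increment `u_t(z) - u_s(z) = u_t(z) - u_t(X_{s,t}(z))` is given by the chain rule for `u_t` along the
flow. -/
theorem pull_eq (hF : IsSmoothField F Λ Λ₂) (hφ : HasTameGradient φ K K₁) {s T : ℝ} (hsT : s ≤ T)
    (z : E) : pull F φ T s z =
      φ z + ∫ r in Ioc s T, fderiv ℝ (pull F φ T r) z (F r z) := by
  have : CompleteSpace E := FiniteDimensional.complete ℝ E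
  obtain ⟨C₀, hC₀, htame⟩ := hF.exists_tame_pull hφ T
  have hcont := hF.continuous_fderiv_pull hφ T
  have hA := continuous_cumul hF.integrable
  have hK : 0 ≤ C₀ * (K + K₁) := (htame 0).nonneg
  have hK₁ : 0 ≤ C₀ * K₁ := (htame 0).nonneg₁
  have h := sub_eq_integral_of_local (a := s) (b := T) (f := fun t => pull F φ T t z)
    (k := fun s t r => -fderiv ℝ (pull F φ T t) (flow F s r z) (F r (flow F s r z)))
    (k₀ := fun r => -fderiv ℝ (pull F φ T r) z (F r z))
    (Λ := fun r => (C₀ * (K + K₁) + C₀ * K₁ * (‖z‖ + ∫ q, Λ q)) * Λ r) hsT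
    (hF.integrable.const_mul _).integrableOn ?_ ?_ ?_ ?_
  · rw [integral_neg, hF.pull_of_le φ le_rfl] at h
    linarith
  · intro s' t _ _ _
    have h1 : Continuous fun r => fderiv ℝ (pull F φ T t) (flow F s' r z) :=
      (htame t).continuous_fderiv.comp (hF.continuous_flow_time s' z)
    exact (aestronglyMeasurable_apply h1.aestronglyMeasurable
      (hF.integrable_flow s' z).aestronglyMeasurable).neg.restrict
  · intro s' t _ hst htT
    have h1 := chain_rule_curve (htame t).contDiff (X := fun r => flow F s' r z)
      (v := fun r => F r (flow F s' r z)) hst (hF.integrable_flow s' z).integrableOn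
      (fun q _ => by rw [hF.flow_of_le le_rfl]; exact hF.flow_eq s' q z)
    rw [hF.pull_flow φ hst htT, hF.flow_of_le le_rfl] at h1
    rw [integral_neg, ← h1]
    ring
  · intro s' t r _ _ _
    rw [abs_neg, ← Real.norm_eq_abs]
    refine (ContinuousLinearMap.le_opNorm _ _).trans
      (mul_le_mul (((htame t).bound _).trans ?_) (hF.bound r _) (norm_nonneg _) ?_)
    · have := mul_le_mul_of_nonneg_left (hF.norm_flow_le s' r z) hK₁
      linarith
    · have : 0 ≤ ∫ q, Λ q := integral_nonneg hF.nonneg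
      positivity
  · intro r hr
    have h1 : Tendsto (fun p : ℝ × ℝ => flow F p.1 r z)
        (𝓝[Icc s r] r ×ˢ 𝓝[Icc r T] r) (𝓝 z) := by
      have h2 : Tendsto (fun q => flow F q r z) (𝓝[Icc s r] r) (𝓝 z) := by
        have h3 : Tendsto (fun q => cumul Λ r - cumul Λ q) (𝓝[Icc s r] r) (𝓝 0) := by
          have hc : Continuous fun q => cumul Λ r - cumul Λ q := by fun_prop
          have := hc.tendsto r
          rw [sub_self] at this
          exact this.mono_left nhdsWithin_le_nhds
        refine tendsto_iff_norm_sub_tendsto_zero.mpr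
          (squeeze_zero' (Eventually.of_forall fun _ => norm_nonneg _) ?_ h3)
        filter_upwards [self_mem_nhdsWithin] with q hq
        rw [← setIntegral_Ioc_eq_cumul hF.integrable hq.2]
        exact hF.norm_flow_sub_self q r z
      exact h2.comp tendsto_fst
    have h2 : Tendsto (fun p : ℝ × ℝ => p.2) (𝓝[Icc s r] r ×ˢ 𝓝[Icc r T] r) (𝓝 r) :=
      (tendsto_id.mono_left nhdsWithin_le_nhds).comp tendsto_snd
    have h3 : Tendsto (fun p : ℝ × ℝ => fderiv ℝ (pull F φ T p.2) (flow F p.1 r z))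
        (𝓝[Icc s r] r ×ˢ 𝓝[Icc r T] r) (𝓝 (fderiv ℝ (pull F φ T r) z)) :=
      Tendsto.comp (g := fun p : ℝ × E => fderiv ℝ (pull F φ T p.1) p.2)
        (f := fun p : ℝ × ℝ => (p.2, flow F p.1 r z)) (hcont.tendsto (r, z)) (h2.prodMk_nhds h1)
    have h4 : Tendsto (fun p : ℝ × ℝ => F r (flow F p.1 r z))
        (𝓝[Icc s r] r ×ˢ 𝓝[Icc r T] r) (𝓝 (F r z)) :=
      ((hF.caratheodory.continuous r).tendsto z).comp h1
    exact (tendsto_apply h3 h4).neg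

/-- A solution of the transport equation driven by `F`, evaluated along a curve with another
velocity `G`: its variation only involves the difference of the velocities. -/
theorem transport_along_curve (hF : IsSmoothField F Λ Λ₂) {w : ℝ → E → ℝ} {a b : ℝ} (hab : a ≤ b)
    (hw : ∀ t ∈ Icc a b, ContDiff ℝ 1 (w t))
    (hwc : ContinuousOn (fun p : ℝ × E => fderiv ℝ (w p.1) p.2) (Icc a b ×ˢ univ))
    (hweq : ∀ s ∈ Icc a b, ∀ t ∈ Icc a b, s ≤ t → ∀ z,
      w t z - w s z = -∫ r in Ioc s t, fderiv ℝ (w r) z (F r z))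
    {Y G : ℝ → E} (hG : IntegrableOn G (Ioc a b))
    (hY : ∀ t ∈ Icc a b, Y t = Y a + ∫ r in Ioc a t, G r) :
    w b (Y b) - w a (Y a) =
      ∫ r in Ioc a b, fderiv ℝ (w r) (Y r) (G r - F r (Y r)) := by
  have : CompleteSpace E := FiniteDimensional.complete ℝ E
  have hGint : Integrable ((Ioc a b).indicator G) := hG.integrable_indicator measurableSet_Ioc
  have hYc : ContinuousOn Y (Icc a b) := by
    refine ((continuous_const.add (continuous_setIntegral_Ioc hGint a)).continuousOn).congr
      (f := fun t => Y a + ∫ r in Ioc a t, (Ioc a b).indicator G r) fun t ht => ?_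
    beta_reduce
    rw [hY t ht, setIntegral_indicator measurableSet_Ioc,
      inter_eq_left.mpr (Ioc_subset_Ioc_right ht.2)]
  have hYinc : ∀ s ∈ Icc a b, ∀ t ∈ Icc s b, Y t = Y s + ∫ r in Ioc s t, G r := by
    intro s hs t ht
    have ht' : t ∈ Icc a b := ⟨hs.1.trans ht.1, ht.2⟩
    have h1 : ∀ c d, a ≤ c → d ≤ b → ∫ r in Ioc c d, (Ioc a b).indicator G r
        = ∫ r in Ioc c d, G r := fun c d hc hd => by
      rw [setIntegral_indicator measurableSet_Ioc, inter_eq_left.mpr (Ioc_subset_Ioc hc hd)]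
    rw [hY t ht', hY s hs, ← h1 a t le_rfl ht.2, ← h1 a s le_rfl hs.2, ← h1 s t hs.1 ht.2,
      setIntegral_Ioc_add hGint hs.1 ht.1, add_assoc]
  -- a bound for the gradients of `w` on the compact range of the curve
  obtain ⟨M, hM⟩ := (isCompact_Icc.prod
    (isCompact_Icc.image_of_continuousOn hYc)).exists_bound_of_continuousOn
      (hwc.mono (prod_mono le_rfl (subset_univ _)))
  have hM' : ∀ s ∈ Icc a b, ∀ t ∈ Icc a b, ‖fderiv ℝ (w s) (Y t)‖ ≤ M := fun s hs t ht =>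
    hM (s, Y t) ⟨hs, mem_image_of_mem _ ht⟩
  have hFc : ∀ z, Integrable fun r => F r z := fun z => hF.integrable_comp continuous_const
  have hwz : ∀ z, ContinuousOn (fun r => fderiv ℝ (w r) z) (Icc a b) := fun z =>
    hwc.comp (by fun_prop : ContinuousOn (fun r : ℝ => (r, z)) (Icc a b))
      fun r hr => ⟨hr, mem_univ _⟩
  have hi1 : ∀ z s t, a ≤ s → t ≤ b →
      IntegrableOn (fun r => fderiv ℝ (w r) z (F r z)) (Ioc s t) := by
    intro z s t has htb
    obtain ⟨M', hM'⟩ := isCompact_Icc.exists_bound_of_continuousOn (hwz z)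
    have hsub : Ioc s t ⊆ Icc a b :=
      (Ioc_subset_Ioc has htb).trans Ioc_subset_Icc_self
    refine (hF.integrable.const_mul M').integrableOn.mono'
      (aestronglyMeasurable_apply (((hwz z).mono hsub).aestronglyMeasurable measurableSet_Ioc)
        (hFc z).aestronglyMeasurable.restrict) ?_
    refine (ae_restrict_iff' measurableSet_Ioc).mpr (ae_of_all _ fun r hr => ?_)
    exact (ContinuousLinearMap.le_opNorm _ _).trans (mul_le_mul (hM' r (hsub hr)) (hF.bound r z)
      (norm_nonneg _) ((norm_nonneg _).trans (hM' r (hsub hr))))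
  have hi2 : ∀ s ∈ Icc a b, ∀ t ≤ b,
      IntegrableOn (fun r => fderiv ℝ (w s) (Y r) (G r)) (Ioc s t) := by
    intro s hs t htb
    have hsub : Ioc s t ⊆ Icc a b :=
      (Ioc_subset_Ioc hs.1 htb).trans Ioc_subset_Icc_self
    have hGst : IntegrableOn G (Ioc s t) := hG.mono_set (Ioc_subset_Ioc hs.1 htb)
    refine (hGst.norm.const_mul M).mono' (aestronglyMeasurable_apply ?_
      hGst.aestronglyMeasurable) ?_
    · exact (((hw s hs).continuous_fderiv one_ne_zero).comp_continuousOn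
        (hYc.mono hsub)).aestronglyMeasurable measurableSet_Ioc
    · refine (ae_restrict_iff' measurableSet_Ioc).mpr (ae_of_all _ fun r hr => ?_)
      exact (ContinuousLinearMap.le_opNorm _ _).trans
        (mul_le_mul_of_nonneg_right (hM' s hs r (hsub hr)) (norm_nonneg _))
  -- the increment over `[s, t]` splits into the increment of `w s` along the curve and the time
  -- increment of `w` at the fixed point `Y t`
  refine sub_eq_integral_of_local (f := fun t => w t (Y t))
    (k := fun s t r => fderiv ℝ (w s) (Y r) (G r) - fderiv ℝ (w r) (Y t) (F r (Y t)))
    (Λ := fun r => M * ‖G r‖ + M * Λ r) hab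
    ((hG.norm.const_mul M).add (hF.integrable.const_mul M).integrableOn) ?_ ?_ ?_ ?_
  · intro s t has hst htb
    exact ((hi2 s ⟨has, hst.trans htb⟩ t htb).sub (hi1 (Y t) s t has htb)).aestronglyMeasurable
  · intro s t has hst htb
    have hs : s ∈ Icc a b := ⟨has, hst.trans htb⟩
    have ht : t ∈ Icc a b := ⟨has.trans hst, htb⟩
    rw [integral_sub (hi2 s hs t htb) (hi1 (Y t) s t has htb)]
    have h1 := hweq s hs t ht hst (Y t)
    have h2 := chain_rule_curve (hw s hs) (X := Y) (v := G) hst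
      (hG.mono_set (Ioc_subset_Ioc has htb)) (fun q hq => hYinc s hs q ⟨hq.1, hq.2.trans htb⟩)
    linarith
  · intro s t r has htb hr
    have hst : s ≤ t := (hr.1.trans_le hr.2).le
    have hs : s ∈ Icc a b := ⟨has, hst.trans htb⟩
    have ht : t ∈ Icc a b := ⟨has.trans hst, htb⟩
    have hr' : r ∈ Icc a b := ⟨has.trans hr.1.le, hr.2.trans htb⟩
    have hM0 : 0 ≤ M := (norm_nonneg _).trans (hM' s hs t ht)
    rw [← Real.norm_eq_abs]
    refine (norm_sub_le _ _).trans (add_le_add ?_ ?_)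
    · exact (ContinuousLinearMap.le_opNorm _ _).trans
        (mul_le_mul_of_nonneg_right (hM' s hs r hr') (norm_nonneg _))
    · exact (ContinuousLinearMap.le_opNorm _ _).trans
        (mul_le_mul (hM' r hr' t ht) (hF.bound r _) (norm_nonneg _) hM0)
  · intro r hr
    have hr' : r ∈ Icc a b := ⟨hr.1.le, hr.2⟩
    rw [map_sub]
    refine Tendsto.sub ?_ ?_
    · have h1 : Tendsto (fun s => fderiv ℝ (w s) (Y r)) (𝓝[Icc a r] r)
          (𝓝 (fderiv ℝ (w r) (Y r))) :=
        ((hwz (Y r)) r hr').mono_left (nhdsWithin_mono r (Icc_subset_Icc_right hr.2))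
      exact tendsto_apply (h1.comp tendsto_fst) tendsto_const_nhds
    · have h1 : Tendsto Y (𝓝[Icc r b] r) (𝓝 (Y r)) :=
        (hYc r hr').mono_left (nhdsWithin_mono r (Icc_subset_Icc_left hr.1.le))
      have h2 : Continuous fun z => fderiv ℝ (w r) z (F r z) :=
        ((hw r hr').continuous_fderiv one_ne_zero).clm_apply (hF.caratheodory.continuous r)
      exact ((h2.tendsto (Y r)).comp h1).comp tendsto_snd

/-- Uniqueness for the transport equation: a solution is constant along the flow. -/
theorem eq_pull_of_transport (hF : IsSmoothField F Λ Λ₂) {w : ℝ → E → ℝ} {a b : ℝ}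
    (hw : ∀ t ∈ Icc a b, ContDiff ℝ 1 (w t))
    (hwc : ContinuousOn (fun p : ℝ × E => fderiv ℝ (w p.1) p.2) (Icc a b ×ˢ univ))
    (hweq : ∀ s ∈ Icc a b, ∀ t ∈ Icc a b, s ≤ t → ∀ z,
      w t z - w s z = -∫ r in Ioc s t, fderiv ℝ (w r) z (F r z)) (hwb : w b = φ) :
    ∀ t ∈ Icc a b, w t = pull F φ b t := by
  intro t ht
  ext z
  have hsub : Icc t b ⊆ Icc a b := Icc_subset_Icc_left ht.1
  have h := hF.transport_along_curve (w := w) ht.2 (fun s hs => hw s (hsub hs))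
    (hwc.mono (prod_mono hsub le_rfl))
    (fun s hs s' hs' => hweq s (hsub hs) s' (hsub hs')) (Y := fun s => flow F t s z)
    (hF.integrable_flow t z).integrableOn
    (fun s _ => by rw [hF.flow_of_le le_rfl]; exact hF.flow_eq t s z)
  simp only [sub_self, map_zero, integral_zero, hF.flow_of_le le_rfl, hwb] at h
  rw [pull]
  linarith

theorem pull_sub_pull (hF : IsSmoothField F Λ Λ₂) (hφ : HasTameGradient φ K K₁) {s t T : ℝ}
    (hst : s ≤ t) (htT : t ≤ T) (z : E) : pull F φ T t z - pull F φ T s z =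
      -∫ r in Ioc s t, fderiv ℝ (pull F φ T r) z (F r z) := by
  have hc := hF.continuous_fderiv_pull hφ T
  have hcz : Continuous fun r => fderiv ℝ (pull F φ T r) z :=
    hc.comp (Continuous.prodMk_left z)
  obtain ⟨C₀, hC₀, htame⟩ := hF.exists_tame_pull hφ T
  have hint : Integrable fun r => fderiv ℝ (pull F φ T r) z (F r z) := by
    refine (hF.integrable.const_mul (C₀ * (K + K₁) + C₀ * K₁ * ‖z‖)).mono'
      (aestronglyMeasurable_apply hcz.aestronglyMeasurable
        (hF.integrable_comp continuous_const).aestronglyMeasurable) (ae_of_all _ fun r => ?_)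
    exact (ContinuousLinearMap.le_opNorm _ _).trans (mul_le_mul ((htame r).bound z) (hF.bound r z)
      (norm_nonneg _) ((norm_nonneg _).trans ((htame r).bound z)))
  rw [hF.pull_eq hφ htT, hF.pull_eq hφ (hst.trans htT), setIntegral_Ioc_add hint hst htT]
  ring

end IsSmoothField

/-! ### The continuity equation -/

variable {E : Type*} [NormedAddCommGroup E] [NormedSpace ℝ E]

/-- Applies to the sine and the cosine of a continuous linear form. -/
theorem hasTameGradient_comp_clm {f f' : ℝ → ℝ} (hf : ∀ x, HasDerivAt f (f' x) x)
    (hb : ∀ x, |f' x| ≤ 1) (hl : ∀ x y, |f' x - f' y| ≤ |x - y|) (L : E →L[ℝ] ℝ) :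
    HasTameGradient (fun z => f (L z)) (‖L‖ + ‖L‖ ^ 2) 0 := by
  have hd : ∀ z, HasFDerivAt (fun z => f (L z)) (f' (L z) • L) z := fun z =>
    (hf (L z)).comp_hasFDerivAt z L.hasFDerivAt
  refine ⟨fun z => (hd z).differentiableAt, fun z => ?_, fun z z' => ?_, by positivity, le_rfl⟩
  · rw [(hd z).fderiv, norm_smul, Real.norm_eq_abs]
    have := mul_le_mul_of_nonneg_right (hb (L z)) (norm_nonneg L)
    nlinarith [sq_nonneg ‖L‖]
  · rw [(hd z).fderiv, (hd z').fderiv, ← sub_smul, norm_smul, Real.norm_eq_abs]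
    have h1 : |f' (L z) - f' (L z')| ≤ ‖L‖ * ‖z - z'‖ := by
      refine (hl _ _).trans ?_
      rw [← map_sub]
      exact L.le_opNorm _
    calc _ ≤ ‖L‖ * ‖z - z'‖ * ‖L‖ := mul_le_mul_of_nonneg_right h1 (norm_nonneg L)
      _ ≤ _ := by nlinarith [mul_nonneg (norm_nonneg L) (norm_nonneg (z - z'))]

/-- A probability measure on a normed space is determined by its integrals of bounded functions
with bounded Lipschitz gradient. -/
theorem measure_eq_of_tame [CompleteSpace E] [MeasurableSpace E] [BorelSpace E]
    [SecondCountableTopology E] {μ μ' : Measure E} [IsProbabilityMeasure μ]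
    [IsProbabilityMeasure μ']
    (h : ∀ (φ : E → ℝ) (K : ℝ), HasTameGradient φ K 0 → (∀ z, |φ z| ≤ 1) →
      ∫ z, φ z ∂μ = ∫ z, φ z ∂μ') : μ = μ' := by
  -- the cosines and sines of linear forms are the real and imaginary parts of the characteristic
  -- function
  refine Measure.ext_of_charFunDual ?_
  ext L
  have hcos := h (fun z => Real.cos (L z)) _
    (hasTameGradient_comp_clm (fun x => Real.hasDerivAt_cos x)
      (fun x => by rw [abs_neg]; exact Real.abs_sin_le_one x)
      (fun x y => by
        rw [neg_sub_neg, abs_sub_comm]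
        exact Real.abs_sin_sub_sin_le x y) L) (fun z => Real.abs_cos_le_one _)
  have hsin := h (fun z => Real.sin (L z)) _
    (hasTameGradient_comp_clm (fun x => Real.hasDerivAt_sin x) Real.abs_cos_le_one
      Real.abs_cos_sub_cos_le L) (fun z => Real.abs_sin_le_one _)
  have key : ∀ (ρ : Measure E) [IsProbabilityMeasure ρ], charFunDual ρ L =
      ((∫ z, Real.cos (L z) ∂ρ : ℝ) : ℂ) + ((∫ z, Real.sin (L z) ∂ρ : ℝ) : ℂ) * Complex.I := by
    intro ρ _
    have hc : Integrable (fun z => ((Real.cos (L z) : ℝ) : ℂ)) ρ := by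
      refine Integrable.of_bound (by fun_prop : Continuous _).aestronglyMeasurable 1
        (ae_of_all _ fun z => ?_)
      rw [Complex.norm_real]
      exact Real.abs_cos_le_one _
    have hs : Integrable (fun z => ((Real.sin (L z) : ℝ) : ℂ)) ρ := by
      refine Integrable.of_bound (by fun_prop : Continuous _).aestronglyMeasurable 1
        (ae_of_all _ fun z => ?_)
      rw [Complex.norm_real]
      exact Real.abs_sin_le_one _
    rw [charFunDual_apply, ← integral_complex_ofReal, ← integral_complex_ofReal,
      ← integral_mul_const, ← integral_add hc (hs.mul_const _)]
    congr 1
    ext z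
    rw [Complex.exp_mul_I, Complex.ofReal_cos, Complex.ofReal_sin]
  rw [key μ, key μ', hcos, hsin]

namespace IsSmoothField

variable {F : ℝ → E → E} {Λ Λ₂ : ℝ → ℝ} {φ : E → ℝ} {K : ℝ}

theorem lipschitz_apply (hF : IsSmoothField F Λ Λ₂) (hφ : HasTameGradient φ K 0) (r : ℝ) :
    (∀ z, |fderiv ℝ φ z (F r z)| ≤ K * Λ r) ∧
      LipschitzWith (2 * K * Λ r).toNNReal fun z => fderiv ℝ φ z (F r z) := by
  have hb : ∀ z, ‖fderiv ℝ φ z‖ ≤ K := fun z => by simpa using hφ.bound z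
  have hl : ∀ z z', ‖fderiv ℝ φ z - fderiv ℝ φ z'‖ ≤ K * ‖z - z'‖ := fun z z' => by
    simpa using hφ.lip z z'
  constructor
  · intro z
    rw [← Real.norm_eq_abs]
    exact (ContinuousLinearMap.le_opNorm _ _).trans
      (mul_le_mul (hb z) (hF.bound r z) (norm_nonneg _) hφ.nonneg)
  · refine LipschitzWith.of_dist_le' fun z z' => ?_
    rw [dist_eq_norm, dist_eq_norm]
    have h1 : fderiv ℝ φ z (F r z) - fderiv ℝ φ z' (F r z') =
        (fderiv ℝ φ z - fderiv ℝ φ z') (F r z) + fderiv ℝ φ z' (F r z - F r z') := by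
      rw [map_sub, sub_apply]
      ring
    rw [h1]
    calc _ ≤ K * ‖z - z'‖ * Λ r + K * (Λ r * ‖z - z'‖) := by
          refine (norm_add_le _ _).trans (add_le_add ?_ ?_)
          · exact (ContinuousLinearMap.le_opNorm _ _).trans
              (mul_le_mul (hl z z') (hF.bound r z) (norm_nonneg _)
                (mul_nonneg hφ.nonneg (norm_nonneg _)))
          · exact (ContinuousLinearMap.le_opNorm _ _).trans
              (mul_le_mul (hb z') (hF.caratheodory.lip r z z') (norm_nonneg _) hφ.nonneg)
      _ = _ := by ring

variable [FiniteDimensional ℝ E] [MeasurableSpace E] [BorelSpace E]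

theorem measurable_flow (hF : IsSmoothField F Λ Λ₂) (s t : ℝ) : Measurable (flow F s t) :=
  ((hF.continuous_flow s).comp (Continuous.prodMk_right t)).measurable

theorem stronglyMeasurable_uncurry (hF : IsSmoothField F Λ Λ₂) :
    StronglyMeasurable fun p : ℝ × E => F p.1 p.2 := by
  have : ProperSpace E := FiniteDimensional.proper_real E
  exact hF.caratheodory.stronglyMeasurable_uncurry.comp_measurable measurable_swap

/-- The push-forward of a measure by the flow solves the continuity equation: this is the chain rule
along each trajectory, integrated over the initial positions. -/
theorem weak_map_flow (hF : IsSmoothField F Λ Λ₂) (μ : Measure E) [IsProbabilityMeasure μ]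
    {a b C : ℝ} {ψ : ℝ × E → ℝ} (hψ : ContDiff ℝ 1 ψ)
    (hC : ∀ t ∈ Icc a b, ∀ z, |ψ (t, z)| ≤ C ∧ ‖fderiv ℝ ψ (t, z)‖ ≤ C) {t₁ : ℝ}
    (ht₁ : t₁ ∈ Icc a b) :
    ∫ z, ψ (t₁, z) ∂(μ.map (flow F a t₁)) = ∫ z, ψ (a, z) ∂μ +
      ∫ t in Ioc a t₁, ∫ z, fderiv ℝ ψ (t, z) (1, F t z) ∂(μ.map (flow F a t)) := by
  have : ProperSpace E := FiniteDimensional.proper_real E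
  have : CompleteSpace E := FiniteDimensional.complete ℝ E
  have hab : a ≤ b := ht₁.1.trans ht₁.2
  have hfl : ∀ t, AEMeasurable (flow F a t) μ := fun t => (hF.measurable_flow a t).aemeasurable
  have hchain : ∀ z, ψ (t₁, flow F a t₁ z) - ψ (a, z) =
      ∫ t in Ioc a t₁, fderiv ℝ ψ (t, flow F a t z) (1, F t (flow F a t z)) := by
    intro z
    have hi : IntegrableOn (fun t => ((1 : ℝ), F t (flow F a t z))) (Ioc a t₁) :=
      Integrable.prodMk (integrableOn_const (by simp) (by simp))
        (hF.integrable_flow a z).integrableOn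
    have h := chain_rule_curve hψ (X := fun t => (t, flow F a t z))
      (v := fun t => (1, F t (flow F a t z))) ht₁.1 hi (fun t ht => ?_)
    · rwa [hF.flow_of_le le_rfl] at h
    · have hi' : IntegrableOn (fun t => ((1 : ℝ), F t (flow F a t z))) (Ioc a t) :=
        hi.mono_set (Ioc_subset_Ioc_right ht.2)
      have h1 : ∫ r in Ioc a t, ((1 : ℝ), F r (flow F a r z)) =
          (∫ r in Ioc a t, (1 : ℝ), ∫ r in Ioc a t, F r (flow F a r z)) :=
        integral_pair hi'.fst hi'.snd
      rw [h1, hF.flow_of_le le_rfl]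
      refine Prod.ext ?_ ?_
      · simp [ht.1]
      · exact hF.flow_eq a t z
  have hψm : ∀ t, AEStronglyMeasurable (fun z => ψ (t, z)) (μ.map (flow F a t)) := fun t =>
    (hψ.continuous.comp (Continuous.prodMk_right t)).aestronglyMeasurable
  have hi1 : Integrable (fun z => ψ (t₁, flow F a t₁ z)) μ := by
    refine Integrable.of_bound ((hψ.continuous.comp (Continuous.prodMk_right t₁)).comp
      ((hF.continuous_flow a).comp (Continuous.prodMk_right t₁))).aestronglyMeasurable C
      (ae_of_all _ fun z => (hC t₁ ht₁ _).1)
  have hi2 : Integrable (fun z => ψ (a, z)) μ :=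
    Integrable.of_bound (hψ.continuous.comp (Continuous.prodMk_right a)).aestronglyMeasurable C
      (ae_of_all _ fun z => (hC a (left_mem_Icc.mpr hab) _).1)
  have hDm : AEStronglyMeasurable (fun p : E × ℝ =>
      fderiv ℝ ψ (p.2, flow F a p.2 p.1) (1, F p.2 (flow F a p.2 p.1)))
      (μ.prod (volume.restrict (Ioc a t₁))) := by
    have hXc : Continuous fun p : E × ℝ => (p.2, flow F a p.2 p.1) :=
      continuous_snd.prodMk ((hF.continuous_flow a).comp continuous_swap)
    refine aestronglyMeasurable_apply
      ((hψ.continuous_fderiv one_ne_zero).comp hXc).aestronglyMeasurable ?_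
    refine AEStronglyMeasurable.prodMk aestronglyMeasurable_const ?_
    exact (hF.stronglyMeasurable_uncurry.comp_measurable hXc.measurable).aestronglyMeasurable
  have hDi : Integrable (fun p : E × ℝ =>
      fderiv ℝ ψ (p.2, flow F a p.2 p.1) (1, F p.2 (flow F a p.2 p.1)))
      (μ.prod (volume.restrict (Ioc a t₁))) := by
    have hdom : Integrable (fun p : E × ℝ => C * (1 + Λ p.2))
        (μ.prod (volume.restrict (Ioc a t₁))) := by
      have h1 : Integrable (fun t => C * (1 + Λ t)) (volume.restrict (Ioc a t₁)) :=
        (Integrable.add (integrable_const _) hF.integrable.restrict).const_mul C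
      exact h1.comp_snd μ
    refine hdom.mono' hDm ?_
    have h2 : ∀ᵐ p : E × ℝ ∂(μ.prod (volume.restrict (Ioc a t₁))), p.2 ∈ Ioc a t₁ := by
      have h3 := (ae_restrict_mem (μ := volume) (measurableSet_Ioc (a := a) (b := t₁)))
      exact (Measure.quasiMeasurePreserving_snd (μ := μ)
        (ν := volume.restrict (Ioc a t₁))).ae h3
    filter_upwards [h2] with p hp
    have hp' : p.2 ∈ Icc a b := ⟨hp.1.le, hp.2.trans ht₁.2⟩
    refine (ContinuousLinearMap.le_opNorm _ _).trans (mul_le_mul (hC p.2 hp' _).2 ?_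
      (norm_nonneg _) ((norm_nonneg _).trans (hC p.2 hp' 0).2))
    rw [Prod.norm_mk, norm_one]
    have h4 := hF.bound p.2 (flow F a p.2 p.1)
    have h5 := hF.nonneg p.2
    exact max_le (by linarith) (by linarith)
  rw [integral_map (hfl t₁) (hψm t₁)]
  have h1 : ∫ z, ψ (t₁, flow F a t₁ z) ∂μ - ∫ z, ψ (a, z) ∂μ =
      ∫ z, (∫ t in Ioc a t₁, fderiv ℝ ψ (t, flow F a t z) (1, F t (flow F a t z))) ∂μ := by
    rw [← integral_sub hi1 hi2]
    exact integral_congr_ae (ae_of_all _ hchain)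
  have h2 : ∫ z, (∫ t in Ioc a t₁, fderiv ℝ ψ (t, flow F a t z) (1, F t (flow F a t z))) ∂μ =
      ∫ t in Ioc a t₁, ∫ z, fderiv ℝ ψ (t, z) (1, F t z) ∂(μ.map (flow F a t)) := by
    rw [integral_integral_swap hDi]
    refine integral_congr_ae (ae_of_all _ fun t => ?_)
    have hm : AEStronglyMeasurable (fun z => fderiv ℝ ψ (t, z) (1, F t z))
        (μ.map (flow F a t)) := by
      refine aestronglyMeasurable_apply ((hψ.continuous_fderiv one_ne_zero).comp
        (Continuous.prodMk_right t)).aestronglyMeasurable ?_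
      exact (continuous_const.prodMk (hF.caratheodory.continuous t)).aestronglyMeasurable
    beta_reduce
    rw [integral_map (hfl t) hm]
  rw [← h2, ← h1]
  ring

/-- Duality between the continuity and the transport equation: a weak solution of the continuity
equation integrates the solution of the transport equation to a constant. -/
theorem integral_eq_integral_pull (hF : IsSmoothField F Λ Λ₂) {γ : ℝ → Measure E} {a b : ℝ}
    (hab : a ≤ b) (hprob : ∀ t ∈ Icc a b, IsProbabilityMeasure (γ t))
    (hcont : ∀ ψ : E → ℝ, (∃ C, ∀ z, |ψ z| ≤ C) → (∃ C, LipschitzWith C ψ) →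
      ContinuousOn (fun t => ∫ z, ψ z ∂(γ t)) (Icc a b))
    (hweak : ∀ ψ : E → ℝ, ContDiff ℝ 1 ψ → (∃ C, ∀ z, |ψ z| ≤ C ∧ ‖fderiv ℝ ψ z‖ ≤ C) →
      ∀ t ∈ Icc a b, ∫ z, ψ z ∂(γ t) = ∫ z, ψ z ∂(γ a) +
        ∫ r in Ioc a t, ∫ z, fderiv ℝ ψ z (F r z) ∂(γ r))
    (hφ : HasTameGradient φ K 0) (hφb : ∀ z, |φ z| ≤ 1) :
    ∫ z, φ z ∂(γ b) = ∫ z, pull F φ b a z ∂(γ a) := by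
  have : ProperSpace E := FiniteDimensional.proper_real E
  have : CompleteSpace E := FiniteDimensional.complete ℝ E
  obtain ⟨C₀, hC₀, htame'⟩ := hF.exists_tame_pull hφ b
  set M := C₀ * (K + 0) with hM
  have htame : ∀ t, HasTameGradient (pull F φ b t) M 0 := fun t => by simpa using htame' t
  have hDb : ∀ t z, ‖fderiv ℝ (pull F φ b t) z‖ ≤ M := fun t z => by
    simpa using (htame t).bound z
  have hM0 : 0 ≤ M := (htame a).nonneg
  have hub : ∀ t z, |pull F φ b t z| ≤ 1 := fun t z => hφb _
  have hDc := hF.continuous_fderiv_pull hφ b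
  have huc : ∀ t, Continuous (pull F φ b t) := fun t => (htame t).diff.continuous
  have hui : ∀ s, ∀ t ∈ Icc a b, Integrable (pull F φ b s) (γ t) := fun s t ht => by
    have := hprob t ht
    exact Integrable.of_bound (huc s).aestronglyMeasurable 1 (ae_of_all _ (hub s))
  have hDFm : StronglyMeasurable fun p : ℝ × E => fderiv ℝ (pull F φ b p.1) p.2 (F p.1 p.2) :=
    (isBoundedBilinearMap_apply (𝕜 := ℝ) (E := E) (F := ℝ)).continuous.comp_stronglyMeasurable
      (hDc.stronglyMeasurable.prodMk hF.stronglyMeasurable_uncurry)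
  have hbdd : ∀ s r, ∀ t ∈ Icc a b, |∫ z, fderiv ℝ (pull F φ b s) z (F r z) ∂(γ t)| ≤ M * Λ r := by
    intro s r t ht
    have := hprob t ht
    have h := norm_integral_le_of_norm_le_const (μ := γ t)
      (f := fun z => fderiv ℝ (pull F φ b s) z (F r z))
      (ae_of_all _ (hF.lipschitz_apply (htame s) r).1)
    simpa using h
  -- measurability in time of the right-hand side of the weak formulation; the time is clamped to
  -- `[a, b]` because nothing is known about `γ` outside this interval
  have hmeas1 : ∀ s, StronglyMeasurable
      fun r => ∫ z, fderiv ℝ (pull F φ b s) z (F r z) ∂(γ (projIcc a b hab r)) := by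
    intro s
    have h1 : ∀ t : ℝ, StronglyMeasurable
        fun r => ∫ z, fderiv ℝ (pull F φ b s) z (F r z) ∂(γ (projIcc a b hab t)) := by
      intro t
      have := hprob _ (projIcc a b hab t).2
      refine StronglyMeasurable.integral_prod_right
        (f := fun r z => fderiv ℝ (pull F φ b s) z (F r z)) ?_
      exact (isBoundedBilinearMap_apply (𝕜 := ℝ) (E := E)
        (F := ℝ)).continuous.comp_stronglyMeasurable
          (((htame s).continuous_fderiv.comp continuous_snd).stronglyMeasurable.prodMk
            hF.stronglyMeasurable_uncurry)
    have h2 := stronglyMeasurable_uncurry_of_continuous_of_stronglyMeasurable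
      (u := fun t r => ∫ z, fderiv ℝ (pull F φ b s) z (F r z) ∂(γ (projIcc a b hab t)))
      (fun r => ?_) h1
    · exact h2.comp_measurable (measurable_id.prodMk measurable_id)
    · obtain ⟨hb, hl⟩ := hF.lipschitz_apply (htame s) r
      have h3 := hcont _ ⟨_, hb⟩ ⟨_, hl⟩
      exact h3.comp_continuous (continuous_subtype_val.comp continuous_projIcc)
        fun t => (projIcc a b hab t).2
  have hint1 : ∀ s c d, a ≤ c → d ≤ b → IntegrableOn
      (fun r => ∫ z, fderiv ℝ (pull F φ b s) z (F r z) ∂(γ r)) (Ioc c d) := by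
    intro s c d hc hd
    have h1 : EqOn (fun r => ∫ z, fderiv ℝ (pull F φ b s) z (F r z) ∂(γ (projIcc a b hab r)))
        (fun r => ∫ z, fderiv ℝ (pull F φ b s) z (F r z) ∂(γ r)) (Ioc c d) := fun r hr => by
      beta_reduce
      rw [projIcc_of_mem hab ⟨hc.trans hr.1.le, hr.2.trans hd⟩]
    refine IntegrableOn.congr_fun ?_ h1 measurableSet_Ioc
    refine (hF.integrable.const_mul M).integrableOn.mono' (hmeas1 s).aestronglyMeasurable ?_
    exact ae_of_all _ fun r => hbdd s r _ (projIcc a b hab r).2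
  have hint2 : ∀ t ∈ Icc a b, Integrable
      fun r => ∫ z, fderiv ℝ (pull F φ b r) z (F r z) ∂(γ t) := by
    intro t ht
    have := hprob t ht
    refine (hF.integrable.const_mul M).mono'
      (StronglyMeasurable.integral_prod_right
        (f := fun r z => fderiv ℝ (pull F φ b r) z (F r z)) hDFm).aestronglyMeasurable
      (ae_of_all _ fun r => hbdd r r t ht)
  -- change of the test function at a fixed measure
  have hspace : ∀ s t, a ≤ s → s ≤ t → t ≤ b → ∫ z, pull F φ b t z ∂(γ t) -
      ∫ z, pull F φ b s z ∂(γ t) =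
        -∫ r in Ioc s t, ∫ z, fderiv ℝ (pull F φ b r) z (F r z) ∂(γ t) := by
    intro s t has hst htb
    have ht : t ∈ Icc a b := ⟨has.trans hst, htb⟩
    have := hprob t ht
    rw [← integral_sub (hui t t ht) (hui s t ht), integral_integral_swap, ← integral_neg]
    · exact integral_congr_ae (ae_of_all _ fun z => hF.pull_sub_pull hφ hst htb z)
    · have hdom : Integrable (fun p : ℝ × E => M * Λ p.1)
          ((volume.restrict (Ioc s t)).prod (γ t)) :=
        (hF.integrable.restrict.const_mul M).comp_fst (γ t)
      exact hdom.mono' hDFm.aestronglyMeasurable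
        (ae_of_all _ fun p => (hF.lipschitz_apply (htame p.1) p.1).1 p.2)
  -- change of the measure at a fixed test function
  have htime : ∀ s t, a ≤ s → s ≤ t → t ≤ b → ∫ z, pull F φ b s z ∂(γ t) -
      ∫ z, pull F φ b s z ∂(γ s) =
        ∫ r in Ioc s t, ∫ z, fderiv ℝ (pull F φ b s) z (F r z) ∂(γ r) := by
    intro s t has hst htb
    have hw := hweak (pull F φ b s) (htame s).contDiff
      ⟨max 1 M, fun z => ⟨(hub s z).trans (le_max_left _ _), (hDb s z).trans (le_max_right _ _)⟩⟩
    rw [hw t ⟨has.trans hst, htb⟩, hw s ⟨has, hst.trans htb⟩,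
      ← intervalIntegral.integral_of_le (has.trans hst), ← intervalIntegral.integral_of_le has,
      ← intervalIntegral.integral_of_le hst, add_sub_add_left_eq_sub,
      intervalIntegral.integral_interval_sub_left]
    · exact (intervalIntegrable_iff_integrableOn_Ioc_of_le (has.trans hst)).mpr
        (hint1 s a t le_rfl htb)
    · exact (intervalIntegrable_iff_integrableOn_Ioc_of_le has).mpr
        (hint1 s a s le_rfl (hst.trans htb))
  -- in the limit of short intervals the two contributions cancel
  have h := sub_eq_integral_of_local (a := a) (b := b)
    (f := fun t => ∫ z, pull F φ b t z ∂(γ t))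
    (k := fun s t r => ∫ z, fderiv ℝ (pull F φ b s) z (F r z) ∂(γ r) -
      ∫ z, fderiv ℝ (pull F φ b r) z (F r z) ∂(γ t))
    (k₀ := fun r => ∫ z, fderiv ℝ (pull F φ b r) z (F r z) ∂(γ r) -
      ∫ z, fderiv ℝ (pull F φ b r) z (F r z) ∂(γ r))
    (Λ := fun r => M * Λ r + M * Λ r) hab
    ((hF.integrable.const_mul M).add (hF.integrable.const_mul M)).integrableOn ?_ ?_ ?_ ?_
  · simp only [sub_self, integral_zero] at h
    rw [hF.pull_of_le φ le_rfl] at h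
    linarith
  · intro s t has hst htb
    exact ((hint1 s s t has htb).sub
      (hint2 t ⟨has.trans hst, htb⟩).integrableOn).aestronglyMeasurable
  · intro s t has hst htb
    rw [integral_sub (hint1 s s t has htb) (hint2 t ⟨has.trans hst, htb⟩).integrableOn]
    linarith [hspace s t has hst htb, htime s t has hst htb]
  · intro s t r has htb hr
    have hr' : r ∈ Icc a b := ⟨has.trans hr.1.le, hr.2.trans htb⟩
    have ht : t ∈ Icc a b := ⟨has.trans (hr.1.trans_le hr.2).le, htb⟩
    exact (abs_sub _ _).trans (add_le_add (hbdd s r r hr') (hbdd r r t ht))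
  · intro r hr
    have hr' : r ∈ Icc a b := ⟨hr.1.le, hr.2⟩
    have := hprob r hr'
    refine Tendsto.sub ?_ ?_
    · have h1 : Tendsto (fun s => ∫ z, fderiv ℝ (pull F φ b s) z (F r z) ∂(γ r)) (𝓝 r)
          (𝓝 (∫ z, fderiv ℝ (pull F φ b r) z (F r z) ∂(γ r))) := by
        refine tendsto_integral_filter_of_dominated_convergence (fun _ => M * Λ r) ?_ ?_
          (integrable_const _) ?_
        · refine Eventually.of_forall fun s => aestronglyMeasurable_apply
            (htame s).continuous_fderiv.aestronglyMeasurable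
            (hF.caratheodory.continuous r).aestronglyMeasurable
        · exact Eventually.of_forall fun s => ae_of_all _ (hF.lipschitz_apply (htame s) r).1
        · refine ae_of_all _ fun z => ?_
          exact tendsto_apply ((hDc.comp (Continuous.prodMk_left z)).tendsto r) tendsto_const_nhds
      exact (h1.mono_left nhdsWithin_le_nhds).comp tendsto_fst
    · obtain ⟨hb, hl⟩ := hF.lipschitz_apply (htame r) r
      have h3 := hcont _ ⟨_, hb⟩ ⟨_, hl⟩ r hr'
      exact (h3.mono_left (nhdsWithin_mono r (Icc_subset_Icc_left hr.1.le))).comp tendsto_snd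

/-- Uniqueness for the continuity equation. -/
theorem eq_map_flow (hF : IsSmoothField F Λ Λ₂) {γ : ℝ → Measure E} {a b : ℝ}
    (hprob : ∀ t ∈ Icc a b, IsProbabilityMeasure (γ t))
    (hcont : ∀ ψ : E → ℝ, (∃ C, ∀ z, |ψ z| ≤ C) → (∃ C, LipschitzWith C ψ) →
      ContinuousOn (fun t => ∫ z, ψ z ∂(γ t)) (Icc a b))
    (hweak : ∀ ψ : E → ℝ, ContDiff ℝ 1 ψ → (∃ C, ∀ z, |ψ z| ≤ C ∧ ‖fderiv ℝ ψ z‖ ≤ C) →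
      ∀ t ∈ Icc a b, ∫ z, ψ z ∂(γ t) = ∫ z, ψ z ∂(γ a) +
        ∫ r in Ioc a t, ∫ z, fderiv ℝ ψ z (F r z) ∂(γ r)) :
    ∀ t ∈ Icc a b, γ t = (γ a).map (flow F a t) := by
  intro t ht
  have : ProperSpace E := FiniteDimensional.proper_real E
  have : CompleteSpace E := FiniteDimensional.complete ℝ E
  have hsub : Icc a t ⊆ Icc a b := Icc_subset_Icc_right ht.2
  have := hprob t ht
  have := hprob a ⟨le_rfl, ht.1.trans ht.2⟩
  have := Measure.isProbabilityMeasure_map (μ := γ a) (hF.measurable_flow a t).aemeasurable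
  refine measure_eq_of_tame fun φ K hφ hb => ?_
  rw [hF.integral_eq_integral_pull ht.1 (fun s hs => hprob s (hsub hs))
    (fun ψ h1 h2 => (hcont ψ h1 h2).mono hsub)
    (fun ψ h1 h2 s hs => hweak ψ h1 h2 s (hsub hs)) hφ hb,
    integral_map (hF.measurable_flow a t).aemeasurable hφ.diff.continuous.aestronglyMeasurable]
  rfl

end IsSmoothField

/-! ### Relative entropy -/

section Entropy

open InformationTheory

variable {α : Type*} {mα : MeasurableSpace α}

/-- The Young inequality `x y ≤ klFun x + exp y` for the conjugate pair `klFun`, `exp - 1`. -/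
theorem mul_le_klFun_add_exp {x : ℝ} (hx : 0 ≤ x) (y : ℝ) : x * y ≤ klFun x + Real.exp y := by
  rcases hx.eq_or_lt with rfl | hx
  · simp only [zero_mul, klFun_zero]
    positivity
  · have h1 := Real.add_one_le_exp (y - Real.log x)
    have h2 : Real.exp y = x * Real.exp (y - Real.log x) := by
      rw [Real.exp_sub, Real.exp_log hx]
      field_simp
    rw [h2, klFun_apply]
    nlinarith

/-- A form of the Donsker–Varadhan inequality: moments are controlled by the relative entropy. -/
theorem lintegral_le_klDiv_add {ν μ : Measure α} [IsFiniteMeasure ν] [IsFiniteMeasure μ]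
    {f : α → ℝ} (hf : Measurable f) :
    ∫⁻ a, ENNReal.ofReal (f a) ∂ν ≤ klDiv ν μ + ∫⁻ a, ENNReal.ofReal (Real.exp (f a)) ∂μ := by
  by_cases hac : ν ≪ μ
  swap
  · simp [klDiv_of_not_ac hac]
  have h1 : ∫⁻ a, ENNReal.ofReal (f a) ∂ν =
      ∫⁻ a, ν.rnDeriv μ a * ENNReal.ofReal (f a) ∂μ :=
    (lintegral_rnDeriv_mul hac hf.ennreal_ofReal.aemeasurable).symm
  rw [h1, klDiv_eq_lintegral_klFun_of_ac hac, ← lintegral_add_right _ (by fun_prop)]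
  refine lintegral_mono_ae ?_
  filter_upwards [Measure.rnDeriv_lt_top ν μ] with a ha
  rw [← ENNReal.ofReal_add (klFun_nonneg ENNReal.toReal_nonneg) (Real.exp_pos _).le]
  nth_rewrite 1 [← ENNReal.ofReal_toReal ha.ne]
  rw [← ENNReal.ofReal_mul ENNReal.toReal_nonneg]
  exact ENNReal.ofReal_le_ofReal (mul_le_klFun_add_exp ENNReal.toReal_nonneg _)

/-- Convexity of the relative entropy in its first argument. -/
theorem klDiv_convex_comb_le {ν ν' μ : Measure α} [IsFiniteMeasure ν] [IsFiniteMeasure ν']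
    [IsFiniteMeasure μ] {δ : ℝ} (h0 : 0 < δ) (h1 : δ < 1) :
    klDiv (ENNReal.ofReal (1 - δ) • ν + ENNReal.ofReal δ • ν') μ ≤
      ENNReal.ofReal (1 - δ) * klDiv ν μ + ENNReal.ofReal δ * klDiv ν' μ := by
  have h1' : 0 < 1 - δ := by linarith
  by_cases hac : ν ≪ μ
  swap
  · rw [klDiv_of_not_ac hac, ENNReal.mul_top (by simpa using h1'), top_add]
    exact le_top
  by_cases hac' : ν' ≪ μ
  swap
  · rw [klDiv_of_not_ac hac', ENNReal.mul_top (by simpa using h0), add_top]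
    exact le_top
  have : IsFiniteMeasure (ENNReal.ofReal (1 - δ) • ν) :=
    ν.smul_finite ENNReal.ofReal_ne_top
  have : IsFiniteMeasure (ENNReal.ofReal δ • ν') :=
    ν'.smul_finite ENNReal.ofReal_ne_top
  have hsum : ENNReal.ofReal (1 - δ) • ν + ENNReal.ofReal δ • ν' ≪ μ :=
    Measure.AbsolutelyContinuous.add_left (hac.smul_left _) (hac'.smul_left _)
  rw [klDiv_eq_lintegral_klFun_of_ac hac, klDiv_eq_lintegral_klFun_of_ac hac',
    klDiv_eq_lintegral_klFun_of_ac hsum, ← lintegral_const_mul _ (by fun_prop),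
    ← lintegral_const_mul _ (by fun_prop), ← lintegral_add_left (by fun_prop)]
  refine lintegral_mono_ae ?_
  filter_upwards [Measure.rnDeriv_add (ENNReal.ofReal (1 - δ) • ν) (ENNReal.ofReal δ • ν') μ,
    Measure.rnDeriv_smul_left_of_ne_top ν μ (ENNReal.ofReal_ne_top (r := 1 - δ)),
    Measure.rnDeriv_smul_left_of_ne_top ν' μ (ENNReal.ofReal_ne_top (r := δ)),
    Measure.rnDeriv_lt_top ν μ, Measure.rnDeriv_lt_top ν' μ] with a e1 e2 e3 t1 t2
  rw [e1, Pi.add_apply, e2, e3, Pi.smul_apply, Pi.smul_apply, smul_eq_mul, smul_eq_mul,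
    ENNReal.toReal_add (ENNReal.mul_ne_top ENNReal.ofReal_ne_top t1.ne)
      (ENNReal.mul_ne_top ENNReal.ofReal_ne_top t2.ne), ENNReal.toReal_mul, ENNReal.toReal_mul,
    ENNReal.toReal_ofReal h1'.le, ENNReal.toReal_ofReal h0.le, ← ENNReal.ofReal_mul h1'.le,
    ← ENNReal.ofReal_mul h0.le, ← ENNReal.ofReal_add
      (mul_nonneg h1'.le (klFun_nonneg ENNReal.toReal_nonneg))
      (mul_nonneg h0.le (klFun_nonneg ENNReal.toReal_nonneg))]
  refine ENNReal.ofReal_le_ofReal ?_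
  exact convexOn_klFun.2 (mem_Ici.mpr ENNReal.toReal_nonneg) (mem_Ici.mpr ENNReal.toReal_nonneg)
    h1'.le h0.le (by ring)

theorem measurable_klDiv_kernel {β : Type*} {mβ : MeasurableSpace β}
    [MeasurableSpace.CountablyGenerated α] (κ η : ProbabilityTheory.Kernel β α) [ProbabilityTheory.IsFiniteKernel κ]
    [ProbabilityTheory.IsFiniteKernel η] : Measurable fun t => klDiv (κ t) (η t) := by
  classical
  have h : (fun t => klDiv (κ t) (η t)) = fun t => if κ t ≪ η t then
      ∫⁻ x, ENNReal.ofReal (klFun (ProbabilityTheory.Kernel.rnDeriv κ η t x).toReal) ∂(η t)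
      else ⊤ := by
    ext t
    split_ifs with hac
    · rw [klDiv_eq_lintegral_klFun_of_ac hac]
      refine lintegral_congr_ae ?_
      filter_upwards [ProbabilityTheory.Kernel.rnDeriv_eq_rnDeriv_measure (κ := κ) (η := η)
        (a := t)] with x hx
      rw [hx]
    · exact klDiv_of_not_ac hac
  rw [h]
  refine Measurable.ite
    (ProbabilityTheory.Kernel.measurableSet_absolutelyContinuous κ η) ?_ measurable_const
  refine Measurable.lintegral_kernel_prod_right (κ := η)
    (f := fun t x => ENNReal.ofReal (klFun (ProbabilityTheory.Kernel.rnDeriv κ η t x).toReal)) ?_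
  exact (measurable_klFun.comp
    (ProbabilityTheory.Kernel.measurable_rnDeriv κ η).ennreal_toReal).ennreal_ofReal

/-- Change of reference measure in the relative entropy. -/
theorem klDiv_tilted_right {ν μ : Measure α} [IsProbabilityMeasure ν] [IsProbabilityMeasure μ]
    {f : α → ℝ} (h : klDiv ν μ ≠ ⊤) (hf : Integrable f ν)
    (hexp : Integrable (fun a => Real.exp (f a)) μ) :
    klDiv ν (μ.tilted f) ≠ ⊤ ∧ (klDiv ν (μ.tilted f)).toReal =
      (klDiv ν μ).toReal - ∫ a, f a ∂ν + Real.log (∫ a, Real.exp (f a) ∂μ) := by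
  obtain ⟨hac, hint⟩ := klDiv_ne_top_iff.mp h
  have := isProbabilityMeasure_tilted hexp
  have hac' : ν ≪ μ.tilted f := hac.trans (absolutelyContinuous_tilted hexp)
  refine ⟨klDiv_ne_top hac' (integrable_llr_tilted_right hac hf hint hexp), ?_⟩
  rw [toReal_klDiv_of_measure_eq hac' (by simp), toReal_klDiv_of_measure_eq hac (by simp),
    integral_llr_tilted_right hac hf hexp hint]

/-- The relative entropy of a Gibbs measure. -/
theorem klDiv_tilted_left {μ : Measure α} [IsProbabilityMeasure μ] {f : α → ℝ}
    (hexp : Integrable (fun a => Real.exp (f a)) μ) (hf : Integrable f (μ.tilted f)) :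
    klDiv (μ.tilted f) μ ≠ ⊤ ∧ (klDiv (μ.tilted f) μ).toReal =
      ∫ a, f a ∂(μ.tilted f) - Real.log (∫ a, Real.exp (f a) ∂μ) := by
  have := isProbabilityMeasure_tilted hexp
  have hac : μ.tilted f ≪ μ := tilted_absolutelyContinuous μ f
  have hllr : llr (μ.tilted f) μ =ᵐ[μ.tilted f]
      fun a => f a - Real.log (∫ a, Real.exp (f a) ∂μ) :=
    hac.ae_le (log_rnDeriv_tilted_left_self hexp)
  have hint : Integrable (llr (μ.tilted f) μ) (μ.tilted f) :=
    (integrable_congr hllr).mpr (hf.sub (integrable_const _))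
  refine ⟨klDiv_ne_top hac hint, ?_⟩
  rw [toReal_klDiv_of_measure_eq hac (by simp), integral_congr_ae hllr,
    integral_sub hf (integrable_const _)]
  simp

end Entropy

/-! ### The prior -/

section Prior

variable {m : ℕ}

theorem integrable_exp_of_le {f : Vec m → ℝ} (hf : Continuous f) {C : ℝ}
    (h : ∀ a, f a ≤ C - ‖a‖ ^ 2) : Integrable fun a => Real.exp (f a) := by
  have h1 : Integrable fun a : Vec m => Real.exp (-‖a‖ ^ 2) := by
    have h2 := (GaussianFourier.integrable_cexp_neg_mul_sq_norm_add (V := Vec m) (b := 1)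
      (by simp) 0 0).norm
    refine h2.congr (ae_of_all _ fun a => ?_)
    beta_reduce
    rw [Complex.norm_exp]
    congr 1
    simp only [neg_mul, one_mul, zero_mul, add_zero, Complex.neg_re]
    norm_cast
  refine (h1.const_mul (Real.exp C)).mono' (by fun_prop : Continuous _).aestronglyMeasurable
    (ae_of_all _ fun a => ?_)
  rw [Real.norm_of_nonneg (Real.exp_pos _).le, ← Real.exp_add]
  exact Real.exp_le_exp.mpr (by linarith [h a])

/-- The convexity assumption makes the potential grow at least like `‖a‖ ^ 4`. -/
theorem exists_quartic_lower_bound {E : Type*} [NormedAddCommGroup E] [NormedSpace ℝ E]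
    {ℓ : E → ℝ} (hℓ : ContDiff ℝ 2 ℓ)
    (hH : ∃ c : ℝ, 0 < c ∧ ∀ a v : E,
      c * (1 + ‖a‖ ^ 2) * ‖v‖ ^ 2 ≤ iteratedFDeriv ℝ 2 ℓ a ![v, v]) :
    ∃ c C : ℝ, 0 < c ∧ ∀ a, c * ‖a‖ ^ 4 - C ≤ ℓ a := by
  obtain ⟨c, hc, hH⟩ := hH
  set M := ‖fderiv ℝ ℓ 0‖ with hM
  have hM0 : 0 ≤ M := norm_nonneg _
  have hd1 : ∀ a, HasFDerivAt ℓ (fderiv ℝ ℓ a) a := fun a =>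
    (hℓ.differentiable two_ne_zero a).hasFDerivAt
  have hC1 : ContDiff ℝ 1 (fderiv ℝ ℓ) := hℓ.fderiv_right (by norm_num)
  have hd2 : ∀ a, HasFDerivAt (fderiv ℝ ℓ) (fderiv ℝ (fderiv ℝ ℓ) a) a := fun a =>
    (hC1.differentiable one_ne_zero a).hasFDerivAt
  have key : ∀ a, c / 12 * ‖a‖ ^ 4 + ℓ 0 - M * ‖a‖ ≤ ℓ a := by
    intro a
    have hline : ∀ θ : ℝ, HasDerivAt (fun θ : ℝ => θ • a) a θ := fun θ => by
      simpa using (hasDerivAt_id θ).smul_const a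
    -- on the segment `θ ↦ θ • a`, the second derivative of `ℓ` is at least `c ‖a‖ ^ 4 θ ^ 2`; the
    -- quartic `c ‖a‖ ^ 4 θ ^ 4 / 12` with that second derivative is subtracted
    have hh : ∀ θ : ℝ, HasDerivAt (fun θ : ℝ => ℓ (θ • a) - c * ‖a‖ ^ 4 * θ ^ 4 / 12)
        (fderiv ℝ ℓ (θ • a) a - c * ‖a‖ ^ 4 * θ ^ 3 / 3) θ := by
      intro θ
      have h1 := (hd1 (θ • a)).comp_hasDerivAt θ (hline θ)
      have h2 := (((hasDerivAt_pow 4 θ).const_mul (c * ‖a‖ ^ 4)).div_const 12)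
      refine (h1.sub h2).congr_deriv ?_
      push_cast
      ring
    have hh' : ∀ θ : ℝ, HasDerivAt (fun θ : ℝ => fderiv ℝ ℓ (θ • a) a - c * ‖a‖ ^ 4 * θ ^ 3 / 3)
        (fderiv ℝ (fderiv ℝ ℓ) (θ • a) a a - c * ‖a‖ ^ 4 * θ ^ 2) θ := by
      intro θ
      have h1 := (ContinuousLinearMap.apply ℝ ℝ a).hasFDerivAt.comp_hasDerivAt θ
        ((hd2 (θ • a)).comp_hasDerivAt θ (hline θ))
      have h2 := (((hasDerivAt_pow 3 θ).const_mul (c * ‖a‖ ^ 4)).div_const 3)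
      refine (h1.sub h2).congr_deriv ?_
      rw [ContinuousLinearMap.apply_apply]
      push_cast
      ring
    have hmono : Monotone fun θ : ℝ => fderiv ℝ ℓ (θ • a) a - c * ‖a‖ ^ 4 * θ ^ 3 / 3 := by
      refine monotone_of_deriv_nonneg (fun θ => (hh' θ).differentiableAt) fun θ => ?_
      rw [(hh' θ).deriv]
      have h1 := hH (θ • a) a
      rw [iteratedFDeriv_two_apply] at h1
      simp only [Matrix.cons_val_zero, Matrix.cons_val_one] at h1
      rw [norm_smul, Real.norm_eq_abs, mul_pow, sq_abs] at h1
      have h2 : 0 ≤ c * ‖a‖ ^ 2 := by positivity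
      nlinarith
    obtain ⟨ξ, hξ, hs⟩ := exists_hasDerivAt_eq_slope
      (fun θ : ℝ => ℓ (θ • a) - c * ‖a‖ ^ 4 * θ ^ 4 / 12) _ zero_lt_one
      (fun θ _ => (hh θ).continuousAt.continuousWithinAt) (fun θ _ => hh θ)
    have h3 := hmono hξ.1.le
    simp only [zero_smul, one_smul] at h3 hs
    have h4 : -(M * ‖a‖) ≤ fderiv ℝ ℓ 0 a :=
      (abs_le.mp ((Real.norm_eq_abs _).symm ▸ (fderiv ℝ ℓ 0).le_opNorm a)).1
    have h5 : (1 : ℝ) - 0 = 1 := by norm_num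
    rw [h5, div_one] at hs
    norm_num at h3 hs
    linarith
  -- the linear term is absorbed by half of the quartic term
  have hk : 0 < c / 24 := by positivity
  refine ⟨c / 24, M * (1 + M / (c / 24)) - ℓ 0, hk, fun a => ?_⟩
  have h1 := key a
  have h2 : M * ‖a‖ ≤ c / 24 * ‖a‖ ^ 4 + M * (1 + M / (c / 24)) := by
    have hs := norm_nonneg a
    rcases le_total ‖a‖ (1 + M / (c / 24)) with h | h
    · have := mul_le_mul_of_nonneg_left h hM0
      have : 0 ≤ c / 24 * ‖a‖ ^ 4 := by positivity
      linarith
    · have h3 : 1 ≤ ‖a‖ := le_trans (by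
        have : 0 ≤ M / (c / 24) := by positivity
        linarith) h
      have h4 : M ≤ c / 24 * ‖a‖ := by
        have := mul_le_mul_of_nonneg_left h hk.le
        rw [mul_add, mul_div_cancel₀ _ hk.ne'] at this
        linarith
      have h5 : ‖a‖ ^ 2 ≤ ‖a‖ ^ 4 := pow_le_pow_right₀ h3 (by norm_num)
      have h6 : M * ‖a‖ ≤ c / 24 * ‖a‖ ^ 2 := by nlinarith
      have h7 := mul_le_mul_of_nonneg_left h5 hk.le
      have : 0 ≤ M * (1 + M / (c / 24)) := by positivity
      linarith
  linarith

variable {ℓ : Vec m → ℝ}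

theorem integrable_exp_neg_add (hc : Continuous ℓ) {c C : ℝ} (hc0 : 0 < c)
    (hℓ : ∀ a, c * ‖a‖ ^ 4 - C ≤ ℓ a) {f : Vec m → ℝ} (hf : Continuous f) {B : ℝ}
    (hfB : ∀ a, f a ≤ B * (1 + ‖a‖) + c / 2 * ‖a‖ ^ 4) :
    Integrable fun a => Real.exp (-ℓ a + f a) := by
  refine integrable_exp_of_le (hc.neg.add hf) (C := C + B + B ^ 2 + 2 / c) fun a => ?_
  have h1 := hℓ a
  have h2 := hfB a
  -- the linear term costs one `‖a‖ ^ 2`; half of the quartic pays for it and for the Gaussian one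
  have h3 : B * ‖a‖ ≤ B ^ 2 + ‖a‖ ^ 2 := by nlinarith [sq_nonneg (B - ‖a‖), sq_nonneg B]
  have h4 : 2 * ‖a‖ ^ 2 ≤ c / 2 * ‖a‖ ^ 4 + 2 / c := by
    have h5 : c / 2 * ‖a‖ ^ 4 + 2 / c - 2 * ‖a‖ ^ 2 = c / 2 * (‖a‖ ^ 2 - 2 / c) ^ 2 := by
      field_simp
      ring
    have h6 : 0 ≤ c / 2 * (‖a‖ ^ 2 - 2 / c) ^ 2 := by positivity
    linarith
  linarith

theorem prior_eq_tilted (ℓ : Vec m → ℝ) : prior ℓ = volume.tilted fun a => -ℓ a := by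
  unfold prior Measure.tilted
  congr 1
  ext a
  rw [div_eq_inv_mul]

theorem integrable_exp_neg (hc : Continuous ℓ) {c C : ℝ} (hc0 : 0 < c)
    (hℓ : ∀ a, c * ‖a‖ ^ 4 - C ≤ ℓ a) : Integrable fun a => Real.exp (-ℓ a) := by
  have := integrable_exp_neg_add hc hc0 hℓ (f := fun _ => 0) continuous_const (B := 0)
    (fun a => by positivity)
  simpa using this

theorem isProbabilityMeasure_prior (hc : Continuous ℓ) {c C : ℝ} (hc0 : 0 < c)
    (hℓ : ∀ a, c * ‖a‖ ^ 4 - C ≤ ℓ a) : IsProbabilityMeasure (prior ℓ) := by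
  rw [prior_eq_tilted]
  exact isProbabilityMeasure_tilted (integrable_exp_neg hc hc0 hℓ)

theorem integrable_exp_prior (hc : Continuous ℓ) {c C : ℝ} (hc0 : 0 < c)
    (hℓ : ∀ a, c * ‖a‖ ^ 4 - C ≤ ℓ a) {f : Vec m → ℝ} (hf : Continuous f) {B : ℝ}
    (hfB : ∀ a, f a ≤ B * (1 + ‖a‖) + c / 2 * ‖a‖ ^ 4) :
    Integrable (fun a => Real.exp (f a)) (prior ℓ) := by
  rw [prior_eq_tilted, integrable_tilted_iff (integrable_exp_neg hc hc0 hℓ)]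
  refine (integrable_exp_neg_add hc hc0 hℓ hf hfB).congr (ae_of_all _ fun a => ?_)
  simp [Real.exp_add]

/-- The fourth moment of a measure is bounded by its entropy relative to the prior. -/
theorem exists_moment_le_klDiv (hc : Continuous ℓ) {c C : ℝ} (hc0 : 0 < c)
    (hℓ : ∀ a, c * ‖a‖ ^ 4 - C ≤ ℓ a) :
    ∃ K : ℝ≥0∞, K ≠ ⊤ ∧ ∀ ν : Measure (Vec m), IsProbabilityMeasure ν →
      ENNReal.ofReal (c / 2) * ∫⁻ a, ENNReal.ofReal (‖a‖ ^ 4) ∂ν ≤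
        InformationTheory.klDiv ν (prior ℓ) + K := by
  have := isProbabilityMeasure_prior hc hc0 hℓ
  have hint := integrable_exp_prior hc hc0 hℓ (f := fun a => c / 2 * ‖a‖ ^ 4) (by fun_prop) (B := 0)
    (fun a => by linarith)
  refine ⟨∫⁻ a, ENNReal.ofReal (Real.exp (c / 2 * ‖a‖ ^ 4)) ∂(prior ℓ),
    hint.lintegral_lt_top.ne, fun ν hν => ?_⟩
  rw [← lintegral_const_mul _ (by fun_prop)]
  refine le_trans (le_of_eq (lintegral_congr fun a => ?_))
    (lintegral_le_klDiv_add (μ := prior ℓ) (f := fun a => c / 2 * ‖a‖ ^ 4) (by fun_prop))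
  rw [ENNReal.ofReal_mul (by positivity)]

end Prior

/-! ### The vector field of a control -/

variable {d₁ d₂ m : ℕ}

/-- The consequences of the regularity assumptions on `b` that are used: `b` is bounded in `x`, and
its first two derivatives in `x` are bounded by powers of `‖a‖`. -/
structure HasFieldBounds (b : Vec d₁ → Vec m → Vec d₁) (C : ℝ) : Prop where
  nonneg : 0 ≤ C
  cont : Continuous fun p : Vec d₁ × Vec m => b p.1 p.2
  diff : ∀ a, Differentiable ℝ fun x => b x a
  cont_fderiv : Continuous fun p : Vec d₁ × Vec m => fderiv ℝ (fun x => b x p.2) p.1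
  bound : ∀ x a, ‖b x a‖ ≤ C * (1 + ‖a‖)
  fderiv_bound : ∀ x a, ‖fderiv ℝ (fun x => b x a) x‖ ≤ C * (1 + ‖a‖ ^ 2)
  fderiv_lip : ∀ x x' a, ‖fderiv ℝ (fun x => b x a) x - fderiv ℝ (fun x => b x a) x'‖ ≤
    C * (1 + ‖a‖ ^ 3) * ‖x - x'‖
  zero : ∀ x, b x 0 = 0

theorem Regularity.exists_fieldBounds {b : Vec d₁ → Vec m → Vec d₁} {ℓ : Vec m → ℝ}
    {L : State d₁ d₂ → ℝ} (h : Regularity b ℓ L) : ∃ C, HasFieldBounds b C := by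
  obtain ⟨C, hC⟩ := h.b_growth
  have hsm : ∀ a, ContDiff ℝ 4 fun x => b x a := fun a =>
    h.b_smooth.comp (contDiff_id.prodMk contDiff_const)
  have hk : ∀ k : ℕ, k ≤ 4 → ∀ x a,
      ‖iteratedFDeriv ℝ k (fun x => b x a) x‖ ≤ 2 * |C| * (1 + ‖a‖ ^ (k + 1)) := by
    intro k hk x a
    have h1 := hC k 0 (by omega) x a
    -- only the bounds without derivatives in `a` are used
    have h2 : (fun x' => iteratedFDeriv ℝ 0 (fun a' => b x' a') a) =
        (continuousMultilinearCurryFin0 ℝ (Vec m) (Vec d₁)).symm ∘ fun x' => b x' a := by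
      ext x' v
      simp
    rw [h2, LinearIsometryEquiv.norm_iteratedFDeriv_comp_left] at h1
    refine h1.trans ?_
    rw [pow_zero]
    have h3 : 0 ≤ 1 + ‖a‖ ^ (k + 1) := by positivity
    nlinarith [mul_le_mul_of_nonneg_right (le_abs_self C) h3]
  have hfd : ∀ a, ContDiff ℝ 1 (fderiv ℝ fun x => b x a) := fun a =>
    (hsm a).fderiv_right (by norm_num)
  refine ⟨2 * |C|, by positivity, h.b_smooth.continuous, fun a =>
    (hsm a).differentiable (by norm_num), ?_, fun x a => ?_, fun x a => ?_, fun x x' a => ?_,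
    h.b_zero⟩
  · have h1 : (fun p : Vec d₁ × Vec m => fderiv ℝ (fun x => b x p.2) p.1) = fun p =>
        (fderiv ℝ (fun p : Vec d₁ × Vec m => b p.1 p.2) p).comp
          (ContinuousLinearMap.inl ℝ (Vec d₁) (Vec m)) := by
      ext1 p
      have h2 : HasFDerivAt (fun x : Vec d₁ => (x, p.2))
          (ContinuousLinearMap.inl ℝ (Vec d₁) (Vec m)) p.1 := hasFDerivAt_prodMk_left p.1 p.2
      exact (((h.b_smooth.differentiable (by norm_num)) (p.1, p.2)).hasFDerivAt.comp p.1 h2).fderiv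
    rw [h1]
    exact (h.b_smooth.continuous_fderiv (by norm_num)).clm_comp continuous_const
  · simpa using hk 0 (by norm_num) x a
  · have h1 := hk 1 (by norm_num) x a
    rwa [norm_iteratedFDeriv_one] at h1
  · refine convex_univ.norm_image_sub_le_of_norm_fderiv_le (𝕜 := ℝ)
      (fun x _ => (hfd a).differentiable one_ne_zero x) (fun x _ => ?_) (mem_univ x') (mem_univ x)
    have h1 := hk 2 (by norm_num) x a
    rwa [← norm_iteratedFDeriv_fderiv, norm_iteratedFDeriv_one] at h1

open ProbabilityTheory

/-- A measurable family of probability measures that is the Dirac mass at `0` outside `[t₀, T]`,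
with fourth moments that are finite at every time and integrable in time. Every admissible control
agrees for almost every time with such a family. -/
structure IsGoodControl (κ : Kernel ℝ (Vec m)) (t₀ T : ℝ) : Prop where
  prob : ∀ t, IsProbabilityMeasure (κ t)
  off : ∀ t ∉ Icc t₀ T, κ t = Measure.dirac 0
  moment : ∀ t, Integrable (fun a => ‖a‖ ^ 4) (κ t)
  integrable : Integrable fun t => ∫ a, ‖a‖ ^ 4 ∂(κ t)

/-- The velocity field on the state space driven by `κ`: labels do not move. -/
noncomputable def ctrlField (b : Vec d₁ → Vec m → Vec d₁) (κ : Kernel ℝ (Vec m)) (t : ℝ)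
    (z : State d₁ d₂) : State d₁ d₂ := (avgField b z.1 (κ t), 0)

/-- The Lipschitz constant of `ctrlField`: it involves the second moment of the control. -/
noncomputable def ctrlBound (C t₀ T : ℝ) (κ : Kernel ℝ (Vec m)) : ℝ → ℝ :=
  (Icc t₀ T).indicator fun t => 2 * C * (1 + ∫ a, ‖a‖ ^ 2 ∂(κ t))

/-- The Lipschitz constant of the derivative of `ctrlField`. -/
noncomputable def ctrlBound₂ (C t₀ T : ℝ) (κ : Kernel ℝ (Vec m)) : ℝ → ℝ :=
  (Icc t₀ T).indicator fun t => 2 * C * (1 + ∫ a, ‖a‖ ^ 4 ∂(κ t))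

/-- A linear map on the features, extended by zero to the labels. -/
noncomputable def liftFst (A : Vec d₁ →L[ℝ] Vec d₁) : State d₁ d₂ →L[ℝ] State d₁ d₂ :=
  (ContinuousLinearMap.inl ℝ (Vec d₁) (Vec d₂)).comp (A.comp (ContinuousLinearMap.fst ℝ _ _))

theorem norm_liftFst_le (A : Vec d₁ →L[ℝ] Vec d₁) :
    ‖(liftFst A : State d₁ d₂ →L[ℝ] State d₁ d₂)‖ ≤ ‖A‖ := by
  refine ContinuousLinearMap.opNorm_le_bound _ (norm_nonneg _) fun v => ?_
  have h1 : ‖liftFst A v‖ = ‖A v.1‖ := by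
    simp [liftFst, Prod.norm_def]
  rw [h1]
  exact (A.le_opNorm _).trans (mul_le_mul_of_nonneg_left (norm_fst_le v) (norm_nonneg _))

theorem liftFst_sub (A B : Vec d₁ →L[ℝ] Vec d₁) :
    (liftFst A - liftFst B : State d₁ d₂ →L[ℝ] State d₁ d₂) = liftFst (A - B) := by
  ext v <;> simp [liftFst]

theorem norm_pow_le_one_add_pow_four {k : ℕ} (hk : k ≤ 4) (a : Vec m) :
    ‖a‖ ^ k ≤ 1 + ‖a‖ ^ 4 := by
  rcases le_total ‖a‖ 1 with h | h
  · have := pow_le_one₀ (n := k) (norm_nonneg a) h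
    have : 0 ≤ ‖a‖ ^ 4 := by positivity
    linarith
  · have := pow_le_pow_right₀ h hk
    linarith

namespace IsGoodControl

variable {κ : Kernel ℝ (Vec m)} {t₀ T C : ℝ} {b : Vec d₁ → Vec m → Vec d₁}

theorem integrable_pow (hκ : IsGoodControl κ t₀ T) {k : ℕ} (hk : k ≤ 4) (t : ℝ) :
    Integrable (fun a => ‖a‖ ^ k) (κ t) := by
  have := hκ.prob t
  refine (Integrable.add (integrable_const 1) (hκ.moment t)).mono'
    (by fun_prop : Continuous _).aestronglyMeasurable (ae_of_all _ fun a => ?_)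
  rw [Real.norm_of_nonneg (by positivity)]
  exact norm_pow_le_one_add_pow_four hk a

theorem integrable_of_bound (hκ : IsGoodControl κ t₀ T) {G : Type*} [NormedAddCommGroup G]
    {f : Vec m → G} (t : ℝ) (hf : AEStronglyMeasurable f (κ t)) {k : ℕ} (hk : k ≤ 4)
    (h : ∀ a, ‖f a‖ ≤ C * (1 + ‖a‖ ^ k)) : Integrable f (κ t) := by
  have := hκ.prob t
  exact ((Integrable.add (integrable_const 1) (hκ.integrable_pow hk t)).const_mul C).mono' hf
    (ae_of_all _ h)

theorem norm_integral_le (hκ : IsGoodControl κ t₀ T) {G : Type*} [NormedAddCommGroup G]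
    [NormedSpace ℝ G] {f : Vec m → G} (t : ℝ) {k : ℕ} (hk : k ≤ 4)
    (h : ∀ a, ‖f a‖ ≤ C * (1 + ‖a‖ ^ k)) :
    ‖∫ a, f a ∂(κ t)‖ ≤ C * (1 + ∫ a, ‖a‖ ^ k ∂(κ t)) := by
  have := hκ.prob t
  have hi := (Integrable.add (integrable_const 1) (hκ.integrable_pow hk t)).const_mul C
  refine (norm_integral_le_of_norm_le hi (ae_of_all _ h)).trans (le_of_eq ?_)
  simp only [Pi.add_apply]
  rw [integral_const_mul, integral_add (integrable_const 1) (hκ.integrable_pow hk t)]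
  simp

theorem integral_pow_nonneg (t : ℝ) (k : ℕ) : 0 ≤ ∫ a, ‖a‖ ^ k ∂(κ t) :=
  integral_nonneg fun a => by positivity

theorem stronglyMeasurable_integral (hκ : IsGoodControl κ t₀ T) {G : Type*}
    [NormedAddCommGroup G] [NormedSpace ℝ G] {f : Vec m → G} (hf : StronglyMeasurable f) :
    StronglyMeasurable fun t => ∫ a, f a ∂(κ t) :=
  have : IsMarkovKernel κ := ⟨hκ.prob⟩
  StronglyMeasurable.integral_kernel_prod_right (κ := κ) (f := fun _ a => f a)
    (hf.comp_measurable measurable_snd)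

theorem integrable_norm_pow (hκ : IsGoodControl κ t₀ T) {k : ℕ} (hk : k ≤ 4) :
    IntegrableOn (fun t => ∫ a, ‖a‖ ^ k ∂(κ t)) (Icc t₀ T) := by
  refine (Integrable.add (integrable_const 1) hκ.integrable.integrableOn).mono'
    (hκ.stronglyMeasurable_integral
      (by fun_prop : Continuous fun a : Vec m => ‖a‖ ^ k).stronglyMeasurable).aestronglyMeasurable
    (ae_of_all _ fun t => ?_)
  have := hκ.prob t
  rw [Real.norm_of_nonneg (integral_pow_nonneg t k)]
  have h1 : ∫ a, ‖a‖ ^ k ∂(κ t) ≤ ∫ a, (1 + ‖a‖ ^ 4) ∂(κ t) :=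
    integral_mono (hκ.integrable_pow hk t) ((integrable_const 1).add (hκ.moment t))
      fun a => norm_pow_le_one_add_pow_four hk a
  rw [integral_add (integrable_const 1) (hκ.moment t)] at h1
  simpa using h1

theorem integrable_ctrlBound (hκ : IsGoodControl κ t₀ T) (C : ℝ) :
    Integrable (ctrlBound C t₀ T κ) :=
  (IntegrableOn.integrable_indicator
    ((Integrable.add (integrable_const 1) (hκ.integrable_norm_pow (k := 2) (by norm_num))).const_mul
      (2 * C)) measurableSet_Icc)

theorem integrable_ctrlBound₂ (hκ : IsGoodControl κ t₀ T) (C : ℝ) :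
    Integrable (ctrlBound₂ C t₀ T κ) :=
  (IntegrableOn.integrable_indicator
    ((Integrable.add (integrable_const 1) (hκ.integrable_norm_pow (k := 4) le_rfl)).const_mul
      (2 * C)) measurableSet_Icc)

/-- The primitive of the Lipschitz constant is Hölder continuous of order `1/2`, since the
Lipschitz constant is controlled by the second moment and the fourth moment is integrable. -/
theorem exists_cumul_ctrlBound_le (hκ : IsGoodControl κ t₀ T) (hC : 0 ≤ C) :
    ∃ K, 0 ≤ K ∧ ∀ s ∈ Icc t₀ T, ∀ t ∈ Icc t₀ T,
      |cumul (ctrlBound C t₀ T κ) t - cumul (ctrlBound C t₀ T κ) s| ≤ K * Real.sqrt |t - s| := by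
  set Q := ∫ t, ∫ a, ‖a‖ ^ 4 ∂(κ t) with hQ
  have hQ0 : 0 ≤ Q := integral_nonneg fun t => integral_pow_nonneg t 4
  have key : ∀ s t, s ∈ Icc t₀ T → t ∈ Icc t₀ T → s ≤ t →
      |cumul (ctrlBound C t₀ T κ) t - cumul (ctrlBound C t₀ T κ) s| ≤
        2 * C * (Real.sqrt (T - t₀) + (Q + 1) / 2) * Real.sqrt |t - s| := by
    intro s t hs ht hst
    have hi := hκ.integrable_ctrlBound C
    have hnn : ∀ r, 0 ≤ ctrlBound C t₀ T κ r := fun r =>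
      indicator_nonneg (fun t _ => by
        have := integral_pow_nonneg (κ := κ) t 2
        positivity) r
    rw [← setIntegral_Ioc_eq_cumul hi hst, abs_of_nonneg (integral_nonneg hnn),
      abs_of_nonneg (sub_nonneg.mpr hst)]
    rcases hst.eq_or_lt with rfl | hst'
    · simp
    set η := Real.sqrt (t - s) with hη
    have hη0 : 0 < η := Real.sqrt_pos.mpr (sub_pos.mpr hst')
    have hη2 : η ^ 2 = t - s := Real.sq_sqrt (sub_nonneg.mpr hst)
    have hηT : η ≤ Real.sqrt (T - t₀) := Real.sqrt_le_sqrt (by linarith [hs.1, ht.2])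
    have h1 : ∫ r in Ioc s t, ctrlBound C t₀ T κ r ≤
        ∫ r in Ioc s t, (2 * C * (1 + 1 / (2 * η)) + C * η * ∫ a, ‖a‖ ^ 4 ∂(κ r)) := by
      refine integral_mono hi.integrableOn ((integrable_const _).add
        (hκ.integrable.integrableOn.const_mul _)) fun r => ?_
      have h4 := integral_pow_nonneg (κ := κ) r 4
      have hr0 : 0 ≤ 2 * C * (1 + 1 / (2 * η)) + C * η * ∫ a, ‖a‖ ^ 4 ∂(κ r) := by positivity
      unfold ctrlBound
      by_cases hr : r ∈ Icc t₀ T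
      · rw [indicator_of_mem hr]
        have := hκ.prob r
        have h2 : ∫ a, ‖a‖ ^ 2 ∂(κ r) ≤ ∫ a, (1 / (2 * η) + η / 2 * ‖a‖ ^ 4) ∂(κ r) := by
          refine integral_mono (hκ.integrable_pow (by norm_num) r)
            ((integrable_const _).add ((hκ.moment r).const_mul _)) fun a => ?_
          -- Young's inequality with the weight `η = √(t - s)` balances the two terms
          have h3 : 1 / (2 * η) + η / 2 * ‖a‖ ^ 4 - ‖a‖ ^ 2 = (η * ‖a‖ ^ 2 - 1) ^ 2 / (2 * η) := by
            field_simp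
            ring
          have h5 : 0 ≤ (η * ‖a‖ ^ 2 - 1) ^ 2 / (2 * η) := by positivity
          beta_reduce
          linarith
        rw [integral_add (integrable_const _) ((hκ.moment r).const_mul _),
          integral_const_mul] at h2
        simp only [integral_const, probReal_univ, smul_eq_mul, one_mul] at h2
        have := mul_le_mul_of_nonneg_left h2 hC
        linarith
      · rw [indicator_of_notMem hr]
        exact hr0
    have h6 : ∫ r in Ioc s t, ∫ a, ‖a‖ ^ 4 ∂(κ r) ≤ Q :=
      setIntegral_le_integral hκ.integrable (ae_of_all _ fun r => integral_pow_nonneg r 4)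
    rw [integral_add (integrable_const _) (hκ.integrable.integrableOn.const_mul _),
      integral_const_mul (C * η)] at h1
    simp only [integral_const, measureReal_restrict_apply_univ, Real.volume_real_Ioc_of_le hst,
      smul_eq_mul] at h1
    rw [← hη2] at h1
    have h7 := mul_le_mul_of_nonneg_left h6 (mul_nonneg hC hη0.le)
    have h8 : η ^ 2 * (2 * C * (1 + 1 / (2 * η))) = 2 * C * η * η + C * η := by
      field_simp
    have h9 : 2 * C * η * η ≤ 2 * C * η * Real.sqrt (T - t₀) :=
      mul_le_mul_of_nonneg_left hηT (by positivity)
    linarith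
  refine ⟨2 * C * (Real.sqrt (T - t₀) + (Q + 1) / 2), by positivity, fun s hs t ht => ?_⟩
  rcases le_total s t with h | h
  · exact key s t hs ht h
  · rw [abs_sub_comm, abs_sub_comm t s]
    exact key t s ht hs h

theorem hasFDerivAt_avgField (hκ : IsGoodControl κ t₀ T) (hb : HasFieldBounds b C) (t : ℝ)
    (x : Vec d₁) : HasFDerivAt (fun x => avgField b x (κ t))
      (∫ a, fderiv ℝ (fun x => b x a) x ∂(κ t)) x := by
  have hc : ∀ x, Continuous fun a => b x a := fun x => hb.cont.comp (Continuous.prodMk_right x)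
  have hc' : ∀ x, Continuous fun a => fderiv ℝ (fun x => b x a) x := fun x =>
    hb.cont_fderiv.comp (Continuous.prodMk_right x)
  have := hκ.prob t
  refine hasFDerivAt_integral_of_dominated_of_fderiv_le (𝕜 := ℝ) (s := univ)
    (F := fun x a => b x a) (F' := fun x a => fderiv ℝ (fun x => b x a) x)
    (bound := fun a => C * (1 + ‖a‖ ^ 2)) univ_mem
    (Eventually.of_forall fun x => (hc x).aestronglyMeasurable) ?_
    (hc' x).aestronglyMeasurable (ae_of_all _ fun a x _ => hb.fderiv_bound x a) ?_
    (ae_of_all _ fun a x _ => (hb.diff a x).hasFDerivAt)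
  · exact hκ.integrable_of_bound (k := 1) t (hc x).aestronglyMeasurable (by norm_num)
      (fun a => by simpa using hb.bound x a)
  · exact (Integrable.add (integrable_const 1) (hκ.integrable_pow (by norm_num) t)).const_mul C

theorem hasFDerivAt_ctrlField (hκ : IsGoodControl κ t₀ T) (hb : HasFieldBounds b C) (t : ℝ)
    (z : State d₁ d₂) : HasFDerivAt (ctrlField b κ t)
      (liftFst (∫ a, fderiv ℝ (fun x => b x a) z.1 ∂(κ t))) z := by
  have h1 := (hκ.hasFDerivAt_avgField hb t z.1).comp z
    (ContinuousLinearMap.fst ℝ (Vec d₁) (Vec d₂)).hasFDerivAt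
  exact (ContinuousLinearMap.inl ℝ (Vec d₁) (Vec d₂)).hasFDerivAt.comp z h1

theorem avgField_of_notMem (hκ : IsGoodControl κ t₀ T) (hb : HasFieldBounds b C) {t : ℝ}
    (ht : t ∉ Icc t₀ T) (x : Vec d₁) : avgField b x (κ t) = 0 := by
  rw [avgField, hκ.off t ht, integral_dirac, hb.zero]

theorem one_add_norm_le (a : Vec m) : 1 + ‖a‖ ≤ 2 * (1 + ‖a‖ ^ 2) := by
  nlinarith [sq_nonneg (‖a‖ - 1), sq_nonneg ‖a‖]

theorem one_add_norm_cube_le (a : Vec m) : 1 + ‖a‖ ^ 3 ≤ 2 * (1 + ‖a‖ ^ 4) := by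
  have := norm_pow_le_one_add_pow_four (k := 3) (by norm_num) a
  have : 0 ≤ ‖a‖ ^ 4 := by positivity
  linarith

/-- The velocity field of a control is smooth in space with constants that are integrable in time,
since these only involve moments of order at most four of the control. -/
theorem isSmoothField (hκ : IsGoodControl κ t₀ T) (hb : HasFieldBounds b C) :
    IsSmoothField (ctrlField (d₂ := d₂) b κ) (ctrlBound C t₀ T κ) (ctrlBound₂ C t₀ T κ) := by
  have hC := hb.nonneg
  have hc : ∀ x, Continuous fun a => b x a := fun x => hb.cont.comp (Continuous.prodMk_right x)
  have hc' : ∀ x, Continuous fun a => fderiv ℝ (fun x => b x a) x := fun x =>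
    hb.cont_fderiv.comp (Continuous.prodMk_right x)
  have hfd : ∀ t (z : State d₁ d₂), fderiv ℝ (ctrlField b κ t) z =
      liftFst (∫ a, fderiv ℝ (fun x => b x a) z.1 ∂(κ t)) := fun t z =>
    (hκ.hasFDerivAt_ctrlField hb t z).fderiv
  have hoff : ∀ t ∉ Icc t₀ T, ∀ z : State d₁ d₂, ctrlField b κ t z = 0 := fun t ht z => by
    rw [ctrlField, hκ.avgField_of_notMem hb ht]
    rfl
  have hoff' : ∀ t ∉ Icc t₀ T, ∀ z : State d₁ d₂, fderiv ℝ (ctrlField b κ t) z = 0 := by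
    intro t ht z
    have h1 : ctrlField (d₂ := d₂) b κ t = fun _ => 0 := funext fun z => hoff t ht z
    rw [h1, fderiv_fun_const]
    rfl
  refine ⟨fun z => ?_, fun z => ?_, fun t z => (hκ.hasFDerivAt_ctrlField hb t z).differentiableAt,
    hκ.integrable_ctrlBound C, hκ.integrable_ctrlBound₂ C, fun t => ?_, fun t z => ?_,
    fun t z => ?_, fun t z z' => ?_⟩
  · exact (hκ.stronglyMeasurable_integral (hc z.1).stronglyMeasurable).prodMk
      stronglyMeasurable_const
  · simp only [hfd]
    have h1 : Continuous fun A : Vec d₁ →L[ℝ] Vec d₁ =>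
        (liftFst A : State d₁ d₂ →L[ℝ] State d₁ d₂) := by
      unfold liftFst
      exact continuous_const.clm_comp (continuous_id.clm_comp continuous_const)
    exact h1.comp_stronglyMeasurable
      (hκ.stronglyMeasurable_integral (hc' z.1).stronglyMeasurable)
  · refine indicator_nonneg (fun t _ => ?_) t
    have := integral_pow_nonneg (κ := κ) t 4
    positivity
  · by_cases ht : t ∈ Icc t₀ T
    · rw [ctrlBound, indicator_of_mem ht]
      have h1 : ‖(ctrlField b κ t z : State d₁ d₂)‖ = ‖avgField b z.1 (κ t)‖ := by
        simp [ctrlField, Prod.norm_def]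
      rw [h1]
      refine hκ.norm_integral_le t (by norm_num) fun a => (hb.bound z.1 a).trans ?_
      have := mul_le_mul_of_nonneg_left (one_add_norm_le a) hC
      linarith
    · rw [hoff t ht, ctrlBound, indicator_of_notMem ht, norm_zero]
  · by_cases ht : t ∈ Icc t₀ T
    · rw [ctrlBound, indicator_of_mem ht, hfd]
      refine (norm_liftFst_le _).trans (hκ.norm_integral_le t (by norm_num) fun a =>
        (hb.fderiv_bound z.1 a).trans ?_)
      have : 0 ≤ C * (1 + ‖a‖ ^ 2) := by positivity
      linarith
    · rw [hoff' t ht, ctrlBound, indicator_of_notMem ht, norm_zero]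
  · by_cases ht : t ∈ Icc t₀ T
    · rw [ctrlBound₂, indicator_of_mem ht, hfd, hfd, liftFst_sub, ← integral_sub]
      · refine (norm_liftFst_le _).trans ?_
        have h1 := hκ.norm_integral_le (C := 2 * C * ‖z - z'‖) (k := 4) t le_rfl
          (f := fun a => fderiv ℝ (fun x => b x a) z.1 - fderiv ℝ (fun x => b x a) z'.1)
          (fun a => ?_)
        · linarith
        · refine (hb.fderiv_lip z.1 z'.1 a).trans ?_
          have h2 : ‖z.1 - z'.1‖ ≤ ‖z - z'‖ := norm_fst_le (z - z')
          have h3 := one_add_norm_cube_le a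
          calc _ ≤ C * (2 * (1 + ‖a‖ ^ 4)) * ‖z - z'‖ := by gcongr
            _ = _ := by ring
      · exact hκ.integrable_of_bound t (hc' z.1).aestronglyMeasurable (by norm_num)
          (hb.fderiv_bound z.1)
      · exact hκ.integrable_of_bound t (hc' z'.1).aestronglyMeasurable (by norm_num)
          (hb.fderiv_bound z'.1)
    · rw [hoff' t ht, hoff' t ht, ctrlBound₂, indicator_of_notMem ht, sub_self, norm_zero, zero_mul]

end IsGoodControl

/-- Admissible controls agree for almost every time with a control whose fourth moments are finite
at every time and integrable in time. -/
theorem exists_goodControl {ℓ : Vec m → ℝ} (hc : Continuous ℓ) {c C : ℝ} (hc0 : 0 < c)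
    (hℓ : ∀ a, c * ‖a‖ ^ 4 - C ≤ ℓ a) {t₀ T : ℝ} {ν : ℝ → Measure (Vec m)}
    (hν : ν ∈ AdmissibleControls ℓ t₀ T) :
    ∃ κ : Kernel ℝ (Vec m), IsGoodControl κ t₀ T ∧
      ∀ᵐ t ∂(volume.restrict (Icc t₀ T)), ν t = κ t := by
  classical
  obtain ⟨hprob, hmeas, hfin⟩ := hν
  -- the control extended by a Dirac mass outside the time interval
  set ν₁ : ℝ → Measure (Vec m) := fun t => if t ∈ Icc t₀ T then ν t else Measure.dirac 0 with hν₁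
  have hm₁ : Measurable ν₁ := by
    refine measurable_of_restrict_of_restrict_compl (s := Icc t₀ T) measurableSet_Icc ?_ ?_
    · convert hmeas using 1
      ext1 t
      simp only [hν₁, Set.domRestrict_apply, if_pos t.2]
    · convert (measurable_const : Measurable fun _ : ((Icc t₀ T)ᶜ : Set ℝ) =>
        (Measure.dirac (0 : Vec m))) using 1
      ext1 t
      have : (t : ℝ) ∉ Icc t₀ T := t.2
      simp only [hν₁, Set.domRestrict_apply, if_neg this]
  -- the fourth moment is integrable in time because the entropy is
  set M : ℝ → ℝ≥0∞ := fun t => ∫⁻ a, ENNReal.ofReal (‖a‖ ^ 4) ∂(ν₁ t) with hM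
  have hMm : Measurable M :=
    (Measure.measurable_lintegral (by fun_prop)).comp hm₁
  have hMfin : ∫⁻ t in Icc t₀ T, M t < ⊤ := by
    obtain ⟨K, hK, hbd⟩ := exists_moment_le_klDiv hc hc0 hℓ
    have hc2 : ENNReal.ofReal (c / 2) ≠ 0 := by
      rw [ne_eq, ENNReal.ofReal_eq_zero, not_le]
      positivity
    have h1 : ENNReal.ofReal (c / 2) * ∫⁻ t in Icc t₀ T, M t < ⊤ := by
      rw [← lintegral_const_mul _ hMm]
      calc _ ≤ ∫⁻ t in Icc t₀ T, (InformationTheory.klDiv (ν t) (prior ℓ) + K) := by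
            refine setLIntegral_mono' measurableSet_Icc fun t ht => ?_
            simp only [hM, hν₁, if_pos ht]
            exact hbd (ν t) (hprob t ht)
        _ = (∫⁻ t in Icc t₀ T, InformationTheory.klDiv (ν t) (prior ℓ)) +
              K * volume (Icc t₀ T) := by
            rw [lintegral_add_right _ measurable_const, lintegral_const,
              Measure.restrict_apply_univ]
        _ < ⊤ := by
            refine ENNReal.add_lt_top.mpr ⟨hfin, ENNReal.mul_lt_top hK.lt_top ?_⟩
            exact measure_Icc_lt_top
    exact lt_top_iff_ne_top.mpr fun h => by
      rw [h, ENNReal.mul_top hc2] at h1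
      exact lt_irrefl _ h1
  -- at the times of infinite fourth moment, a null set, the control is replaced by a Dirac mass
  set G : Set ℝ := {t | M t < ⊤} with hG
  have hGm : MeasurableSet G := measurableSet_lt hMm measurable_const
  set ν₂ : ℝ → Measure (Vec m) := fun t => if t ∈ G then ν₁ t else Measure.dirac 0 with hν₂
  have hm₂ : Measurable ν₂ := Measurable.ite hGm hm₁ measurable_const
  have hM₂ : ∀ t, ∫⁻ a, ENNReal.ofReal (‖a‖ ^ 4) ∂(ν₂ t) = G.indicator M t := by
    intro t
    by_cases ht : t ∈ G
    · simp [hν₂, ht, hM]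
    · simp [hν₂, ht]
  have hfin₂ : ∀ t, ∫⁻ a, ENNReal.ofReal (‖a‖ ^ 4) ∂(ν₂ t) < ⊤ := by
    intro t
    rw [hM₂]
    by_cases ht : t ∈ G
    · rw [indicator_of_mem ht]
      exact ht
    · rw [indicator_of_notMem ht]
      exact ENNReal.zero_lt_top
  have hmom : ∀ t, Integrable (fun a => ‖a‖ ^ 4) (ν₂ t) := fun t =>
    ⟨(by fun_prop : Continuous fun a : Vec m => ‖a‖ ^ 4).aestronglyMeasurable, by
      rw [hasFiniteIntegral_iff_ofReal (ae_of_all _ fun a => by positivity)]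
      exact hfin₂ t⟩
  have hprob₁ : ∀ t, IsProbabilityMeasure (ν₁ t) := by
    intro t
    by_cases ht : t ∈ Icc t₀ T
    · simp only [hν₁, if_pos ht]
      exact hprob t ht
    · simp only [hν₁, if_neg ht]
      infer_instance
  refine ⟨⟨ν₂, hm₂⟩, ⟨fun t => ?_, fun t ht => ?_, hmom, ?_⟩, ?_⟩
  · change IsProbabilityMeasure (ν₂ t)
    by_cases ht : t ∈ G
    · simp only [hν₂, if_pos ht]
      exact hprob₁ t
    · simp only [hν₂, if_neg ht]
      infer_instance
  · change ν₂ t = _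
    simp only [hν₂, hν₁, if_neg ht, ite_self]
  · have h1 : ∀ t, ∫ a, ‖a‖ ^ 4 ∂(ν₂ t) = (G.indicator M t).toReal := by
      intro t
      rw [integral_eq_lintegral_of_nonneg_ae (ae_of_all _ fun a => by positivity)
        (hmom t).aestronglyMeasurable, hM₂]
    change Integrable fun t => ∫ a, ‖a‖ ^ 4 ∂(ν₂ t)
    simp only [h1]
    refine integrable_toReal_of_lintegral_ne_top (hMm.indicator hGm).aemeasurable ?_
    have h2 : ∫⁻ t, G.indicator M t ≤ ∫⁻ t in Icc t₀ T, M t := by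
      rw [← lintegral_indicator measurableSet_Icc]
      refine lintegral_mono fun t => ?_
      by_cases ht : t ∈ Icc t₀ T
      · rw [indicator_of_mem ht]
        exact indicator_le_self _ _ _
      · have h3 : M t = 0 := by
          simp only [hM, hν₁, if_neg ht]
          simp
        rw [indicator_of_notMem ht]
        exact (indicator_le_self _ _ _).trans h3.le
    exact (h2.trans_lt hMfin).ne
  · filter_upwards [ae_lt_top hMm hMfin.ne, ae_restrict_mem measurableSet_Icc] with t ht ht'
    change ν t = ν₂ t
    have h3 : t ∈ G := ht
    simp only [hν₂, if_pos h3, hν₁, if_pos ht']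

/-! ### Gradients, moments and the Wasserstein distance on the state space -/

variable {d₁ d₂ m : ℕ}

theorem inner_gradX {f : State d₁ d₂ → ℝ} {z : State d₁ d₂} (hf : DifferentiableAt ℝ f z)
    (v : Vec d₁) : inner ℝ v (gradX f z) = fderiv ℝ f z (v, 0) := by
  have h1 : HasFDerivAt (fun x : Vec d₁ => (x, z.2))
      (ContinuousLinearMap.inl ℝ (Vec d₁) (Vec d₂)) z.1 := hasFDerivAt_prodMk_left z.1 z.2
  have h2 : fderiv ℝ (fun x => f (x, z.2)) z.1 =
      (fderiv ℝ f z).comp (ContinuousLinearMap.inl ℝ (Vec d₁) (Vec d₂)) :=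
    (HasFDerivAt.comp z.1 (g := f) hf.hasFDerivAt h1).fderiv
  rw [gradX, gradient, real_inner_comm, InnerProductSpace.toDual_symm_apply, h2]
  simp

theorem Regularity.exists_tame {b : Vec d₁ → Vec m → Vec d₁} {ℓ : Vec m → ℝ}
    {L : State d₁ d₂ → ℝ} (h : Regularity b ℓ L) : ∃ K K₁, HasTameGradient L K K₁ := by
  obtain ⟨C, hC⟩ := h.L_growth
  have hg : ∀ (k : ℕ) z, 1 ≤ k → k ≤ 3 → ‖iteratedFDeriv ℝ k L z‖ ≤ |C| + 2 * |C| * ‖z‖ := by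
    intro k z h1 h3
    refine ((hC z).2 k h1 h3).trans ?_
    have h4 := norm_fst_le z
    have h5 := norm_snd_le z
    calc C * (1 + ‖z.1‖ + ‖z.2‖) ≤ |C| * (1 + ‖z.1‖ + ‖z.2‖) := by
          gcongr
          exact le_abs_self C
      _ ≤ |C| * (1 + ‖z‖ + ‖z‖) := by gcongr
      _ = _ := by ring
  have hfd : ContDiff ℝ 1 (fderiv ℝ L) := h.L_two.fderiv_right (by norm_num)
  refine ⟨|C|, 2 * |C|, h.L_two.differentiable (by norm_num), fun z => ?_, fun z z' => ?_,
    by positivity, by positivity⟩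
  · have h1 := hg 1 z le_rfl (by norm_num)
    rwa [norm_iteratedFDeriv_one] at h1
  · refine (convex_closedBall (0 : State d₁ d₂) (‖z‖ + ‖z'‖)).norm_image_sub_le_of_norm_fderiv_le
      (𝕜 := ℝ) (fun x _ => hfd.differentiable one_ne_zero x) (fun x hx => ?_)
      (by simp) (by simp)
    have h1 := hg 2 x (by norm_num) (by norm_num)
    rw [← norm_iteratedFDeriv_fderiv, norm_iteratedFDeriv_one] at h1
    refine h1.trans ?_
    have h2 : ‖x‖ ≤ ‖z‖ + ‖z'‖ := by simpa using hx
    gcongr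

theorem sq_norm_le (z : State d₁ d₂) : ‖z‖ ^ 2 ≤ ‖z.1‖ ^ 2 + ‖z.2‖ ^ 2 := by
  rw [Prod.norm_def]
  rcases max_cases ‖z.1‖ ‖z.2‖ with h | h <;> rw [h.1] <;>
    nlinarith [sq_nonneg ‖z.1‖, sq_nonneg ‖z.2‖]

theorem le_sq_norm (z : State d₁ d₂) : ‖z.1‖ ^ 2 + ‖z.2‖ ^ 2 ≤ 2 * ‖z‖ ^ 2 := by
  have h4 := norm_fst_le z
  have h5 := norm_snd_le z
  have h6 : ‖z.1‖ ^ 2 ≤ ‖z‖ ^ 2 := by gcongr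
  have h7 : ‖z.2‖ ^ 2 ≤ ‖z‖ ^ 2 := by gcongr
  linarith

theorem inP_two_of_integrable {γ : Measure (State d₁ d₂)} [IsProbabilityMeasure γ]
    (h : Integrable (fun z => ‖z‖ ^ 2) γ) : InP 2 γ := by
  refine ⟨inferInstance, ?_⟩
  have h1 := (h.const_mul 2).lintegral_lt_top
  refine lt_of_le_of_lt (lintegral_mono fun z => ENNReal.ofReal_le_ofReal ?_) h1
  rw [div_self two_ne_zero, Real.rpow_one]
  exact le_sq_norm z

theorem InP.integrable_sq_norm {γ : Measure (State d₁ d₂)} {p : ℝ} (hp : 2 ≤ p) (h : InP p γ) :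
    Integrable (fun z => ‖z‖ ^ 2) γ := by
  have := h.1
  refine ⟨(by fun_prop : Continuous fun z : State d₁ d₂ => ‖z‖ ^ 2).aestronglyMeasurable, ?_⟩
  rw [hasFiniteIntegral_iff_ofReal (ae_of_all _ fun a => by positivity)]
  refine lt_of_le_of_lt (lintegral_mono (g := fun z => 1 +
    ENNReal.ofReal ((‖z.1‖ ^ 2 + ‖z.2‖ ^ 2) ^ (p / 2))) fun z => ?_) ?_
  · have h1 : ‖z‖ ^ 2 ≤ 1 + (‖z.1‖ ^ 2 + ‖z.2‖ ^ 2) ^ (p / 2) := by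
      refine (sq_norm_le z).trans ?_
      set r := ‖z.1‖ ^ 2 + ‖z.2‖ ^ 2
      have hr : 0 ≤ r := by positivity
      rcases le_total r 1 with h2 | h2
      · have := Real.rpow_nonneg hr (p / 2)
        linarith
      · have := Real.rpow_le_rpow_of_exponent_le h2 (show 1 ≤ p / 2 by linarith)
        rw [Real.rpow_one] at this
        linarith
    refine (ENNReal.ofReal_le_ofReal h1).trans ?_
    rw [ENNReal.ofReal_add zero_le_one (by positivity), ENNReal.ofReal_one]
  · rw [lintegral_add_left measurable_const, lintegral_const, measure_univ, mul_one]
    exact ENNReal.add_lt_top.mpr ⟨ENNReal.one_lt_top, h.2⟩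

theorem integrable_norm_of_sq {γ : Measure (State d₁ d₂)} [IsProbabilityMeasure γ]
    (h : Integrable (fun z => ‖z‖ ^ 2) γ) : Integrable (fun z => ‖z‖) γ := by
  refine ((integrable_const 1).add h).mono' continuous_norm.aestronglyMeasurable
    (ae_of_all _ fun z => ?_)
  rw [norm_norm, Pi.add_apply]
  nlinarith [sq_nonneg (‖z‖ - 1), sq_nonneg ‖z‖]

/-- Two images of the same measure are coupled by the pair of maps. -/
theorem dist2_map_le {μ : Measure (State d₁ d₂)} [IsProbabilityMeasure μ]
    {X Y : State d₁ d₂ → State d₁ d₂} (hX : Measurable X) (hY : Measurable Y) {D : ℝ}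
    (hD : 0 ≤ D) (h : ∀ z, ‖X z - Y z‖ ≤ D) :
    dist2 (μ.map X) (μ.map Y) ≤ ENNReal.ofReal (2 * D) := by
  have hXY : Measurable fun z => (X z, Y z) := hX.prodMk hY
  have h1 : ∫⁻ q, ENNReal.ofReal (‖q.1.1 - q.2.1‖ ^ 2 + ‖q.1.2 - q.2.2‖ ^ 2)
      ∂(μ.map fun z => (X z, Y z)) ≤ ENNReal.ofReal (2 * D) ^ 2 := by
    rw [lintegral_map (by fun_prop) hXY]
    calc _ ≤ ∫⁻ _, ENNReal.ofReal ((2 * D) ^ 2) ∂μ := by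
          refine lintegral_mono fun z => ENNReal.ofReal_le_ofReal ?_
          have h2 := le_sq_norm (X z - Y z)
          have h3 : ‖X z - Y z‖ ^ 2 ≤ D ^ 2 := by
            gcongr
            exact h z
          simp only [Prod.fst_sub, Prod.snd_sub] at h2
          nlinarith [sq_nonneg D]
      _ = _ := by
          rw [lintegral_const, measure_univ, mul_one, ENNReal.ofReal_pow (by positivity)]
  rw [dist2]
  have h4 : (ENNReal.ofReal (2 * D) ^ 2) ^ (1 / 2 : ℝ) = ENNReal.ofReal (2 * D) := by
    rw [← ENNReal.rpow_natCast, ← ENNReal.rpow_mul]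
    norm_num
  rw [← h4]
  refine ENNReal.rpow_le_rpow (iInf_le_of_le _ (iInf_le_of_le ?_ (iInf_le_of_le ?_ h1)))
    (by norm_num)
  · rw [Measure.map_map measurable_fst hXY]
    rfl
  · rw [Measure.map_map measurable_snd hXY]
    rfl

/-- Convergence in the Wasserstein distance implies convergence of the integrals of bounded Lipschitz
functions. -/
theorem abs_integral_sub_le_of_dist2_lt {μ μ' : Measure (State d₁ d₂)} [IsProbabilityMeasure μ]
    [IsProbabilityMeasure μ'] {ψ : State d₁ d₂ → ℝ} {B : ℝ} (hB : ∀ z, |ψ z| ≤ B) {C : NNReal}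
    (hψ : LipschitzWith C ψ) {η : ℝ} (hη : 0 < η) (h : dist2 μ μ' < ENNReal.ofReal η) :
    |∫ z, ψ z ∂μ - ∫ z, ψ z ∂μ'| ≤ C * η := by
  rw [dist2] at h
  have h1 := (ENNReal.rpow_lt_rpow_iff (z := 2) (by norm_num)).mpr h
  rw [← ENNReal.rpow_mul] at h1
  norm_num at h1
  simp only [iInf_lt_iff] at h1
  obtain ⟨π, hπ1, hπ2, hπ⟩ := h1
  have hp : IsProbabilityMeasure π := by
    refine ⟨?_⟩
    have : π.map Prod.fst univ = 1 := by rw [hπ1]; exact measure_univ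
    rwa [Measure.map_apply measurable_fst MeasurableSet.univ, preimage_univ] at this
  set D : State d₁ d₂ × State d₁ d₂ → ℝ :=
    fun q => ‖q.1.1 - q.2.1‖ ^ 2 + ‖q.1.2 - q.2.2‖ ^ 2 with hD
  have hDc : Continuous D := by fun_prop
  have hDi : Integrable D π := by
    refine ⟨hDc.aestronglyMeasurable, ?_⟩
    rw [hasFiniteIntegral_iff_ofReal (ae_of_all _ fun a => by positivity)]
    exact hπ.trans (by finiteness)
  have hDle : ∫ q, D q ∂π ≤ η ^ 2 := by
    rw [integral_eq_lintegral_of_nonneg_ae (ae_of_all _ fun a => by positivity)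
      hDc.aestronglyMeasurable]
    refine ENNReal.toReal_le_of_le_ofReal (by positivity) ?_
    rw [ENNReal.ofReal_pow hη.le]
    exact hπ.le
  have hi : ∀ (g : State d₁ d₂ × State d₁ d₂ → State d₁ d₂), Continuous g →
      Integrable (fun q => ψ (g q)) π := fun g hg =>
    (integrable_const B).mono' (hψ.continuous.comp hg).aestronglyMeasurable
      (ae_of_all _ fun q => hB (g q))
  have e1 : ∫ z, ψ z ∂μ = ∫ q, ψ q.1 ∂π := by
    rw [← hπ1, integral_map measurable_fst.aemeasurable hψ.continuous.aestronglyMeasurable]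
  have e2 : ∫ z, ψ z ∂μ' = ∫ q, ψ q.2 ∂π := by
    rw [← hπ2, integral_map measurable_snd.aemeasurable hψ.continuous.aestronglyMeasurable]
  rw [e1, e2, ← integral_sub (hi _ continuous_fst) (hi _ continuous_snd)]
  -- Young's inequality `‖v‖ ≤ ‖v‖ ^ 2 / (2 η) + η / 2` in place of the Cauchy–Schwarz inequality
  have h2 : |∫ q, (ψ q.1 - ψ q.2) ∂π| ≤ ∫ q, C * (1 / (2 * η) * D q + η / 2) ∂π := by
    refine (abs_integral_le_integral_abs).trans (integral_mono
      ((hi _ continuous_fst).sub (hi _ continuous_snd)).abs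
      (((hDi.const_mul _).add (integrable_const _)).const_mul _) fun q => ?_)
    have h3 : |ψ q.1 - ψ q.2| ≤ C * ‖q.1 - q.2‖ := by
      have := hψ.dist_le_mul q.1 q.2
      rwa [Real.dist_eq, dist_eq_norm] at this
    refine h3.trans (mul_le_mul_of_nonneg_left ?_ C.2)
    have h4 : ‖q.1 - q.2‖ ^ 2 ≤ D q := sq_norm_le (q.1 - q.2)
    have h5 : 1 / (2 * η) * ‖q.1 - q.2‖ ^ 2 + η / 2 - ‖q.1 - q.2‖ =
        (‖q.1 - q.2‖ - η) ^ 2 / (2 * η) := by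
      field_simp
      ring
    have h6 : 0 ≤ (‖q.1 - q.2‖ - η) ^ 2 / (2 * η) := by positivity
    have h7 : 1 / (2 * η) * ‖q.1 - q.2‖ ^ 2 ≤ 1 / (2 * η) * D q := by gcongr
    linarith
  refine h2.trans ?_
  rw [integral_const_mul, integral_add (hDi.const_mul _) (integrable_const _), integral_const_mul,
    integral_const, probReal_univ, one_smul]
  have h8 : 1 / (2 * η) * ∫ q, D q ∂π ≤ 1 / (2 * η) * η ^ 2 := by gcongr
  have h9 : 1 / (2 * η) * η ^ 2 = η / 2 := by field_simp
  exact mul_le_mul_of_nonneg_left (by linarith) C.2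

/-! ### The continuity equation of a control -/

open ProbabilityTheory

namespace IsGoodControl

variable {κ : Kernel ℝ (Vec m)} {t₀ T C : ℝ} {b : Vec d₁ → Vec m → Vec d₁}
  {ν : ℝ → Measure (Vec m)} {γ₀ : Measure (State d₁ d₂)}

theorem integrable_sq_norm_map_flow (hκ : IsGoodControl κ t₀ T) (hb : HasFieldBounds b C)
    [IsProbabilityMeasure γ₀] (hγ₀ : Integrable (fun z => ‖z‖ ^ 2) γ₀) (t : ℝ) :
    Integrable (fun z => ‖z‖ ^ 2) (γ₀.map (flow (ctrlField b κ) t₀ t)) := by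
  have hF := hκ.isSmoothField (d₂ := d₂) hb
  have hc : Continuous fun z : State d₁ d₂ => ‖z‖ ^ 2 := by fun_prop
  rw [integrable_map_measure hc.aestronglyMeasurable (hF.measurable_flow t₀ t).aemeasurable]
  set Q := ∫ q, ctrlBound C t₀ T κ q
  refine ((hγ₀.const_mul 2).add (integrable_const (2 * Q ^ 2))).mono'
    (hc.measurable.comp (hF.measurable_flow t₀ t)).aestronglyMeasurable (ae_of_all _ fun z => ?_)
  have h1 : ‖flow (ctrlField b κ) t₀ t z‖ ≤ ‖z‖ + Q := hF.norm_flow_le t₀ t z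
  have h2 : ‖flow (ctrlField b κ) t₀ t z‖ ^ 2 ≤ (‖z‖ + Q) ^ 2 := by gcongr
  rw [Function.comp_apply, Real.norm_of_nonneg (by positivity)]
  simp only [Pi.add_apply]
  nlinarith [sq_nonneg (‖z‖ - Q)]

/-- The integrand of the weak formulation is the space-time derivative of the test function in the
direction of the velocity field. -/
theorem weak_integrand_eq (hνκ : ν t = κ t) {φ : ℝ × State d₁ d₂ → ℝ} (hφ : ContDiff ℝ 1 φ)
    (z : State d₁ d₂) :
    deriv (fun s => φ (s, z)) t + inner ℝ (avgField b z.1 (ν t)) (gradX (fun z' => φ (t, z')) z) =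
      fderiv ℝ φ (t, z) (1, ctrlField b κ t z) := by
  have hd : HasFDerivAt φ (fderiv ℝ φ (t, z)) (t, z) :=
    (hφ.differentiable one_ne_zero (t, z)).hasFDerivAt
  have h1 : deriv (fun s => φ (s, z)) t = fderiv ℝ φ (t, z) (1, 0) := by
    have := hd.comp_hasDerivAt t ((hasDerivAt_id t).prodMk (hasDerivAt_const t z))
    exact this.deriv
  have h2 : HasFDerivAt (fun z' => φ (t, z'))
      ((fderiv ℝ φ (t, z)).comp (ContinuousLinearMap.inr ℝ ℝ (State d₁ d₂))) z :=
    hd.comp z (hasFDerivAt_prodMk_right t z)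
  rw [h1, inner_gradX h2.differentiableAt, h2.fderiv, hνκ]
  simp only [ContinuousLinearMap.comp_apply, ContinuousLinearMap.inr_apply]
  rw [← map_add]
  simp [ctrlField]

/-- Existence for the continuity equation driven by a control. -/
theorem isContinuitySolution (hκ : IsGoodControl κ t₀ T) (hb : HasFieldBounds b C)
    (hν : ∀ᵐ t ∂(volume.restrict (Icc t₀ T)), ν t = κ t) [IsProbabilityMeasure γ₀]
    (hγ₀ : Integrable (fun z => ‖z‖ ^ 2) γ₀) :
    IsContinuitySolution b t₀ T γ₀ ν fun t => γ₀.map (flow (ctrlField b κ) t₀ t) := by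
  have hF := hκ.isSmoothField (d₂ := d₂) hb
  have hprob : ∀ t, IsProbabilityMeasure (γ₀.map (flow (ctrlField b κ) t₀ t)) := fun t =>
    Measure.isProbabilityMeasure_map (hF.measurable_flow t₀ t).aemeasurable
  refine ⟨fun t _ => ?_, fun t _ => ?_, ?_, ?_⟩
  · have := hprob t
    exact inP_two_of_integrable (hκ.integrable_sq_norm_map_flow hb hγ₀ t)
  · have hc := continuous_cumul hF.integrable
    have h1 : ∀ s, dist2 (γ₀.map (flow (ctrlField b κ) t₀ s)) (γ₀.map (flow (ctrlField b κ) t₀ t)) ≤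
        ENNReal.ofReal (2 * |cumul (ctrlBound C t₀ T κ) s - cumul (ctrlBound C t₀ T κ) t|) := by
      intro s
      refine dist2_map_le (hF.measurable_flow _ _) (hF.measurable_flow _ _) (abs_nonneg _)
        fun z => ?_
      rcases le_total s t with h | h
      · rw [norm_sub_rev, abs_sub_comm]
        refine (hF.norm_flow_sub_flow_time t₀ h z).trans ?_
        rw [setIntegral_Ioc_eq_cumul hF.integrable h]
        exact le_abs_self _
      · refine (hF.norm_flow_sub_flow_time t₀ h z).trans ?_
        rw [setIntegral_Ioc_eq_cumul hF.integrable h]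
        exact le_abs_self _
    refine tendsto_of_tendsto_of_tendsto_of_le_of_le tendsto_const_nhds ?_ (fun s => zero_le) h1
    have h2 : Continuous fun s => ENNReal.ofReal
        (2 * |cumul (ctrlBound C t₀ T κ) s - cumul (ctrlBound C t₀ T κ) t|) :=
      ENNReal.continuous_ofReal.comp (by fun_prop)
    have h3 := (h2.tendsto t).mono_left (nhdsWithin_le_nhds (s := Icc t₀ T))
    simpa using h3
  · have h1 : flow (ctrlField b κ) t₀ t₀ = (id : State d₁ d₂ → State d₁ d₂) :=
      funext fun z => hF.flow_of_le le_rfl z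
    simp only [h1, Measure.map_id]
  · rintro φ hφ ⟨B, hB⟩ t₁ ht₁
    rw [intervalIntegral.integral_of_le ht₁.1, hF.weak_map_flow γ₀ hφ hB ht₁]
    congr 1
    have h1 : ∀ᵐ t ∂(volume.restrict (Ioc t₀ t₁)), ν t = κ t :=
      ae_restrict_of_ae_restrict_of_subset
        (Ioc_subset_Icc_self.trans (Icc_subset_Icc_right ht₁.2)) hν
    refine integral_congr_ae (h1.mono fun t ht => ?_)
    exact integral_congr_ae (ae_of_all _ fun z => (weak_integrand_eq ht hφ z).symm)

/-- Uniqueness for the continuity equation driven by a control. -/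
theorem eq_of_isContinuitySolution (hκ : IsGoodControl κ t₀ T) (hb : HasFieldBounds b C)
    (hν : ∀ᵐ t ∂(volume.restrict (Icc t₀ T)), ν t = κ t) {γ : ℝ → Measure (State d₁ d₂)}
    (hγ : IsContinuitySolution b t₀ T γ₀ ν γ) :
    ∀ t ∈ Icc t₀ T, γ t = γ₀.map (flow (ctrlField b κ) t₀ t) := by
  have hF := hκ.isSmoothField (d₂ := d₂) hb
  rw [← hγ.initial]
  refine hF.eq_map_flow (fun t ht => (hγ.mem_P2 t ht).1) ?_ ?_
  · rintro ψ ⟨B, hB⟩ ⟨K, hK⟩ t ht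
    rw [ContinuousWithinAt, Metric.tendsto_nhds]
    intro e he
    have hη : 0 < e / (2 * (K + 1)) := by positivity
    have h1 := (hγ.continuous t ht).eventually
      (gt_mem_nhds (ENNReal.ofReal_pos.mpr hη))
    filter_upwards [h1, self_mem_nhdsWithin] with s hs hs'
    have := (hγ.mem_P2 t ht).1
    have := (hγ.mem_P2 s hs').1
    rw [Real.dist_eq]
    refine (abs_integral_sub_le_of_dist2_lt hB hK hη hs).trans_lt ?_
    have h2 : (K : ℝ) * (e / (2 * (K + 1))) = e / 2 * (K / (K + 1)) := by
      field_simp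
    have h3 : (K : ℝ) / (K + 1) ≤ 1 := by
      rw [div_le_one (by positivity)]
      linarith
    rw [h2]
    nlinarith
  · rintro ψ hψ ⟨B, hB⟩ t₁ ht₁
    have hsnd : ContDiff ℝ 1 fun p : ℝ × State d₁ d₂ => ψ p.2 := hψ.comp contDiff_snd
    have hfd : ∀ t z, fderiv ℝ (fun p : ℝ × State d₁ d₂ => ψ p.2) (t, z) =
        (fderiv ℝ ψ z).comp (ContinuousLinearMap.snd ℝ ℝ (State d₁ d₂)) := fun t z =>
      (HasFDerivAt.comp (t, z) (g := ψ) (hψ.differentiable one_ne_zero z).hasFDerivAt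
        (hasFDerivAt_snd)).fderiv
    have h1 := hγ.weak (fun p => ψ p.2) hsnd ⟨B, fun t _ z => ⟨(hB z).1, ?_⟩⟩ t₁ ht₁
    · rw [h1, intervalIntegral.integral_of_le ht₁.1, hγ.initial]
      congr 1
      have h2 : ∀ᵐ t ∂(volume.restrict (Ioc t₀ t₁)), ν t = κ t :=
        ae_restrict_of_ae_restrict_of_subset
          (Ioc_subset_Icc_self.trans (Icc_subset_Icc_right ht₁.2)) hν
      refine integral_congr_ae (h2.mono fun t ht => ?_)
      refine integral_congr_ae (ae_of_all _ fun z => ?_)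
      have h3 := weak_integrand_eq (b := b) ht hsnd z
      rw [hfd] at h3
      exact h3
    · rw [hfd]
      refine (ContinuousLinearMap.opNorm_comp_le _ _).trans ?_
      exact (mul_le_of_le_one_right (norm_nonneg _)
        (ContinuousLinearMap.norm_snd_le ℝ ℝ (State d₁ d₂))).trans (hB z).2

end IsGoodControl

/-! ### The transport equation of a control -/

variable {d₁ d₂ m : ℕ}

theorem norm_le_add (z : State d₁ d₂) : ‖z‖ ≤ ‖z.1‖ + ‖z.2‖ :=
  max_le (le_add_of_nonneg_right (norm_nonneg _)) (le_add_of_nonneg_left (norm_nonneg _))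

theorem HasTameGradient.exists_c121Bound {φ : State d₁ d₂ → ℝ} {K K₁ : ℝ}
    (h : HasTameGradient φ K K₁) : ∃ B, C121Bound φ B := by
  have hK := h.nonneg
  have hK₁ := h.nonneg₁
  refine ⟨|φ 0| + K + K₁, fun z => ⟨?_, ?_⟩⟩
  · have h1 := h.abs_sub_le 0 z
    rw [norm_zero, sub_zero, zero_add] at h1
    have h2 := abs_sub_abs_le_abs_sub (φ z) (φ 0)
    have h3 := sq_norm_le z
    have h4 : ‖z‖ ≤ 1 + ‖z‖ ^ 2 := by nlinarith [sq_nonneg (‖z‖ - 1)]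
    calc |φ z| ≤ |φ 0| + K * ‖z‖ + K₁ * ‖z‖ ^ 2 := by nlinarith
      _ ≤ |φ 0| * (1 + ‖z‖ ^ 2) + K * (1 + ‖z‖ ^ 2) + K₁ * (1 + ‖z‖ ^ 2) := by
          have := abs_nonneg (φ 0)
          have h5 : |φ 0| * 1 ≤ |φ 0| * (1 + ‖z‖ ^ 2) := by
            gcongr
            nlinarith [sq_nonneg ‖z‖]
          have h6 : K * ‖z‖ ≤ K * (1 + ‖z‖ ^ 2) := by gcongr
          have h7 : K₁ * ‖z‖ ^ 2 ≤ K₁ * (1 + ‖z‖ ^ 2) := by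
            gcongr
            linarith
          linarith
      _ = (|φ 0| + K + K₁) * (1 + ‖z‖ ^ 2) := by ring
      _ ≤ _ := by
          rw [add_assoc 1]
          gcongr
  · have h1 : ‖z‖ ≤ ‖z.1‖ + ‖z.2‖ := norm_le_add z
    calc _ ≤ K + K₁ * ‖z‖ := h.bound z
      _ ≤ (|φ 0| + K + K₁) * 1 + (|φ 0| + K + K₁) * (‖z.1‖ + ‖z.2‖) := by
          have := abs_nonneg (φ 0)
          have h2 : K₁ * ‖z‖ ≤ (|φ 0| + K + K₁) * (‖z.1‖ + ‖z.2‖) := by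
            gcongr
            linarith
          linarith
      _ = _ := by ring

open ProbabilityTheory

namespace IsGoodControl

variable {κ : Kernel ℝ (Vec m)} {t₀ T C K K₁ : ℝ} {b : Vec d₁ → Vec m → Vec d₁}
  {ν : ℝ → Measure (Vec m)} {L : State d₁ d₂ → ℝ}

/-- The pointwise integrand of the transport equation, on differentiable functions, is the
derivative along the velocity field of the control. -/
theorem integral_inner_gradX_eq (hν : ∀ᵐ t ∂(volume.restrict (Icc t₀ T)), ν t = κ t)
    {u : ℝ → State d₁ d₂ → ℝ} (hu : ∀ t ∈ Icc t₀ T, Differentiable ℝ (u t)) {t : ℝ}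
    (ht : t ∈ Icc t₀ T) (z : State d₁ d₂) :
    ∫ s in t..T, inner ℝ (avgField b z.1 (ν s)) (gradX (u s) z) =
      ∫ s in Ioc t T, fderiv ℝ (u s) z (ctrlField b κ s z) := by
  rw [intervalIntegral.integral_of_le ht.2]
  have hsub : Ioc t T ⊆ Icc t₀ T := Ioc_subset_Icc_self.trans (Icc_subset_Icc_left ht.1)
  have h1 : ∀ᵐ s ∂(volume.restrict (Ioc t T)), ν s = κ s :=
    ae_restrict_of_ae_restrict_of_subset hsub hν
  refine integral_congr_ae ?_
  filter_upwards [h1, ae_restrict_mem measurableSet_Ioc] with s hs hs'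
  rw [inner_gradX (hu s (hsub hs') z), hs]
  rfl

/-- Existence for the transport equation driven by a control. The Hölder continuity in time is that
of the primitive of the Lipschitz constant. -/
theorem isTransportSolution (hκ : IsGoodControl κ t₀ T) (hb : HasFieldBounds b C)
    (hν : ∀ᵐ t ∂(volume.restrict (Icc t₀ T)), ν t = κ t) (hL : HasTameGradient L K K₁) :
    IsTransportSolution b L t₀ T ν (pull (ctrlField b κ) L T) := by
  have hF := hκ.isSmoothField (d₂ := d₂) hb
  obtain ⟨B, hB0, hB⟩ := hF.exists_tame_pull hL T
  refine ⟨fun t _ => (hB t).contDiff, fun t _ => (hB t).exists_c121Bound, ?_, fun t ht z => ?_⟩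
  · obtain ⟨B', hB'0, hB'⟩ := hF.exists_pull_time_bound hL T
    obtain ⟨Q, hQ0, hQ⟩ := hκ.exists_cumul_ctrlBound_le hb.nonneg
    refine ⟨2 * B' * Q, fun s hs t ht z => ?_⟩
    have h1 := hB' s t z
    have h2 := hQ s hs t ht
    have h3 : ‖z‖ ≤ ‖z.1‖ + ‖z.2‖ := norm_le_add z
    have h4 := sq_norm_le z
    have h5 : 1 + ‖z‖ ≤ 2 * (1 + ‖z‖ ^ 2) := by nlinarith [sq_nonneg (‖z‖ - 1), sq_nonneg ‖z‖]
    constructor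
    · calc _ ≤ B' * (1 + ‖z‖) * (Q * Real.sqrt |t - s|) := by
            refine h1.1.trans ?_
            gcongr
        _ ≤ B' * (2 * (1 + ‖z.1‖ ^ 2 + ‖z.2‖ ^ 2)) * (Q * Real.sqrt |t - s|) := by
            gcongr
            linarith
        _ = _ := by ring
    · have h6 : fderiv ℝ (fun z => pull (ctrlField b κ) L T t z - pull (ctrlField b κ) L T s z) z =
          fderiv ℝ (pull (ctrlField b κ) L T t) z - fderiv ℝ (pull (ctrlField b κ) L T s) z :=
        fderiv_fun_sub ((hB t).diff z) ((hB s).diff z)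
      rw [h6]
      calc _ ≤ B' * (1 + ‖z‖) * (Q * Real.sqrt |t - s|) := by
            refine h1.2.trans ?_
            gcongr
        _ ≤ B' * (2 * (1 + ‖z.1‖ + ‖z.2‖)) * (Q * Real.sqrt |t - s|) := by
            gcongr
            linarith [norm_nonneg z.1, norm_nonneg z.2]
        _ = _ := by ring
  · rw [integral_inner_gradX_eq hν (fun s _ => (hB s).diff) ht]
    exact hF.pull_eq hL ht.2 z

/-- The Hölder bound in time makes the spatial derivative of a solution jointly continuous. -/
theorem continuousOn_fderiv_of_holder {u : ℝ → State d₁ d₂ → ℝ}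
    (hu : IsTransportSolution b L t₀ T ν u) :
    ContinuousOn (fun p : ℝ × State d₁ d₂ => fderiv ℝ (u p.1) p.2) (Icc t₀ T ×ˢ univ) := by
  obtain ⟨Q, hQ⟩ := hu.holder
  rintro ⟨t, z⟩ ⟨ht, -⟩
  have hd : ∀ s ∈ Icc t₀ T, Differentiable ℝ (u s) := fun s hs =>
    (hu.contDiff s hs).differentiable one_ne_zero
  have h1 : Tendsto (fun p : ℝ × State d₁ d₂ => fderiv ℝ (u t) p.2)
      (𝓝[Icc t₀ T ×ˢ univ] (t, z)) (𝓝 (fderiv ℝ (u t) z)) :=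
    ((((hu.contDiff t ht).continuous_fderiv one_ne_zero).comp continuous_snd).tendsto
      (t, z)).mono_left nhdsWithin_le_nhds
  have h2 : Tendsto (fun p : ℝ × State d₁ d₂ => fderiv ℝ (u p.1) p.2 - fderiv ℝ (u t) p.2)
      (𝓝[Icc t₀ T ×ˢ univ] (t, z)) (𝓝 0) := by
    have h3 : Continuous fun p : ℝ × State d₁ d₂ =>
        Q * Real.sqrt |p.1 - t| * (1 + ‖p.2.1‖ + ‖p.2.2‖) := by fun_prop
    have h4 := (h3.tendsto (t, z)).mono_left (nhdsWithin_le_nhds (s := Icc t₀ T ×ˢ univ))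
    simp only [sub_self, abs_zero, Real.sqrt_zero, mul_zero, zero_mul] at h4
    refine squeeze_zero_norm' ?_ h4
    filter_upwards [self_mem_nhdsWithin] with p hp
    have h5 := (hQ t ht p.1 hp.1 p.2).2
    rwa [fderiv_fun_sub (hd p.1 hp.1 p.2) (hd t ht p.2)] at h5
  have h6 := h2.add h1
  simp only [sub_add_cancel, zero_add] at h6
  exact h6

/-- Uniqueness for the transport equation driven by a control. -/
theorem eq_of_isTransportSolution (hκ : IsGoodControl κ t₀ T) (hb : HasFieldBounds b C)
    (hν : ∀ᵐ t ∂(volume.restrict (Icc t₀ T)), ν t = κ t) {u : ℝ → State d₁ d₂ → ℝ}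
    (hu : IsTransportSolution b L t₀ T ν u) (h0T : t₀ ≤ T) :
    ∀ t ∈ Icc t₀ T, u t = pull (ctrlField b κ) L T t := by
  have hF := hκ.isSmoothField (d₂ := d₂) hb
  have hd : ∀ s ∈ Icc t₀ T, Differentiable ℝ (u s) := fun s hs =>
    (hu.contDiff s hs).differentiable one_ne_zero
  have hcont := continuousOn_fderiv_of_holder hu
  have heq : ∀ t ∈ Icc t₀ T, ∀ z, u t z = L z +
      ∫ s in Ioc t T, fderiv ℝ (u s) z (ctrlField b κ s z) := fun t ht z => by
    rw [hu.equation t ht z, integral_inner_gradX_eq hν hd ht]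
  refine hF.eq_pull_of_transport hu.contDiff hcont (fun s hs t ht hst z => ?_) ?_
  · have hc : ContinuousOn (fun r => fderiv ℝ (u r) z) (Icc t₀ T) :=
      hcont.comp (by fun_prop : ContinuousOn (fun r : ℝ => (r, z)) _) fun r hr => ⟨hr, mem_univ _⟩
    obtain ⟨B, hB⟩ := isCompact_Icc.exists_bound_of_continuousOn hc
    have hint : IntegrableOn (fun r => fderiv ℝ (u r) z (ctrlField b κ r z)) (Icc t₀ T) := by
      refine Integrable.mono' ((hF.integrable.integrableOn (s := Icc t₀ T)).const_mul B)
        (aestronglyMeasurable_apply (hc.aestronglyMeasurable measurableSet_Icc)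
          (hF.meas z).aestronglyMeasurable) ?_
      filter_upwards [ae_restrict_mem measurableSet_Icc] with r hr
      refine (ContinuousLinearMap.le_opNorm _ _).trans ?_
      exact mul_le_mul (hB r hr) (hF.bound r z) (norm_nonneg _) ((norm_nonneg _).trans (hB r hr))
    rw [heq t ht, heq s hs, ← Ioc_union_Ioc_eq_Ioc hst ht.2, setIntegral_union
      (Ioc_disjoint_Ioc_of_le le_rfl) measurableSet_Ioc]
    · ring
    · exact hint.mono_set (Ioc_subset_Icc_self.trans (Icc_subset_Icc hs.1 ht.2))
    · exact hint.mono_set (Ioc_subset_Icc_self.trans (Icc_subset_Icc ht.1 le_rfl))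
  · ext z
    rw [heq T ⟨h0T, le_rfl⟩]
    simp

end IsGoodControl

/-! ### Gibbs measures relative to the prior -/

section Gibbs

open ProbabilityTheory InformationTheory

variable {m : ℕ} {ℓ : Vec m → ℝ} {c C B : ℝ}

theorem prior_tilted_eq_withDensity (hint : Integrable fun a => Real.exp (-ℓ a))
    (f : Vec m → ℝ) : (prior ℓ).tilted f = volume.withDensity fun a =>
      ENNReal.ofReal (Real.exp (-ℓ a + f a) / ∫ a, Real.exp (-ℓ a + f a)) := by
  rw [prior_eq_tilted, tilted_tilted hint]
  rfl

/-- Tilting the prior by a potential of linear growth changes the fourth moment and the entropy by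
an amount that only depends on the growth constant. -/
theorem exists_gibbs_bounds (hc : Continuous ℓ) (hc0 : 0 < c) (hℓ : ∀ a, c * ‖a‖ ^ 4 - C ≤ ℓ a)
    (hB : 0 ≤ B) : ∃ M₁ M₂ : ℝ, ∀ f : Vec m → ℝ, Continuous f → (∀ a, |f a| ≤ B * (1 + ‖a‖)) →
      Integrable (fun a => Real.exp (f a)) (prior ℓ) ∧
      Integrable (fun a => ‖a‖ ^ 4) ((prior ℓ).tilted f) ∧
      ∫ a, ‖a‖ ^ 4 ∂((prior ℓ).tilted f) ≤ M₁ ∧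
      klDiv ((prior ℓ).tilted f) (prior ℓ) ≤ ENNReal.ofReal M₂ := by
  have hpr := isProbabilityMeasure_prior hc hc0 hℓ
  have hlin : Continuous fun a : Vec m => B * (1 + ‖a‖) := by fun_prop
  have hquart : Continuous fun a : Vec m => B * (1 + ‖a‖) + c / 4 * ‖a‖ ^ 4 := by fun_prop
  have hi0 : Integrable (fun a => Real.exp (-(B * (1 + ‖a‖)))) (prior ℓ) :=
    integrable_exp_prior hc hc0 hℓ hlin.neg (B := B) fun a => by
      have : 0 ≤ B * (1 + ‖a‖) := by positivity
      have : 0 ≤ c / 2 * ‖a‖ ^ 4 := by positivity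
      linarith
  have hi4 : Integrable (fun a => Real.exp (B * (1 + ‖a‖) + c / 4 * ‖a‖ ^ 4)) (prior ℓ) :=
    integrable_exp_prior hc hc0 hℓ hquart (B := B) fun a => by
      have : 0 ≤ ‖a‖ ^ 4 := by positivity
      nlinarith
  -- `Z₀` is a lower bound for the partition functions and `N` an upper bound for the unnormalized
  -- fourth moments, both uniform in `f`
  set Z₀ := ∫ a, Real.exp (-(B * (1 + ‖a‖))) ∂(prior ℓ) with hZ₀
  set N := ∫ a, 4 / c * Real.exp (B * (1 + ‖a‖) + c / 4 * ‖a‖ ^ 4) ∂(prior ℓ) with hN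
  have hZ₀pos : 0 < Z₀ := integral_exp_pos hi0
  refine ⟨N / Z₀, B * (2 + N / Z₀) - Real.log Z₀, fun f hf hfB => ?_⟩
  have hif : Integrable (fun a => Real.exp (f a)) (prior ℓ) :=
    integrable_exp_prior hc hc0 hℓ hf (B := B) fun a => by
      have := (abs_le.mp (hfB a)).2
      have : 0 ≤ c / 2 * ‖a‖ ^ 4 := by positivity
      linarith
  set Z := ∫ a, Real.exp (f a) ∂(prior ℓ) with hZ
  have hZle : Z₀ ≤ Z := integral_mono hi0 hif fun a =>
    Real.exp_le_exp.mpr (abs_le.mp (hfB a)).1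
  have hZpos : 0 < Z := hZ₀pos.trans_le hZle
  have hgp : IsProbabilityMeasure ((prior ℓ).tilted f) := isProbabilityMeasure_tilted hif
  -- the fourth power is absorbed by a small multiple of the quartic confinement
  have hpt : ∀ a : Vec m, Real.exp (f a) * ‖a‖ ^ 4 ≤
      4 / c * Real.exp (B * (1 + ‖a‖) + c / 4 * ‖a‖ ^ 4) := fun a => by
    have h1 : c / 4 * ‖a‖ ^ 4 ≤ Real.exp (c / 4 * ‖a‖ ^ 4) := by
      linarith [Real.add_one_le_exp (c / 4 * ‖a‖ ^ 4)]
    have h2 : Real.exp (f a) ≤ Real.exp (B * (1 + ‖a‖)) :=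
      Real.exp_le_exp.mpr (abs_le.mp (hfB a)).2
    rw [Real.exp_add]
    calc Real.exp (f a) * ‖a‖ ^ 4 = 4 / c * (Real.exp (f a) * (c / 4 * ‖a‖ ^ 4)) := by
          field_simp
      _ ≤ _ := by gcongr
  have hi4' : Integrable (fun a => Real.exp (f a) * ‖a‖ ^ 4) (prior ℓ) := by
    refine (hi4.const_mul (4 / c)).mono' (by fun_prop : Continuous _).aestronglyMeasurable
      (ae_of_all _ fun a => ?_)
    rw [Real.norm_of_nonneg (by positivity)]
    exact hpt a
  have hmom : Integrable (fun a => ‖a‖ ^ 4) ((prior ℓ).tilted f) := by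
    rw [integrable_tilted_iff]
    · simpa only [smul_eq_mul] using hi4'
    · exact hif
  have hmomle : ∫ a, ‖a‖ ^ 4 ∂((prior ℓ).tilted f) ≤ N / Z₀ := by
    rw [integral_tilted]
    have h1 : ∀ a : Vec m, (Real.exp (f a) / Z) • ‖a‖ ^ 4 = (Real.exp (f a) * ‖a‖ ^ 4) / Z :=
      fun a => by
        rw [smul_eq_mul]
        ring
    simp only [← hZ, h1]
    rw [integral_div]
    have h2 : ∫ a, Real.exp (f a) * ‖a‖ ^ 4 ∂(prior ℓ) ≤ N :=
      integral_mono hi4' (hi4.const_mul _) hpt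
    have h3 : 0 ≤ ∫ a, Real.exp (f a) * ‖a‖ ^ 4 ∂(prior ℓ) := integral_nonneg fun a => by positivity
    exact div_le_div₀ (h3.trans h2) h2 hZ₀pos hZle
  refine ⟨hif, hmom, hmomle, ?_⟩
  have hg : Integrable (fun a : Vec m => B * (2 + ‖a‖ ^ 4)) ((prior ℓ).tilted f) :=
    ((integrable_const 2).add hmom).const_mul B
  have hfle : ∀ a, |f a| ≤ B * (2 + ‖a‖ ^ 4) := fun a => by
    refine (hfB a).trans (mul_le_mul_of_nonneg_left ?_ hB)
    have := norm_pow_le_one_add_pow_four (k := 1) (by norm_num) a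
    rw [pow_one] at this
    linarith
  have hfi : Integrable f ((prior ℓ).tilted f) :=
    hg.mono' hf.aestronglyMeasurable (ae_of_all _ hfle)
  obtain ⟨hne, hkl⟩ := klDiv_tilted_left hif hfi
  rw [← ENNReal.ofReal_toReal hne, hkl]
  refine ENNReal.ofReal_le_ofReal ?_
  have h4 : ∫ a, f a ∂((prior ℓ).tilted f) ≤ B * (2 + N / Z₀) := by
    calc _ ≤ ∫ a, B * (2 + ‖a‖ ^ 4) ∂((prior ℓ).tilted f) :=
          integral_mono hfi hg fun a => (le_abs_self _).trans (hfle a)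
      _ = B * (2 + ∫ a, ‖a‖ ^ 4 ∂((prior ℓ).tilted f)) := by
          rw [integral_const_mul, integral_add (integrable_const _) hmom]
          simp
      _ ≤ _ := by gcongr
  have h5 := Real.log_le_log hZ₀pos hZle
  linarith

theorem integrable_exp_neg_add_of_linear (hc : Continuous ℓ) (hc0 : 0 < c)
    (hℓ : ∀ a, c * ‖a‖ ^ 4 - C ≤ ℓ a) {f : Vec m → ℝ} (hf : Continuous f)
    (hfB : ∀ a, |f a| ≤ B * (1 + ‖a‖)) : Integrable fun a => Real.exp (-ℓ a + f a) :=
  integrable_exp_neg_add hc hc0 hℓ hf (B := B) fun a => by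
    have := (abs_le.mp (hfB a)).2
    have : 0 ≤ c / 2 * ‖a‖ ^ 4 := by positivity
    linarith

/-- The partition function of a continuous family of potentials is continuous. -/
theorem continuous_partition (hc : Continuous ℓ) (hc0 : 0 < c) (hℓ : ∀ a, c * ‖a‖ ^ 4 - C ≤ ℓ a)
    {f : ℝ → Vec m → ℝ} (hf : Continuous fun p : ℝ × Vec m => f p.1 p.2)
    (hfB : ∀ t a, |f t a| ≤ B * (1 + ‖a‖)) :
    Continuous fun t => ∫ a, Real.exp (-ℓ a + f t a) := by
  have hB : 0 ≤ B := by
    have h1 := (abs_nonneg _).trans (hfB 0 0)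
    simpa using h1
  refine continuous_of_dominated (bound := fun a => Real.exp (-ℓ a + B * (1 + ‖a‖)))
    (fun t => ?_) (fun t => ae_of_all _ fun a => ?_)
    (integrable_exp_neg_add_of_linear (B := B) hc hc0 hℓ (by fun_prop) fun a => ?_)
    (ae_of_all _ fun a => ?_)
  · have : Continuous fun a => f t a := hf.comp (Continuous.prodMk_right t)
    exact (by fun_prop : Continuous fun a => Real.exp (-ℓ a + f t a)).aestronglyMeasurable
  · rw [Real.norm_of_nonneg (Real.exp_pos _).le]
    exact Real.exp_le_exp.mpr (by linarith [(abs_le.mp (hfB t a)).2])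
  · exact (abs_of_nonneg (by positivity)).le
  · have : Continuous fun t => f t a := hf.comp (Continuous.prodMk_left a)
    fun_prop

/-- A jointly continuous family of potentials of linear growth defines a control made of Gibbs
measures, with bounded entropy. -/
theorem exists_gibbs_control (hc : Continuous ℓ) (hc0 : 0 < c) (hℓ : ∀ a, c * ‖a‖ ^ 4 - C ≤ ℓ a)
    {f : ℝ → Vec m → ℝ} (hf : Continuous fun p : ℝ × Vec m => f p.1 p.2)
    (hfB : ∀ t a, |f t a| ≤ B * (1 + ‖a‖)) (t₀ T : ℝ) :
    ∃ g : Kernel ℝ (Vec m), IsGoodControl g t₀ T ∧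
      (∀ t ∈ Icc t₀ T, g t = (prior ℓ).tilted (f t)) ∧
      ∫⁻ t in Icc t₀ T, klDiv (g t) (prior ℓ) < ⊤ := by
  have hpr := isProbabilityMeasure_prior hc hc0 hℓ
  have hB : 0 ≤ B := by
    have h1 := (abs_nonneg _).trans (hfB 0 0)
    simpa using h1
  obtain ⟨M₁, M₂, hM⟩ := exists_gibbs_bounds (m := m) hc hc0 hℓ hB
  have hft : ∀ t, Continuous (f t) := fun t => hf.comp (Continuous.prodMk_right t)
  have hden : ∀ t, (prior ℓ).tilted (f t) = volume.withDensity fun a =>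
      ENNReal.ofReal (Real.exp (-ℓ a + f t a) / ∫ a, Real.exp (-ℓ a + f t a)) := fun t =>
    prior_tilted_eq_withDensity (integrable_exp_neg hc hc0 hℓ) (f t)
  have hmeas : Measurable fun t => (prior ℓ).tilted (f t) := by
    have hm : Measurable fun p : ℝ × Vec m => ENNReal.ofReal
        (Real.exp (-ℓ p.2 + f p.1 p.2) / ∫ a, Real.exp (-ℓ a + f p.1 a)) := by
      refine ENNReal.measurable_ofReal.comp (Measurable.div ?_ ?_)
      · exact (by fun_prop : Continuous _).measurable
      · exact ((continuous_partition hc hc0 hℓ hf hfB).comp continuous_fst).measurable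
    refine Measure.measurable_of_measurable_coe _ fun s hs => ?_
    simp only [hden, withDensity_apply _ hs]
    exact hm.lintegral_prod_right' (ν := volume.restrict s)
  have hmark : ∀ t, IsProbabilityMeasure ((prior ℓ).tilted (f t)) := fun t =>
    isProbabilityMeasure_tilted (hM (f t) (hft t) (hfB t)).1
  classical
  set g : Kernel ℝ (Vec m) := Kernel.piecewise (measurableSet_Icc (a := t₀) (b := T))
    ⟨fun t => (prior ℓ).tilted (f t), hmeas⟩ (Kernel.const ℝ (Measure.dirac 0)) with hg
  have hin : ∀ t ∈ Icc t₀ T, g t = (prior ℓ).tilted (f t) := fun t ht => by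
    rw [hg, Kernel.piecewise_apply, if_pos ht]
    rfl
  have hout : ∀ t ∉ Icc t₀ T, g t = Measure.dirac 0 := fun t ht => by
    rw [hg, Kernel.piecewise_apply, if_neg ht, Kernel.const_apply]
  have hprob : ∀ t, IsProbabilityMeasure (g t) := fun t => by
    by_cases ht : t ∈ Icc t₀ T
    · rw [hin t ht]
      exact hmark t
    · rw [hout t ht]
      infer_instance
  have : IsMarkovKernel g := ⟨hprob⟩
  refine ⟨g, ⟨hprob, hout, fun t => ?_, ?_⟩, hin, ?_⟩
  · by_cases ht : t ∈ Icc t₀ T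
    · rw [hin t ht]
      exact (hM (f t) (hft t) (hfB t)).2.1
    · rw [hout t ht]
      exact integrable_dirac (by finiteness)
  · have hsm : StronglyMeasurable fun t => ∫ a, ‖a‖ ^ 4 ∂(g t) :=
      StronglyMeasurable.integral_kernel_prod_right (κ := g) (f := fun _ a => ‖a‖ ^ 4)
        (by fun_prop : Continuous fun p : ℝ × Vec m => ‖p.2‖ ^ 4).stronglyMeasurable
    have hi : Integrable ((Icc t₀ T).indicator fun _ => M₁) :=
      (integrable_indicator_iff measurableSet_Icc).mpr
        (integrableOn_const measure_Icc_lt_top.ne)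
    refine hi.mono' hsm.aestronglyMeasurable (ae_of_all _ fun t => ?_)
    rw [Real.norm_of_nonneg (integral_nonneg fun a => by positivity)]
    by_cases ht : t ∈ Icc t₀ T
    · rw [hin t ht, indicator_of_mem ht]
      exact (hM (f t) (hft t) (hfB t)).2.2.1
    · rw [hout t ht, indicator_of_notMem ht, integral_dirac]
      simp
  · calc _ ≤ ∫⁻ _ in Icc t₀ T, ENNReal.ofReal M₂ := by
          refine setLIntegral_mono' measurableSet_Icc fun t ht => ?_
          rw [hin t ht]
          exact (hM (f t) (hft t) (hfB t)).2.2.2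
      _ < ⊤ := by
          rw [setLIntegral_const]
          exact ENNReal.mul_lt_top ENNReal.ofReal_lt_top measure_Icc_lt_top

end Gibbs

/-! ### First variation of the terminal cost -/

namespace IsSmoothField

variable {E : Type*} [NormedAddCommGroup E] [NormedSpace ℝ E] [FiniteDimensional ℝ E]
  [MeasurableSpace E] [BorelSpace E] {F G : ℝ → E → E} {Λ Λ₂ M M₂ : ℝ → ℝ} {φ : E → ℝ} {K K₁ : ℝ}

theorem exists_norm_fderiv_pull_le (hF : IsSmoothField F Λ Λ₂) (hφ : HasTameGradient φ K K₁)
    (T : ℝ) : ∃ B, 0 ≤ B ∧ ∀ t z, ‖fderiv ℝ (pull F φ T t) z‖ ≤ B * (1 + ‖z‖) := by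
  obtain ⟨C, hC, h⟩ := hF.exists_tame_pull hφ T
  have hK := hφ.nonneg
  have hK₁ := hφ.nonneg₁
  refine ⟨C * (K + K₁), by positivity, fun t z => ((h t).bound z).trans ?_⟩
  have h1 : C * K₁ * ‖z‖ ≤ C * (K + K₁) * ‖z‖ := by
    gcongr
    linarith
  linarith

/-- Perturbing the field `F` to `F + δ (G - F)` changes the mean terminal cost at first order by the
integral along the unperturbed flow of the derivative of the value `pull F φ` in the direction
`G - F`. -/
theorem tendsto_variation (hF : IsSmoothField F Λ Λ₂) (hG : IsSmoothField G M M₂)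
    (hφ : HasTameGradient φ K K₁) {μ : Measure E} [IsProbabilityMeasure μ]
    (hμ : Integrable (fun z => ‖z‖) μ) {a b : ℝ} (hab : a ≤ b) {δ : ℕ → ℝ} (hδ0 : ∀ n, 0 < δ n)
    (hδ1 : ∀ n, δ n ≤ 1) (hδ : Tendsto δ atTop (𝓝 0)) {Fs : ℕ → ℝ → E → E} {Λs Λs₂ : ℕ → ℝ → ℝ}
    (hFs : ∀ n, IsSmoothField (Fs n) (Λs n) (Λs₂ n))
    (hFs_eq : ∀ n t z, Fs n t z = F t z + δ n • (G t z - F t z)) :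
    Tendsto (fun n => (δ n)⁻¹ * ∫ z, (φ (flow (Fs n) a b z) - φ (flow F a b z)) ∂μ) atTop
      (𝓝 (∫ r in Ioc a b, ∫ z, fderiv ℝ (pull F φ b r) (flow F a r z)
        (G r (flow F a r z) - F r (flow F a r z)) ∂μ)) := by
  obtain ⟨B, hB0, hB⟩ := hF.exists_norm_fderiv_pull_le hφ b
  obtain ⟨_, _, htame⟩ := hF.exists_tame_pull hφ b
  have hDc := hF.continuous_fderiv_pull hφ b
  set S := ∫ r in Ioc a b, (Λ r + M r) with hS
  have hΛM : ∀ r, 0 ≤ Λ r + M r := fun r => add_nonneg (hF.nonneg r) (hG.nonneg r)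
  have hS0 : 0 ≤ S := integral_nonneg hΛM
  have hGF : ∀ r z, ‖G r z - F r z‖ ≤ Λ r + M r := fun r z => by
    have := norm_sub_le (G r z) (F r z)
    linarith [hG.bound r z, hF.bound r z]
  -- the perturbed trajectories are close to the unperturbed ones
  have hclose : ∀ n z, ∀ t ∈ Icc a b,
      ‖flow (Fs n) a t z - flow F a t z‖ ≤ gron Λ * (δ n * S) := by
    intro n z t ht
    have h1 := hF.norm_sub_flow_le (s := a) (T := b) (z := z) (z' := z)
      (Y := fun t => flow (Fs n) a t z) (G := fun r => Fs n r (flow (Fs n) a r z))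
      (e := fun r => δ n * (Λ r + M r)) ((hFs n).continuous_flow_time a z).continuousOn
      ((hFs n).integrable_flow a z).integrableOn
      ((hF.integrable.add hG.integrable).const_mul (δ n)).integrableOn
      (fun r _ => mul_nonneg (hδ0 n).le (hΛM r)) (fun t _ => (hFs n).flow_eq a t z)
      (fun r _ => ?_) t ht
    · rwa [sub_self, norm_zero, zero_add, integral_const_mul] at h1
    · rw [hFs_eq, add_sub_cancel_left, norm_smul, Real.norm_of_nonneg (hδ0 n).le]
      exact mul_le_mul_of_nonneg_left (hGF _ _) (hδ0 n).le
  set R := (∫ r, Λ r) + gron Λ * S with hR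
  have hR0 : 0 ≤ R := add_nonneg (integral_nonneg hF.nonneg) (mul_nonneg hF.gron_nonneg hS0)
  have hbd : ∀ n z, ∀ t ∈ Icc a b, ‖flow (Fs n) a t z‖ ≤ ‖z‖ + R := by
    intro n z t ht
    have h1 := hclose n z t ht
    have h2 := hF.norm_flow_le a t z
    have h3 := norm_le_norm_add_norm_sub (flow F a t z) (flow (Fs n) a t z)
    have h4 : gron Λ * (δ n * S) ≤ gron Λ * S := mul_le_mul_of_nonneg_left
      (mul_le_of_le_one_left hS0 (hδ1 n)) hF.gron_nonneg
    rw [norm_sub_rev] at h3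
    linarith
  -- the integrand along an arbitrary jointly continuous family of trajectories
  set k : (ℝ → E → E) → ℝ × E → ℝ := fun Y p =>
    fderiv ℝ (pull F φ b p.1) (Y p.1 p.2) (G p.1 (Y p.1 p.2) - F p.1 (Y p.1 p.2)) with hk
  have hkm : ∀ Y : ℝ → E → E, Continuous (fun p : ℝ × E => Y p.1 p.2) →
      StronglyMeasurable (k Y) := by
    intro Y hY
    have h1 : Measurable fun p : ℝ × E => (p.1, Y p.1 p.2) := (continuous_fst.prodMk hY).measurable
    have h2 : StronglyMeasurable fun p : ℝ × E => fderiv ℝ (pull F φ b p.1) (Y p.1 p.2) :=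
      (hDc.comp (continuous_fst.prodMk hY)).stronglyMeasurable
    have h3 : StronglyMeasurable fun p : ℝ × E => G p.1 (Y p.1 p.2) - F p.1 (Y p.1 p.2) :=
      (hG.stronglyMeasurable_uncurry.comp_measurable h1).sub
        (hF.stronglyMeasurable_uncurry.comp_measurable h1)
    exact isBoundedBilinearMap_apply.continuous.comp_stronglyMeasurable (h2.prodMk h3)
  set g : ℝ × E → ℝ := fun p => (Λ p.1 + M p.1) * (B * (1 + (‖p.2‖ + R))) with hg
  have hgi : Integrable g ((volume.restrict (Ioc a b)).prod μ) :=
    Integrable.mul_prod (f := fun r => Λ r + M r) (g := fun z : E => B * (1 + (‖z‖ + R)))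
      (hF.integrable.add hG.integrable).integrableOn
      (((integrable_const 1).add (hμ.add (integrable_const R))).const_mul B)
  have hkb : ∀ Y : ℝ → E → E, (∀ z, ∀ t ∈ Icc a b, ‖Y t z‖ ≤ ‖z‖ + R) →
      ∀ᵐ p ∂((volume.restrict (Ioc a b)).prod μ), ‖k Y p‖ ≤ g p := by
    intro Y hY
    have h1 : ∀ᵐ p ∂((volume.restrict (Ioc a b)).prod μ), p.1 ∈ Ioc a b :=
      Measure.quasiMeasurePreserving_fst.ae (ae_restrict_mem measurableSet_Ioc)
    filter_upwards [h1] with p hp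
    refine (ContinuousLinearMap.le_opNorm _ _).trans ?_
    rw [hg, mul_comm]
    refine mul_le_mul (hGF _ _) ((hB _ _).trans ?_) (norm_nonneg _) (hΛM _)
    have := hY p.2 p.1 (Ioc_subset_Icc_self hp)
    gcongr
  have hYc : ∀ n, Continuous fun p : ℝ × E => flow (Fs n) a p.1 p.2 := fun n =>
    (hFs n).continuous_flow a
  have hXb : ∀ z, ∀ t ∈ Icc a b, ‖flow F a t z‖ ≤ ‖z‖ + R := fun z t _ => by
    have := hF.norm_flow_le a t z
    have := mul_nonneg hF.gron_nonneg hS0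
    linarith
  have hki : ∀ n, Integrable (k (flow (Fs n) a)) ((volume.restrict (Ioc a b)).prod μ) := fun n =>
    hgi.mono' (hkm _ (hYc n)).aestronglyMeasurable (hkb _ (hbd n))
  have hki0 : Integrable (k (flow F a)) ((volume.restrict (Ioc a b)).prod μ) :=
    hgi.mono' (hkm _ (hF.continuous_flow a)).aestronglyMeasurable (hkb _ hXb)
  have hlim : Tendsto (fun n => ∫ p, k (flow (Fs n) a) p ∂((volume.restrict (Ioc a b)).prod μ))
      atTop (𝓝 (∫ p, k (flow F a) p ∂((volume.restrict (Ioc a b)).prod μ))) := by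
    refine tendsto_integral_of_dominated_convergence g
      (fun n => (hki n).aestronglyMeasurable) hgi (fun n => hkb _ (hbd n)) ?_
    have h1 : ∀ᵐ p ∂((volume.restrict (Ioc a b)).prod μ), p.1 ∈ Ioc a b :=
      Measure.quasiMeasurePreserving_fst.ae (ae_restrict_mem measurableSet_Ioc)
    filter_upwards [h1] with p hp
    have hY : Tendsto (fun n => flow (Fs n) a p.1 p.2) atTop (𝓝 (flow F a p.1 p.2)) := by
      refine tendsto_iff_norm_sub_tendsto_zero.mpr (squeeze_zero (fun n => norm_nonneg _)
        (fun n => hclose n p.2 p.1 (Ioc_subset_Icc_self hp)) ?_)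
      simpa using (hδ.mul_const S).const_mul (gron Λ)
    refine tendsto_apply ?_ (((hG.caratheodory.continuous p.1).tendsto _ |>.comp hY).sub
      ((hF.caratheodory.continuous p.1).tendsto _ |>.comp hY))
    have h2 : Continuous fun z => fderiv ℝ (pull F φ b p.1) z :=
      hDc.comp (Continuous.prodMk_right p.1)
    exact (h2.tendsto _).comp hY
  rw [integral_prod _ hki0] at hlim
  refine hlim.congr fun n => ?_
  rw [integral_prod_symm _ (hki n), ← integral_const_mul]
  refine integral_congr_ae (ae_of_all _ fun z => ?_)
  -- the value along the perturbed trajectory changes by the mismatch of the fields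
  have h1 := hF.transport_along_curve hab (w := pull F φ b) (fun t _ => (htame t).contDiff)
    hDc.continuousOn (fun s _ t ht hst z => hF.pull_sub_pull hφ hst ht.2 z)
    (Y := fun t => flow (Fs n) a t z) (G := fun r => Fs n r (flow (Fs n) a r z))
    ((hFs n).integrable_flow a z).integrableOn
    (fun t _ => by
      rw [(hFs n).flow_of_le le_rfl]
      exact (hFs n).flow_eq a t z)
  rw [hF.pull_of_le φ le_rfl, (hFs n).flow_of_le le_rfl] at h1
  have h2 : pull F φ b a z = φ (flow F a b z) := rfl
  rw [h2] at h1
  beta_reduce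
  rw [h1]
  simp only [hFs_eq, add_sub_cancel_left, map_smul, smul_eq_mul]
  rw [integral_const_mul, ← mul_assoc, inv_mul_cancel₀ (hδ0 n).ne', one_mul]

end IsSmoothField

/-! ### The potential of the Gibbs measure -/

open ProbabilityTheory

variable {d₁ d₂ m : ℕ}

/-- The potential `a ↦ ∫ b(x,a) · ∇_x u(x,y) dγ(x,y)` that appears in the Gibbs weight. -/
noncomputable def pairing (b : Vec d₁ → Vec m → Vec d₁) (u : State d₁ d₂ → ℝ)
    (γ : Measure (State d₁ d₂)) (a : Vec m) : ℝ := ∫ z, inner ℝ (b z.1 a) (gradX u z) ∂γ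

/-- The state at time `t` of the control `κ`, started from `γ₀` at time `t₀`. -/
noncomputable def stateOf (b : Vec d₁ → Vec m → Vec d₁) (κ : Kernel ℝ (Vec m)) (t₀ : ℝ)
    (γ₀ : Measure (State d₁ d₂)) (t : ℝ) : Measure (State d₁ d₂) :=
  γ₀.map (flow (ctrlField b κ) t₀ t)

theorem norm_prodMk_zero (v : Vec d₁) : ‖((v, 0) : State d₁ d₂)‖ = ‖v‖ := by
  simp [Prod.norm_def]

namespace IsGoodControl

variable {κ g : Kernel ℝ (Vec m)} {t₀ T C K K₁ : ℝ} {b : Vec d₁ → Vec m → Vec d₁}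
  {L : State d₁ d₂ → ℝ} {γ₀ : Measure (State d₁ d₂)}

/-- The integrand of the potential along the flow is jointly continuous, and grows at most linearly
in the parameter and in the initial state. -/
theorem continuous_potential_integrand (hκ : IsGoodControl κ t₀ T) (hb : HasFieldBounds b C)
    (hL : HasTameGradient L K K₁) :
    Continuous fun p : (ℝ × Vec m) × State d₁ d₂ =>
      fderiv ℝ (pull (ctrlField b κ) L T p.1.1) (flow (ctrlField b κ) t₀ p.1.1 p.2)
        (b (flow (ctrlField b κ) t₀ p.1.1 p.2).1 p.1.2, 0) := by
  have hF := hκ.isSmoothField (d₂ := d₂) hb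
  have h1 : Continuous fun p : (ℝ × Vec m) × State d₁ d₂ =>
      flow (ctrlField b κ) t₀ p.1.1 p.2 := (hF.continuous_flow t₀).comp
    ((continuous_fst.comp continuous_fst).prodMk continuous_snd)
  have h2 : Continuous fun p : (ℝ × Vec m) × State d₁ d₂ =>
      fderiv ℝ (pull (ctrlField b κ) L T p.1.1) (flow (ctrlField b κ) t₀ p.1.1 p.2) :=
    (hF.continuous_fderiv_pull hL T).comp ((continuous_fst.comp continuous_fst).prodMk h1)
  have h3 : Continuous fun p : (ℝ × Vec m) × State d₁ d₂ =>
      b (flow (ctrlField b κ) t₀ p.1.1 p.2).1 p.1.2 :=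
    hb.cont.comp ((continuous_fst.comp h1).prodMk (continuous_snd.comp continuous_fst))
  exact h2.clm_apply (h3.prodMk continuous_const)

theorem exists_potential_integrand_bound (hκ : IsGoodControl κ t₀ T) (hb : HasFieldBounds b C)
    (hL : HasTameGradient L K K₁) :
    ∃ D, 0 ≤ D ∧ ∀ t a (z : State d₁ d₂),
      ‖fderiv ℝ (pull (ctrlField b κ) L T t) (flow (ctrlField b κ) t₀ t z)
        (b (flow (ctrlField b κ) t₀ t z).1 a, 0)‖ ≤ D * (1 + ‖a‖) * (1 + ‖z‖) := by
  have hF := hκ.isSmoothField (d₂ := d₂) hb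
  obtain ⟨B, hB0, hB⟩ := hF.exists_norm_fderiv_pull_le hL T
  set Q := ∫ r, ctrlBound C t₀ T κ r
  have hQ : 0 ≤ Q := integral_nonneg hF.nonneg
  have hC := hb.nonneg
  refine ⟨B * (1 + Q) * C, by positivity, fun t a z => ?_⟩
  refine (ContinuousLinearMap.le_opNorm _ _).trans ?_
  rw [norm_prodMk_zero]
  have h1 : ‖flow (ctrlField b κ) t₀ t z‖ ≤ ‖z‖ + Q := hF.norm_flow_le t₀ t z
  have h2 : 0 ≤ Q * ‖z‖ := by positivity
  calc _ ≤ B * (1 + ‖flow (ctrlField b κ) t₀ t z‖) * (C * (1 + ‖a‖)) := by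
        gcongr
        · exact hB _ _
        · exact hb.bound _ _
    _ ≤ B * ((1 + Q) * (1 + ‖z‖)) * (C * (1 + ‖a‖)) := by
        gcongr
        linarith
    _ = _ := by ring

theorem inner_gradX_pull (hκ : IsGoodControl κ t₀ T) (hb : HasFieldBounds b C)
    (hL : HasTameGradient L K K₁) (t : ℝ) (q : State d₁ d₂) (v : Vec d₁) :
    inner ℝ v (gradX (pull (ctrlField b κ) L T t) q) =
      fderiv ℝ (pull (ctrlField b κ) L T t) q (v, 0) := by
  obtain ⟨_, _, h⟩ := (hκ.isSmoothField (d₂ := d₂) hb).exists_tame_pull hL T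
  exact inner_gradX ((h t).diff q) v

theorem continuous_inner_gradX_pull (hκ : IsGoodControl κ t₀ T) (hb : HasFieldBounds b C)
    (hL : HasTameGradient L K K₁) (t : ℝ) (a : Vec m) :
    Continuous fun q => inner ℝ (b q.1 a) (gradX (pull (ctrlField b κ) L T t) q) := by
  have hF := hκ.isSmoothField (d₂ := d₂) hb
  simp only [hκ.inner_gradX_pull hb hL]
  have h2 : Continuous fun q => fderiv ℝ (pull (ctrlField b κ) L T t) q :=
    (hF.continuous_fderiv_pull hL T).comp (Continuous.prodMk_right t)
  have h3 : Continuous fun q : State d₁ d₂ => b q.1 a :=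
    hb.cont.comp (continuous_fst.prodMk continuous_const)
  exact h2.clm_apply (h3.prodMk continuous_const)

theorem pairing_eq (hκ : IsGoodControl κ t₀ T) (hb : HasFieldBounds b C)
    (hL : HasTameGradient L K K₁) (t : ℝ) (a : Vec m) :
    pairing b (pull (ctrlField b κ) L T t) (stateOf b κ t₀ γ₀ t) a =
      ∫ z, fderiv ℝ (pull (ctrlField b κ) L T t) (flow (ctrlField b κ) t₀ t z)
        (b (flow (ctrlField b κ) t₀ t z).1 a, 0) ∂γ₀ := by
  have hF := hκ.isSmoothField (d₂ := d₂) hb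
  rw [pairing, stateOf, integral_map (hF.measurable_flow t₀ t).aemeasurable
    (hκ.continuous_inner_gradX_pull hb hL t a).aestronglyMeasurable]
  simp only [hκ.inner_gradX_pull hb hL]

variable [IsProbabilityMeasure γ₀]

theorem integrable_potential_integrand (hκ : IsGoodControl κ t₀ T) (hb : HasFieldBounds b C)
    (hL : HasTameGradient L K K₁) (hγ₀ : Integrable (fun z => ‖z‖) γ₀) (t : ℝ) (a : Vec m) :
    Integrable (fun z => fderiv ℝ (pull (ctrlField b κ) L T t) (flow (ctrlField b κ) t₀ t z)
        (b (flow (ctrlField b κ) t₀ t z).1 a, 0)) γ₀ := by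
  obtain ⟨D, hD0, hD⟩ := hκ.exists_potential_integrand_bound hb hL
  exact (((integrable_const 1).add hγ₀).const_mul (D * (1 + ‖a‖))).mono'
    ((hκ.continuous_potential_integrand hb hL).comp
      (Continuous.prodMk_right (t, a))).aestronglyMeasurable (ae_of_all _ fun z => hD t a z)

theorem integrable_inner_gradX (hκ : IsGoodControl κ t₀ T) (hb : HasFieldBounds b C)
    (hL : HasTameGradient L K K₁) (hγ₀ : Integrable (fun z => ‖z‖) γ₀) (t : ℝ) (a : Vec m) :
    Integrable (fun q => inner ℝ (b q.1 a) (gradX (pull (ctrlField b κ) L T t) q))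
      (stateOf b κ t₀ γ₀ t) := by
  have hF := hκ.isSmoothField (d₂ := d₂) hb
  rw [stateOf, integrable_map_measure
    (hκ.continuous_inner_gradX_pull hb hL t a).aestronglyMeasurable
    (hF.measurable_flow t₀ t).aemeasurable]
  refine (hκ.integrable_potential_integrand hb hL hγ₀ t a).congr (ae_of_all _ fun z => ?_)
  exact (hκ.inner_gradX_pull hb hL t _ _).symm

theorem exists_pairing_bound (hκ : IsGoodControl κ t₀ T) (hb : HasFieldBounds b C)
    (hL : HasTameGradient L K K₁) (hγ₀ : Integrable (fun z => ‖z‖) γ₀) :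
    ∃ B, 0 ≤ B ∧ ∀ t a,
      |pairing b (pull (ctrlField b κ) L T t) (stateOf b κ t₀ γ₀ t) a| ≤ B * (1 + ‖a‖) := by
  obtain ⟨D, hD0, hD⟩ := hκ.exists_potential_integrand_bound hb hL
  have h0 : 0 ≤ ∫ z, (1 + ‖z‖) ∂γ₀ := integral_nonneg fun z => by positivity
  refine ⟨D * ∫ z, (1 + ‖z‖) ∂γ₀, by positivity, fun t a => ?_⟩
  rw [hκ.pairing_eq hb hL]
  refine (norm_integral_le_of_norm_le
    (((integrable_const 1).add hγ₀).const_mul (D * (1 + ‖a‖)))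
    (ae_of_all _ fun z => hD t a z)).trans (le_of_eq ?_)
  rw [integral_const_mul]
  simp only [Pi.add_apply]
  ring

theorem continuous_pairing (hκ : IsGoodControl κ t₀ T) (hb : HasFieldBounds b C)
    (hL : HasTameGradient L K K₁) (hγ₀ : Integrable (fun z => ‖z‖) γ₀) :
    Continuous fun p : ℝ × Vec m =>
      pairing b (pull (ctrlField b κ) L T p.1) (stateOf b κ t₀ γ₀ p.1) p.2 := by
  obtain ⟨D, hD0, hD⟩ := hκ.exists_potential_integrand_bound hb hL
  have hc := hκ.continuous_potential_integrand hb hL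
  simp only [hκ.pairing_eq hb hL]
  refine continuous_iff_continuousAt.mpr fun p₀ => ?_
  refine continuousAt_of_dominated (bound := fun z => D * (2 + ‖p₀.2‖) * (1 + ‖z‖))
    (Eventually.of_forall fun p => (hc.comp (Continuous.prodMk_right p)).aestronglyMeasurable) ?_
    (((integrable_const 1).add hγ₀).const_mul _)
    (ae_of_all _ fun z => (hc.comp (Continuous.prodMk_left z)).continuousAt)
  have h1 : ∀ᶠ p : ℝ × Vec m in 𝓝 p₀, ‖p.2‖ < ‖p₀.2‖ + 1 :=
    (by fun_prop : Continuous fun p : ℝ × Vec m => ‖p.2‖).continuousAt.eventually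
      (gt_mem_nhds (by simp))
  filter_upwards [h1] with p hp
  refine ae_of_all _ fun z => (hD p.1 p.2 z).trans ?_
  exact mul_le_mul_of_nonneg_right (mul_le_mul_of_nonneg_left (by linarith) hD0) (by positivity)

/-- Averaging the potential over a control gives the mean of the derivative of the value along the
velocity field of that control. -/
theorem integral_fderiv_ctrlField (hκ : IsGoodControl κ t₀ T) (hg : IsGoodControl g t₀ T)
    (hb : HasFieldBounds b C) (hL : HasTameGradient L K K₁)
    (hγ₀ : Integrable (fun z => ‖z‖) γ₀) (t : ℝ) :
    Integrable (fun z => fderiv ℝ (pull (ctrlField b κ) L T t) (flow (ctrlField b κ) t₀ t z)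
      (ctrlField b g t (flow (ctrlField b κ) t₀ t z))) γ₀ ∧
    ∫ z, fderiv ℝ (pull (ctrlField b κ) L T t) (flow (ctrlField b κ) t₀ t z)
      (ctrlField b g t (flow (ctrlField b κ) t₀ t z)) ∂γ₀ =
    ∫ a, pairing b (pull (ctrlField b κ) L T t) (stateOf b κ t₀ γ₀ t) a ∂(g t) := by
  have := hg.prob t
  obtain ⟨D, hD0, hD⟩ := hκ.exists_potential_integrand_bound hb hL
  have hc := hκ.continuous_potential_integrand hb hL
  set θ : Vec m → State d₁ d₂ → ℝ := fun a z =>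
    fderiv ℝ (pull (ctrlField b κ) L T t) (flow (ctrlField b κ) t₀ t z)
      (b (flow (ctrlField b κ) t₀ t z).1 a, 0) with hθ
  have hθc : Continuous fun p : State d₁ d₂ × Vec m => θ p.2 p.1 :=
    hc.comp (f := fun p : State d₁ d₂ × Vec m => ((t, p.2), p.1))
      ((continuous_const.prodMk continuous_snd).prodMk continuous_fst)
  have h1 := hg.integrable_pow (k := 1) (by norm_num) t
  simp only [pow_one] at h1
  have hθi : Integrable (fun p : State d₁ d₂ × Vec m => θ p.2 p.1) (γ₀.prod (g t)) := by
    refine (Integrable.mul_prod (f := fun z : State d₁ d₂ => 1 + ‖z‖)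
      (g := fun a : Vec m => D * (1 + ‖a‖)) ((integrable_const 1).add hγ₀)
      (((integrable_const 1).add h1).const_mul D)).mono' hθc.aestronglyMeasurable
      (ae_of_all _ fun p => ?_)
    refine (hD t p.2 p.1).trans (le_of_eq ?_)
    ring
  have h2 : ∀ z, fderiv ℝ (pull (ctrlField b κ) L T t) (flow (ctrlField b κ) t₀ t z)
      (ctrlField b g t (flow (ctrlField b κ) t₀ t z)) = ∫ a, θ a z ∂(g t) := by
    intro z
    have hbi : Integrable (fun a => b (flow (ctrlField b κ) t₀ t z).1 a) (g t) :=
      hg.integrable_of_bound (k := 1) t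
        (hb.cont.comp (Continuous.prodMk_right _)).aestronglyMeasurable (by norm_num)
        (fun a => by simpa using hb.bound _ a)
    have h3 := ((fderiv ℝ (pull (ctrlField b κ) L T t) (flow (ctrlField b κ) t₀ t z)).comp
      (ContinuousLinearMap.inl ℝ (Vec d₁) (Vec d₂))).integral_comp_comm hbi
    simp only [ContinuousLinearMap.comp_apply, ContinuousLinearMap.inl_apply] at h3
    rw [hθ, h3]
    rfl
  simp only [h2]
  refine ⟨hθi.integral_prod_left, ?_⟩
  rw [integral_integral_swap hθi]
  simp only [hκ.pairing_eq hb hL, hθ]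

end IsGoodControl

/-! ### Convex combinations of controls -/

/-- The convex combination `(1 - δ) κ + δ g` of two controls. -/
noncomputable def mixKernel (δ : ℝ) (κ g : Kernel ℝ (Vec m)) : Kernel ℝ (Vec m) where
  toFun t := ENNReal.ofReal (1 - δ) • κ t + ENNReal.ofReal δ • g t
  measurable' := by
    refine Measure.measurable_of_measurable_coe _ fun s hs => ?_
    simp only [Measure.add_apply, Measure.smul_apply, smul_eq_mul]
    exact ((κ.measurable_coe hs).const_mul _).add ((g.measurable_coe hs).const_mul _)

theorem mixKernel_apply (δ : ℝ) (κ g : Kernel ℝ (Vec m)) (t : ℝ) :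
    mixKernel δ κ g t = ENNReal.ofReal (1 - δ) • κ t + ENNReal.ofReal δ • g t := rfl

section Mix

variable {κ g : Kernel ℝ (Vec m)} {t₀ T C δ : ℝ} {b : Vec d₁ → Vec m → Vec d₁}

theorem integral_mixKernel {G : Type*} [NormedAddCommGroup G] [NormedSpace ℝ G] (h0 : 0 ≤ δ)
    (h1 : δ ≤ 1) {f : Vec m → G} {t : ℝ} (hκ : Integrable f (κ t)) (hg : Integrable f (g t)) :
    Integrable f (mixKernel δ κ g t) ∧
      ∫ a, f a ∂(mixKernel δ κ g t) = (1 - δ) • ∫ a, f a ∂(κ t) + δ • ∫ a, f a ∂(g t) := by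
  have hκ' := hκ.smul_measure (c := ENNReal.ofReal (1 - δ)) ENNReal.ofReal_ne_top
  have hg' := hg.smul_measure (c := ENNReal.ofReal δ) ENNReal.ofReal_ne_top
  rw [mixKernel_apply]
  refine ⟨hκ'.add_measure hg', ?_⟩
  rw [integral_add_measure hκ' hg', integral_smul_measure, integral_smul_measure,
    ENNReal.toReal_ofReal h0, ENNReal.toReal_ofReal (by linarith)]

theorem IsGoodControl.mix (hκ : IsGoodControl κ t₀ T) (hg : IsGoodControl g t₀ T) (h0 : 0 ≤ δ)
    (h1 : δ ≤ 1) : IsGoodControl (mixKernel δ κ g) t₀ T := by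
  have hsum : ENNReal.ofReal (1 - δ) + ENNReal.ofReal δ = 1 := by
    rw [← ENNReal.ofReal_add (by linarith) h0]
    simp
  refine ⟨fun t => ⟨?_⟩, fun t ht => ?_, fun t =>
    (integral_mixKernel h0 h1 (hκ.moment t) (hg.moment t)).1, ?_⟩
  · have := hκ.prob t
    have := hg.prob t
    rw [mixKernel_apply]
    simpa using hsum
  · rw [mixKernel_apply, hκ.off t ht, hg.off t ht, ← add_smul, hsum, one_smul]
  · simp only [fun t => (integral_mixKernel h0 h1 (hκ.moment t) (hg.moment t)).2]
    exact (hκ.integrable.smul (1 - δ)).add (hg.integrable.smul δ)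

theorem ctrlField_mix (hκ : IsGoodControl κ t₀ T) (hg : IsGoodControl g t₀ T)
    (hb : HasFieldBounds b C) (h0 : 0 ≤ δ) (h1 : δ ≤ 1) (t : ℝ) (z : State d₁ d₂) :
    ctrlField b (mixKernel δ κ g) t z =
      ctrlField b κ t z + δ • (ctrlField b g t z - ctrlField b κ t z) := by
  have hi : ∀ {η : Kernel ℝ (Vec m)}, IsGoodControl η t₀ T →
      Integrable (fun a => b z.1 a) (η t) := fun hη =>
    hη.integrable_of_bound (k := 1) t
      (hb.cont.comp (Continuous.prodMk_right _)).aestronglyMeasurable (by norm_num)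
      (fun a => by simpa using hb.bound _ a)
  have h2 := (integral_mixKernel h0 h1 (hi hκ) (hi hg)).2
  refine Prod.ext ?_ ?_
  · simp only [ctrlField, avgField, Prod.fst_add, Prod.smul_fst, Prod.fst_sub]
    rw [h2]
    module
  · simp [ctrlField]

end Mix

/-! ### The first-order condition -/

open ProbabilityTheory InformationTheory

section FirstOrder

variable {d₁ d₂ m : ℕ} {κ g : Kernel ℝ (Vec m)} {t₀ T C K K₁ ε : ℝ} {b : Vec d₁ → Vec m → Vec d₁}
  {ℓ : Vec m → ℝ} {L : State d₁ d₂ → ℝ} {γ₀ : Measure (State d₁ d₂)} {ν : ℝ → Measure (Vec m)}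

theorem HasTameGradient.integrable_comp_flow (hL : HasTameGradient L K K₁)
    (hκ : IsGoodControl κ t₀ T) (hb : HasFieldBounds b C) [IsProbabilityMeasure γ₀]
    (hγ₀ : Integrable (fun z => ‖z‖ ^ 2) γ₀) (t : ℝ) :
    Integrable (fun z => L (flow (ctrlField b κ) t₀ t z)) γ₀ := by
  have hF := hκ.isSmoothField (d₂ := d₂) hb
  obtain ⟨B, hB⟩ := hL.exists_c121Bound
  have hprob : IsProbabilityMeasure (γ₀.map (flow (ctrlField b κ) t₀ t)) :=
    Measure.isProbabilityMeasure_map (hF.measurable_flow t₀ t).aemeasurable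
  have h1 : Integrable L (γ₀.map (flow (ctrlField b κ) t₀ t)) := by
    refine (((integrable_const 1).add
      ((hκ.integrable_sq_norm_map_flow hb hγ₀ t).const_mul 2)).const_mul |B|).mono'
      hL.diff.continuous.aestronglyMeasurable (ae_of_all _ fun z => ((hB z).1).trans ?_)
    have h2 := le_sq_norm z
    calc B * (1 + ‖z.1‖ ^ 2 + ‖z.2‖ ^ 2) ≤ |B| * (1 + ‖z.1‖ ^ 2 + ‖z.2‖ ^ 2) := by
          gcongr
          exact le_abs_self B
      _ ≤ _ := by
          simp only [Pi.add_apply, add_assoc]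
          gcongr
  exact h1.comp_measurable (hF.measurable_flow t₀ t)

/-- The cost of a control in terms of its flow. The curve in the definition of the cost is the
push-forward of `γ₀` by the flow, because the continuity equation has a unique solution. -/
theorem cost_eq (hκ : IsGoodControl κ t₀ T) (hb : HasFieldBounds b C)
    (hL : HasTameGradient L K K₁) (h0T : t₀ ≤ T) [IsProbabilityMeasure γ₀]
    (hγ₀ : Integrable (fun z => ‖z‖ ^ 2) γ₀)
    (hν : ∀ᵐ t ∂(volume.restrict (Icc t₀ T)), ν t = κ t) :
    cost b ℓ L ε t₀ T γ₀ ν = ∫ z, L (flow (ctrlField b κ) t₀ T z) ∂γ₀ +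
      ε * (∫⁻ t in Icc t₀ T, klDiv (κ t) (prior ℓ)).toReal := by
  have hF := hκ.isSmoothField (d₂ := d₂) hb
  have h1 : IsContinuitySolution b t₀ T γ₀ ν (stateCurve b t₀ T γ₀ ν) :=
    Classical.epsilon_spec ⟨_, hκ.isContinuitySolution hb hν hγ₀⟩
  rw [cost, hκ.eq_of_isContinuitySolution hb hν h1 T ⟨h0T, le_rfl⟩,
    integral_map (hF.measurable_flow t₀ T).aemeasurable hL.diff.continuous.aestronglyMeasurable]
  congr 3
  exact lintegral_congr_ae (hν.mono fun t ht => by simp only [ht])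

/-- The entropy of a convex combination of controls is at most the combination of the entropies. -/
theorem lintegral_klDiv_mixKernel_le (hκ : IsGoodControl κ t₀ T) (hg : IsGoodControl g t₀ T)
    [IsProbabilityMeasure (prior ℓ)] {δ : ℝ} (h0 : 0 < δ) (h1 : δ < 1) :
    ∫⁻ t in Icc t₀ T, klDiv (mixKernel δ κ g t) (prior ℓ) ≤
      ENNReal.ofReal (1 - δ) * (∫⁻ t in Icc t₀ T, klDiv (κ t) (prior ℓ)) +
        ENNReal.ofReal δ * ∫⁻ t in Icc t₀ T, klDiv (g t) (prior ℓ) := by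
  have : IsMarkovKernel κ := ⟨hκ.prob⟩
  have : IsMarkovKernel g := ⟨hg.prob⟩
  have hm : ∀ η : Kernel ℝ (Vec m), IsMarkovKernel η →
      Measurable fun t => klDiv (η t) (prior ℓ) := fun η _ =>
    measurable_klDiv_kernel η (Kernel.const ℝ (prior ℓ))
  rw [← lintegral_const_mul _ (hm κ inferInstance), ← lintegral_const_mul _ (hm g inferInstance),
    ← lintegral_add_left ((hm κ inferInstance).const_mul _)]
  exact lintegral_mono fun t => klDiv_convex_comb_le h0 h1

theorem mixKernel_mem_admissibleControls (hκ : IsGoodControl κ t₀ T) (hg : IsGoodControl g t₀ T)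
    [IsProbabilityMeasure (prior ℓ)] {δ : ℝ} (h0 : 0 < δ) (h1 : δ < 1)
    (hκfin : ∫⁻ t in Icc t₀ T, klDiv (κ t) (prior ℓ) < ⊤)
    (hgfin : ∫⁻ t in Icc t₀ T, klDiv (g t) (prior ℓ) < ⊤) :
    (fun t => mixKernel δ κ g t) ∈ AdmissibleControls ℓ t₀ T := by
  refine ⟨fun t _ => (hκ.mix hg h0.le h1.le).prob t,
    (mixKernel δ κ g).measurable.comp measurable_subtype_coe,
    (lintegral_klDiv_mixKernel_le hκ hg h0 h1).trans_lt ?_⟩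
  exact ENNReal.add_lt_top.mpr ⟨ENNReal.mul_lt_top ENNReal.ofReal_lt_top hκfin,
    ENNReal.mul_lt_top ENNReal.ofReal_lt_top hgfin⟩

/-- The directional derivative of the cost at a minimizer is nonnegative: moving the minimizer
towards another control of finite entropy changes the terminal cost at first order by the difference
of the mean potentials, and the entropy by at most the difference of the entropies. -/
theorem IsMinimizer.variation_nonneg (hmin : IsMinimizer b ℓ L ε t₀ T γ₀ ν) (hε : 0 < ε)
    (h0T : t₀ ≤ T) (hκ : IsGoodControl κ t₀ T) (hg : IsGoodControl g t₀ T)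
    (hb : HasFieldBounds b C) (hL : HasTameGradient L K K₁) [IsProbabilityMeasure (prior ℓ)]
    [IsProbabilityMeasure γ₀] (hγ₀ : Integrable (fun z => ‖z‖ ^ 2) γ₀)
    (hν : ∀ᵐ t ∂(volume.restrict (Icc t₀ T)), ν t = κ t)
    (hκfin : ∫⁻ t in Icc t₀ T, klDiv (κ t) (prior ℓ) < ⊤)
    (hgfin : ∫⁻ t in Icc t₀ T, klDiv (g t) (prior ℓ) < ⊤) :
    0 ≤ (∫ t in Icc t₀ T,
        (∫ a, pairing b (pull (ctrlField b κ) L T t) (stateOf b κ t₀ γ₀ t) a ∂(g t) -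
          ∫ a, pairing b (pull (ctrlField b κ) L T t) (stateOf b κ t₀ γ₀ t) a ∂(κ t))) +
      ε * ((∫⁻ t in Icc t₀ T, klDiv (g t) (prior ℓ)).toReal -
        (∫⁻ t in Icc t₀ T, klDiv (κ t) (prior ℓ)).toReal) := by
  have hγ₁ := integrable_norm_of_sq hγ₀
  have hF := hκ.isSmoothField (d₂ := d₂) hb
  -- the mixture weight stays in `(0, 1)` and tends to zero
  set δ : ℕ → ℝ := fun n => 1 / ((n : ℝ) + 2) with hδ
  have hδ0 : ∀ n, 0 < δ n := fun n => by positivity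
  have hδ1 : ∀ n, δ n < 1 := fun n => by
    rw [hδ, div_lt_one (by positivity)]
    have : (0 : ℝ) ≤ n := Nat.cast_nonneg n
    linarith
  have hδlim : Tendsto δ atTop (𝓝 0) := by
    have h1 := (tendsto_one_div_add_atTop_nhds_zero_nat (𝕜 := ℝ)).comp (tendsto_add_atTop_nat 1)
    refine h1.congr fun n => ?_
    simp only [Function.comp_apply, hδ]
    push_cast
    ring_nf
  have hmix : ∀ n, IsGoodControl (mixKernel (δ n) κ g) t₀ T := fun n =>
    hκ.mix hg (hδ0 n).le (hδ1 n).le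
  have hlim := hF.tendsto_variation (hg.isSmoothField (d₂ := d₂) hb) hL hγ₁ h0T hδ0
    (fun n => (hδ1 n).le) hδlim (Fs := fun n => ctrlField (d₂ := d₂) b (mixKernel (δ n) κ g))
    (fun n => (hmix n).isSmoothField hb)
    (fun n t z => ctrlField_mix hκ hg hb (hδ0 n).le (hδ1 n).le t z)
  have hlim' := hlim.add_const (ε * ((∫⁻ t in Icc t₀ T, klDiv (g t) (prior ℓ)).toReal -
        (∫⁻ t in Icc t₀ T, klDiv (κ t) (prior ℓ)).toReal))
  -- the limit is the claimed quantity, and minimality makes each term of the sequence nonnegative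
  have hge := ge_of_tendsto' hlim' (b := 0) fun n => ?_
  · rw [← integral_Icc_eq_integral_Ioc] at hge
    refine hge.trans (le_of_eq (congrArg (· + _) ?_))
    refine integral_congr_ae (ae_of_all _ fun t => ?_)
    have h1 := hκ.integral_fderiv_ctrlField hg hb hL hγ₁ t
    have h2 := hκ.integral_fderiv_ctrlField hκ hb hL hγ₁ t
    simp only [map_sub]
    rw [← h1.2, ← h2.2, integral_sub h1.1 h2.1]
  · have h1 := hmin.2 _ (mixKernel_mem_admissibleControls hκ hg (hδ0 n) (hδ1 n) hκfin hgfin)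
    rw [cost_eq hκ hb hL h0T hγ₀ hν,
      cost_eq (hmix n) hb hL h0T hγ₀ (ae_of_all _ fun _ => rfl)] at h1
    have h2 := ENNReal.toReal_mono (by finiteness)
      (lintegral_klDiv_mixKernel_le hκ hg (ℓ := ℓ) (hδ0 n) (hδ1 n))
    rw [ENNReal.toReal_add (by finiteness) (by finiteness), ENNReal.toReal_mul, ENNReal.toReal_mul,
      ENNReal.toReal_ofReal (hδ0 n).le, ENNReal.toReal_ofReal (by linarith [hδ1 n])] at h2
    rw [integral_sub (hL.integrable_comp_flow (hmix n) hb hγ₀ T)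
      (hL.integrable_comp_flow hκ hb hγ₀ T)]
    set Kκ := (∫⁻ t in Icc t₀ T, klDiv (κ t) (prior ℓ)).toReal
    set Kg := (∫⁻ t in Icc t₀ T, klDiv (g t) (prior ℓ)).toReal
    have h3 := mul_le_mul_of_nonneg_left h2 hε.le
    have h4 : 0 ≤ δ n * ((δ n)⁻¹ * (∫ z, L (flow (ctrlField b (mixKernel (δ n) κ g)) t₀ T z) ∂γ₀ -
        ∫ z, L (flow (ctrlField b κ) t₀ T z) ∂γ₀) + ε * (Kg - Kκ)) := by
      rw [mul_add, ← mul_assoc, mul_inv_cancel₀ (hδ0 n).ne']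
      linarith
    exact nonneg_of_mul_nonneg_right h4 (hδ0 n)

end FirstOrder

/-! ### Minimizers are Gibbs measures -/

open ProbabilityTheory InformationTheory

section Minimizer

variable {d₁ d₂ m : ℕ} {κ : Kernel ℝ (Vec m)} {t₀ T C K K₁ ε B : ℝ}
  {b : Vec d₁ → Vec m → Vec d₁} {ℓ : Vec m → ℝ} {L : State d₁ d₂ → ℝ}
  {γ₀ : Measure (State d₁ d₂)} {ν : ℝ → Measure (Vec m)}

theorem IsGoodControl.integrable_of_linear (hκ : IsGoodControl κ t₀ T) {f : Vec m → ℝ}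
    (hf : Continuous f) (hfB : ∀ a, |f a| ≤ B * (1 + ‖a‖)) (t : ℝ) : Integrable f (κ t) :=
  hκ.integrable_of_bound (k := 1) t hf.aestronglyMeasurable (by norm_num)
    fun a => by simpa using hfB a

theorem IsGoodControl.integrableOn_integral (hκ : IsGoodControl κ t₀ T) {f : ℝ → Vec m → ℝ}
    (hf : Continuous fun p : ℝ × Vec m => f p.1 p.2) (hfB : ∀ t a, |f t a| ≤ B * (1 + ‖a‖)) :
    IntegrableOn (fun t => ∫ a, f t a ∂(κ t)) (Icc t₀ T) := by
  have : IsMarkovKernel κ := ⟨hκ.prob⟩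
  have h1 := hκ.integrable_norm_pow (k := 1) (by norm_num)
  refine (((Integrable.add (integrable_const 1) h1).const_mul B)).mono'
    (StronglyMeasurable.integral_kernel_prod_right (κ := κ) (f := f)
      hf.stronglyMeasurable).aestronglyMeasurable (ae_of_all _ fun t => ?_)
  exact hκ.norm_integral_le t (by norm_num) fun a => by simpa using hfB t a

/-- The Gibbs variational principle: the free energy exceeds its minimum by the relative entropy
with respect to the Gibbs measure. -/
theorem toReal_klDiv_gibbs {ν g : Measure (Vec m)} [IsProbabilityMeasure ν]
    [IsProbabilityMeasure (prior ℓ)] {f : Vec m → ℝ}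
    (hexp : Integrable (fun a => Real.exp (f a)) (prior ℓ)) (hg : g = (prior ℓ).tilted f)
    (hν : klDiv ν (prior ℓ) ≠ ⊤) (hfν : Integrable f ν) (hfg : Integrable f g) :
    klDiv ν g ≠ ⊤ ∧ (klDiv ν g).toReal = (klDiv ν (prior ℓ)).toReal - (klDiv g (prior ℓ)).toReal +
      (∫ a, f a ∂g - ∫ a, f a ∂ν) := by
  subst hg
  obtain ⟨h1, h2⟩ := klDiv_tilted_right hν hfν hexp
  obtain ⟨-, h3⟩ := klDiv_tilted_left hexp hfg
  exact ⟨h1, by linarith⟩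

/-- A minimizer is, at almost every time, the Gibbs measure of its own potential: the first-order
condition in the direction of the Gibbs control says that the relative entropy with respect to the
Gibbs control has a nonpositive integral in time. -/
theorem IsMinimizer.ae_eq_gibbs (hmin : IsMinimizer b ℓ L ε t₀ T γ₀ ν) (hε : 0 < ε)
    (h0T : t₀ ≤ T) (hκ : IsGoodControl κ t₀ T) (hb : HasFieldBounds b C)
    (hL : HasTameGradient L K K₁) (hℓc : Continuous ℓ) {c A : ℝ} (hc0 : 0 < c)
    (hℓ : ∀ a, c * ‖a‖ ^ 4 - A ≤ ℓ a) [IsProbabilityMeasure γ₀]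
    (hγ₀ : Integrable (fun z => ‖z‖ ^ 2) γ₀)
    (hν : ∀ᵐ t ∂(volume.restrict (Icc t₀ T)), ν t = κ t) :
    ∀ᵐ t ∂(volume.restrict (Icc t₀ T)), κ t = (prior ℓ).tilted fun a =>
      -(1 / ε * pairing b (pull (ctrlField b κ) L T t) (stateOf b κ t₀ γ₀ t) a) := by
  have hpr := isProbabilityMeasure_prior hℓc hc0 hℓ
  have hγ₁ := integrable_norm_of_sq hγ₀
  set P : ℝ → Vec m → ℝ := fun t a =>
    pairing b (pull (ctrlField b κ) L T t) (stateOf b κ t₀ γ₀ t) a with hP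
  have hPc : Continuous fun p : ℝ × Vec m => P p.1 p.2 := hκ.continuous_pairing hb hL hγ₁
  obtain ⟨B, hB0, hB⟩ : ∃ B, 0 ≤ B ∧ ∀ t a, |P t a| ≤ B * (1 + ‖a‖) :=
    hκ.exists_pairing_bound hb hL hγ₁
  set f : ℝ → Vec m → ℝ := fun t a => -(1 / ε * P t a) with hf
  have hfc : Continuous fun p : ℝ × Vec m => f p.1 p.2 := (continuous_const.mul hPc).neg
  have hfB : ∀ t a, |f t a| ≤ 1 / ε * B * (1 + ‖a‖) := fun t a => by
    rw [hf, abs_neg, abs_mul, abs_of_pos (by positivity : 0 < 1 / ε), mul_assoc]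
    exact mul_le_mul_of_nonneg_left (hB t a) (by positivity)
  have hft : ∀ t, Continuous (f t) := fun t => hfc.comp (Continuous.prodMk_right t)
  have hPt : ∀ t, Continuous (P t) := fun t => hPc.comp (Continuous.prodMk_right t)
  obtain ⟨g, hg, hgeq, hgfin⟩ := exists_gibbs_control hℓc hc0 hℓ hfc hfB t₀ T
  have hκfin : ∫⁻ t in Icc t₀ T, klDiv (κ t) (prior ℓ) < ⊤ := by
    rw [← lintegral_congr_ae (hν.mono fun t ht => by simp only [ht] :
      (fun t => klDiv (ν t) (prior ℓ)) =ᵐ[volume.restrict (Icc t₀ T)] _)]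
    exact hmin.1.2.2
  have hvar := hmin.variation_nonneg hε h0T hκ hg hb hL hγ₀ hν hκfin hgfin
  have : IsMarkovKernel κ := ⟨hκ.prob⟩
  have : IsMarkovKernel g := ⟨hg.prob⟩
  have hκm : Measurable fun t => klDiv (κ t) (prior ℓ) :=
    measurable_klDiv_kernel κ (Kernel.const ℝ (prior ℓ))
  have hgm : Measurable fun t => klDiv (g t) (prior ℓ) :=
    measurable_klDiv_kernel g (Kernel.const ℝ (prior ℓ))
  have hκi := integrable_toReal_of_lintegral_ne_top hκm.aemeasurable hκfin.ne
  have hgi := integrable_toReal_of_lintegral_ne_top hgm.aemeasurable hgfin.ne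
  have hκlt := ae_lt_top hκm hκfin.ne
  have hglt := ae_lt_top hgm hgfin.ne
  have hD := (hg.integrableOn_integral hPc hB).sub (hκ.integrableOn_integral hPc hB)
  -- pointwise in time, the relative entropy of `κ t` with respect to the Gibbs measure
  have hkl : ∀ᵐ t ∂(volume.restrict (Icc t₀ T)), klDiv (κ t) (g t) ≠ ⊤ ∧
      (klDiv (κ t) (g t)).toReal = (klDiv (κ t) (prior ℓ)).toReal - (klDiv (g t) (prior ℓ)).toReal -
        1 / ε * (∫ a, P t a ∂(g t) - ∫ a, P t a ∂(κ t)) := by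
    filter_upwards [hκlt, ae_restrict_mem measurableSet_Icc] with t ht htI
    have hexp : Integrable (fun a => Real.exp (f t a)) (prior ℓ) := by
      obtain ⟨_, _, hM⟩ := exists_gibbs_bounds (m := m) hℓc hc0 hℓ
        (by positivity : 0 ≤ 1 / ε * B)
      exact (hM (f t) (hft t) (hfB t)).1
    obtain ⟨h1, h2⟩ := toReal_klDiv_gibbs hexp (hgeq t htI) ht.ne
      (hκ.integrable_of_linear (hft t) (hfB t) t) (hg.integrable_of_linear (hft t) (hfB t) t)
    refine ⟨h1, h2.trans ?_⟩
    simp only [hf, integral_neg, integral_const_mul]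
    ring
  have hint : IntegrableOn (fun t => (klDiv (κ t) (g t)).toReal) (Icc t₀ T) :=
    ((hκi.sub hgi).sub (hD.const_mul (1 / ε))).congr (hkl.mono fun t ht => ht.2.symm)
  have hle : ∫ t in Icc t₀ T, (klDiv (κ t) (g t)).toReal ≤ 0 := by
    rw [integral_congr_ae (hkl.mono fun t ht => ht.2)]
    have h1 := integral_sub (hκi.sub hgi) (hD.const_mul (1 / ε))
    have h2 := integral_sub hκi hgi
    simp only [Pi.sub_apply] at h1 h2
    rw [h1, h2, integral_const_mul, integral_toReal hκm.aemeasurable hκlt,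
      integral_toReal hgm.aemeasurable hglt]
    set I := ∫ t in Icc t₀ T, (∫ a, P t a ∂(g t) - ∫ a, P t a ∂(κ t))
    set Kκ := (∫⁻ t in Icc t₀ T, klDiv (κ t) (prior ℓ)).toReal
    set Kg := (∫⁻ t in Icc t₀ T, klDiv (g t) (prior ℓ)).toReal
    have h3 : 0 ≤ I + ε * (Kg - Kκ) := hvar
    -- up to the factor `-1 / ε`, this is the first variation
    have h4 : Kκ - Kg - 1 / ε * I = -(1 / ε * (I + ε * (Kg - Kκ))) := by
      field_simp
      ring
    rw [h4]
    have : 0 ≤ 1 / ε * (I + ε * (Kg - Kκ)) := by positivity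
    linarith
  have hnn : 0 ≤ fun t => (klDiv (κ t) (g t)).toReal := fun t => ENNReal.toReal_nonneg
  have hzero := (integral_eq_zero_iff_of_nonneg hnn hint).mp
    (le_antisymm hle (integral_nonneg hnn))
  filter_upwards [hzero, hkl, ae_restrict_mem measurableSet_Icc] with t h1 h2 h3
  have h4 : klDiv (κ t) (g t) = 0 :=
    ((ENNReal.toReal_eq_zero_iff _).mp h1).resolve_right h2.1
  rw [klDiv_eq_zero_iff] at h4
  rw [h4, hgeq t h3]

end Minimizer

end MeanFieldResNet

theorem mainTheorem3 {d₁ d₂ m : ℕ} (hd₁ : 1 ≤ d₁) (hd₂ : 1 ≤ d₂) (hm : 1 ≤ m)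
    (b : MeanFieldResNet.Vec d₁ → MeanFieldResNet.Vec m → MeanFieldResNet.Vec d₁)
    (ℓ : MeanFieldResNet.Vec m → ℝ) (L : MeanFieldResNet.State d₁ d₂ → ℝ)
    (hreg : MeanFieldResNet.Regularity b ℓ L)
    (ε T : ℝ) (hε : 0 < ε) (hT : 0 < T)
    (t₀ : ℝ) (ht₀ : t₀ ∈ Icc 0 T)
    (γ₀ : Measure (MeanFieldResNet.State d₁ d₂)) (hγ₀ : MeanFieldResNet.InP 3 γ₀)
    (ν : ℝ → Measure (MeanFieldResNet.Vec m))
    (hν : MeanFieldResNet.IsMinimizer b ℓ L ε t₀ T γ₀ ν) :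
    ∃ (γ : ℝ → Measure (MeanFieldResNet.State d₁ d₂))
      (u : ℝ → MeanFieldResNet.State d₁ d₂ → ℝ)
      (ρ : ℝ → MeanFieldResNet.Vec m → ℝ) (z : ℝ → ℝ),
      -- `γ` is the solution of the continuity equation started from `(t₀, γ₀)`, driven by `ν`
      MeanFieldResNet.IsContinuitySolution b t₀ T γ₀ ν γ ∧
      (∀ γ', MeanFieldResNet.IsContinuitySolution b t₀ T γ₀ ν γ' → EqOn γ' γ (Icc t₀ T)) ∧
      -- `u` is the solution of the transport equation with terminal data `L`, driven by `ν`
      MeanFieldResNet.IsTransportSolution b L t₀ T ν u ∧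
      (∀ u', MeanFieldResNet.IsTransportSolution b L t₀ T ν u' → EqOn u' u (Icc t₀ T)) ∧
      -- the integrals in the Gibbs formula converge, and `z t` is the normalizing constant
      (∀ t ∈ Icc t₀ T, ∀ a,
        Integrable (fun q => inner ℝ (b q.1 a) (MeanFieldResNet.gradX (u t) q)) (γ t)) ∧
      (∀ t ∈ Icc t₀ T,
        Integrable (MeanFieldResNet.gibbsWeight b ℓ ε (u t) (γ t)) volume ∧
        z t = ∫ a, MeanFieldResNet.gibbsWeight b ℓ ε (u t) (γ t) a ∧ 0 < z t) ∧
      -- the density has the Gibbs form for every `(t, a)` and is jointly continuous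
      (∀ t ∈ Icc t₀ T, ∀ a,
        ρ t a = 1 / z t * MeanFieldResNet.gibbsWeight b ℓ ε (u t) (γ t) a) ∧
      ContinuousOn (fun p : ℝ × MeanFieldResNet.Vec m => ρ p.1 p.2) (Icc t₀ T ×ˢ univ) ∧
      -- `ρ` is the density of `ν` (a control is determined up to a Lebesgue-null set of times)
      ∀ᵐ t ∂(volume.restrict (Icc t₀ T)),
        ν t = volume.withDensity (fun a => ENNReal.ofReal (ρ t a)) := by
  open MeanFieldResNet in
  obtain ⟨C, hb⟩ := hreg.exists_fieldBounds
  obtain ⟨K, K₁, hL⟩ := hreg.exists_tame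
  have hℓc : Continuous ℓ := hreg.ell_smooth.continuous
  obtain ⟨c, A, hc0, hℓ⟩ := exists_quartic_lower_bound hreg.ell_smooth hreg.ell_hessian
  -- the equations only see the control up to a null set of times
  obtain ⟨κ, hκ, hνκ⟩ := exists_goodControl hℓc hc0 hℓ hν.1
  have hprob : IsProbabilityMeasure γ₀ := hγ₀.1
  have hγ₂ := hγ₀.integrable_sq_norm (by norm_num)
  have hγ₁ := integrable_norm_of_sq hγ₂
  set u := pull (ctrlField (d₂ := d₂) b κ) L T with hu
  set γ := stateOf b κ t₀ γ₀ with hγ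
  set f : ℝ → Vec m → ℝ := fun t a => -(1 / ε * pairing b (u t) (γ t) a) with hf
  have hw : ∀ t a, gibbsWeight b ℓ ε (u t) (γ t) a = Real.exp (-ℓ a + f t a) := fun t a => by
    rw [gibbsWeight, sub_eq_add_neg]
    rfl
  have hfc : Continuous fun p : ℝ × Vec m => f p.1 p.2 :=
    (continuous_const.mul (hκ.continuous_pairing hb hL hγ₁)).neg
  obtain ⟨B, hB0, hB⟩ := hκ.exists_pairing_bound hb hL hγ₁
  have hfB : ∀ t a, |f t a| ≤ 1 / ε * B * (1 + ‖a‖) := fun t a => by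
    rw [hf, abs_neg, abs_mul, abs_of_pos (by positivity : 0 < 1 / ε), mul_assoc]
    exact mul_le_mul_of_nonneg_left (hB t a) (by positivity)
  have hwi : ∀ t, Integrable fun a => Real.exp (-ℓ a + f t a) := fun t =>
    integrable_exp_neg_add_of_linear hℓc hc0 hℓ (hfc.comp (Continuous.prodMk_right t)) (hfB t)
  have hzpos : ∀ t, 0 < ∫ a, Real.exp (-ℓ a + f t a) := fun t => integral_exp_pos (hwi t)
  refine ⟨γ, u, fun t a => 1 / (∫ a, Real.exp (-ℓ a + f t a)) * Real.exp (-ℓ a + f t a),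
    fun t => ∫ a, Real.exp (-ℓ a + f t a), hκ.isContinuitySolution hb hνκ hγ₂,
    fun γ' hγ' t ht => hκ.eq_of_isContinuitySolution hb hνκ hγ' t ht,
    hκ.isTransportSolution hb hνκ hL,
    fun u' hu' t ht => hκ.eq_of_isTransportSolution hb hνκ hu' ht₀.2 t ht,
    fun t _ a => hκ.integrable_inner_gradX hb hL hγ₁ t a, fun t _ => ?_, fun t _ a => ?_, ?_, ?_⟩
  · simp only [hw]
    exact ⟨hwi t, trivial, hzpos t⟩
  · rw [hw]
  · refine Continuous.continuousOn (Continuous.mul (continuous_const.div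
      ((continuous_partition hℓc hc0 hℓ hfc hfB).comp continuous_fst) fun p => (hzpos p.1).ne') ?_)
    fun_prop
  · filter_upwards [hνκ, hν.ae_eq_gibbs hε ht₀.2 hκ hb hL hℓc hc0 hℓ hγ₂ hνκ] with t h1 h2
    have h3 : κ t = (prior ℓ).tilted (f t) := h2
    rw [h1, h3, prior_tilted_eq_withDensity (integrable_exp_neg hℓc hc0 hℓ)]
    simp only [one_div_mul_eq_div]
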